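/- Let $X=(X_t)_{t\in\mathbb R}$ be a centered Gaussian process with continuous sample paths, $R(s,t)=\mathrm E(X_sX_t)$, and let $-\infty<a<b<\infty$. Assume one of the following. (a) (1) $R(s,t)=\sum_{m,n\ge 0} r_{mn}s^mt^n$ for all $s,t\in\mathbb R$, for some real $r_{mn}$ (an absolutely convergent double power series); (2) for every compact interval $[c,d]$ and every Borel probability measure $\nu$ on $[c,d]$, $\iint R(s,t)\,\nu(ds)\,\nu(dt)>0$; (3) the sample paths of $X$ are infinitely differentiable and the covariance matrix of every finite subfamily of $(X^{(n)}_t: t\in\mathbb R,\ n\ge 0)$ is non-singular; (4) $\limsup_{t\to\infty}R(s,t)\le 0$ for every $s\in[a,b]$, and $R$ is bounded above on $[a,b]\times[T,\infty)$ for some $T$. (b) $X$ is stationary, $R(s,t)=\int e^{i(t-s)x}F(dx)$ with a finite symmetric Borel measure $F$ on $\mathbb R$ such that $\int e^{tx}F(dx)<\infty$ for all $t\in\mathbb R$ and the support of $F$ has an accumulation point. Then the problem of minimizing $\iint R(s,t)\,\nu(ds)\,\nu(dt)$ over all Borel probability measures $\nu$ on $[a,b]$ has a unique solution $\nu_*$;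 its support $S=\{t_1<\dots<t_k\}$ is finite and the minimal value $V_*$ is positive. Let $\Sigma$ be the covariance matrix of $(X_{t_1},\dots,X_{t_k})$, $\theta=\Sigma^{-1}(1,\dots,1)^T$, $\mu(t)=\mathrm E(X_t\mid X_s=1\text{ for all }s\in S)$ and $Z_t=X_t-\mathrm E(X_t\mid X_s,\,s\in S)$, in the version with smooth paths. Then $\det\Sigma>0$, $\theta_1,\dots,\theta_k>0$, and the set $E=\{t\in[a,b]:\mu(t)=1\}$ is finite. Define, with the convention $\exp(-c/0)=0$, $$W_{(a,b)}=\prod_{j:\,t_j\in(a,b)}\exp\Bigl\{-\frac{\theta_j}{2\mu''(t_j)}\bigl(Z'_{t_j}\bigr)^2\Bigr\};$$ $$W_a=\mathbf 1(Z'_a>0)+\exp\Bigl\{-\frac{\theta_1}{2\mu''(a)}(Z'_a)^2\Bigr\}\mathbf 1(Z'_a<0)\quad\text{if } t_1=a \text{ and } \mu'(a)=0,\qquad W_a=1\text{ otherwise};$$ $$W_b=\mathbf 1(Z'_b<0)+\exp\Bigl\{-\frac{\theta_k}{2\mu''(b)}(Z'_b)^2\Bigr\}\mathbf 1(Z'_b>0)\quad\text{if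 } t_k=b \text{ and } \mu'(b)=0,\qquad W_b=1\text{ otherwise};$$ $$W=W_{(a,b)}W_aW_b\prod_{t\in E\setminus S}\mathbf 1(Z_t>0).$$ Write $f(u)\sim c\,g(u)$ for $\lim_{u\to\infty}f(u)/g(u)=c$, where $g$ does not vanish and $c=0$ is allowed. Then, as $u\to\infty$, $$\mathrm P\Bigl(\min_{t\in[a,b]}X_t>u\Bigr)\sim \mathrm E(W)\,\mathrm P\Bigl(\min_{t\in S}X_t>u\Bigr),$$ $$\mathrm P\Bigl(\min_{t\in[a,b]}X_t>u\Bigr)\sim\frac{\mathrm E(W)}{(2\pi)^{k/2}\,\theta_1\cdots\theta_k\,(\det\Sigma)^{1/2}}\;u^{-k}\exp\Bigl(-\frac{u^2}{2V_*}\Bigr).$$ Moreover, $\mathrm E(W)>0$ if and only if $\mu''(t)>0$ for all $t\in S\cap(a,b)$. -/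

import Mathlib

open MeasureTheory ProbabilityTheory Filter Topology Set
open scoped Matrix

noncomputable section

namespace HighMinima

/-- The covariance function `R(s,t) = E(X_s X_t)` of a centered process. -/
def covFn {Ω : Type*} [MeasurableSpace Ω] (X : ℝ → Ω → ℝ) (P : Measure Ω) (s t : ℝ) : ℝ :=
  ∫ ω, X s ω * X t ω ∂P

/-- Centered Gaussian process on the line with (almost surely) continuous sample paths. -/
structure IsCenteredContinuousGaussian {Ω : Type*} [MeasurableSpace Ω]
    (X : ℝ → Ω → ℝ) (P : Measure Ω) : Prop where
  gaussian : IsGaussianProcess X P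
  measurable : ∀ t, Measurable (X t)
  centered : ∀ t, ∫ ω, X t ω ∂P = 0
  continuous_paths : ∀ᵐ ω ∂P, Continuous fun t => X t ω

/-- The Borel probability measures on the line that are concentrated on `[a,b]`. -/
def probOn (a b : ℝ) : Set (Measure ℝ) :=
  {ν | IsProbabilityMeasure ν ∧ ν (Icc a b)ᶜ = 0}

/-- `∬ R(s,t) ν(ds) ν(dt)`. -/
def energy (R : ℝ → ℝ → ℝ) (ν : Measure ℝ) : ℝ :=
  ∫ t, ∫ s, R s t ∂ν ∂ν

/-- `ν` solves the problem of minimizing the energy over the probability measures on `[a,b]`. -/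
def IsOptimal (R : ℝ → ℝ → ℝ) (a b : ℝ) (ν : Measure ℝ) : Prop :=
  ν ∈ probOn a b ∧ IsMinOn (energy R) (probOn a b) ν

/-- `R` is the sum of a double power series on all of `ℝ × ℝ`. -/
def HasPowerExpansion (R : ℝ → ℝ → ℝ) : Prop :=
  ∃ r : ℕ → ℕ → ℝ, ∀ s t : ℝ,
    HasSum (fun p : ℕ × ℕ => r p.1 p.2 * s ^ p.1 * t ^ p.2) (R s t)

/-- Non-negative non-degeneracy on every compact interval. -/
def NonnegNondegenerate (R : ℝ → ℝ → ℝ) : Prop :=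
  ∀ c d : ℝ, ∀ ν ∈ probOn c d, 0 < energy R ν

/-- The sample paths are infinitely differentiable, and every finite family of distinct
variables `X_t^{(n)}` has a non-singular covariance matrix. -/
def SmoothNondegenerate {Ω : Type*} [MeasurableSpace Ω] (X : ℝ → Ω → ℝ) (P : Measure Ω) : Prop :=
  (∀ᵐ ω ∂P, ContDiff ℝ ((⊤ : ℕ∞) : WithTop ℕ∞) fun t => X t ω) ∧
  ∀ I : Finset (ℝ × ℕ),
    (Matrix.of fun p q : I =>
      cov[fun ω => iteratedDeriv p.1.2 (fun t => X t ω) p.1.1,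
          fun ω => iteratedDeriv q.1.2 (fun t => X t ω) q.1.1; P]).det ≠ 0

/-- The first set of assumptions. The upper bound on `R` in `bddAbove` is what makes the
pointwise condition `limsup_nonpos` integrable in `s`; without it an optimal measure can have
infinite support. -/
structure AssumptionA {Ω : Type*} [MeasurableSpace Ω] (X : ℝ → Ω → ℝ) (P : Measure Ω)
    (a b : ℝ) : Prop where
  power : HasPowerExpansion (covFn X P)
  nonneg_nondegenerate : NonnegNondegenerate (covFn X P)
  smooth_nondegenerate : SmoothNondegenerate X P
  limsup_nonpos : ∀ s ∈ Icc a b, limsup (fun t : ℝ => (covFn X P s t : EReal)) atTop ≤ 0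
  bddAbove : ∃ M : ℝ, ∀ᶠ t in atTop, ∀ s ∈ Icc a b, covFn X P s t ≤ M

/-- The second set of assumptions: `X` is stationary with a spectral measure all of whose
exponential moments are finite and whose support has an accumulation point. For a centered
Gaussian process, stationarity means that `R(s,t)` depends on `t - s` only, which the spectral
representation contains. -/
def AssumptionB {Ω : Type*} [MeasurableSpace Ω] (X : ℝ → Ω → ℝ) (P : Measure Ω) : Prop :=
  ∃ F : Measure ℝ, IsFiniteMeasure F ∧ F.map (fun x => -x) = F ∧
    (∀ s t : ℝ, (covFn X P s t : ℂ) = ∫ x : ℝ, Complex.exp (Complex.I * (t - s) * x) ∂F) ∧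
    (∀ t : ℝ, Integrable (fun x : ℝ => Real.exp (t * x)) F) ∧
    ∃ x : ℝ, AccPt x (𝓟 F.support)

/-- Covariance matrix of `(X_s, s ∈ S)`. -/
def covMatrix (R : ℝ → ℝ → ℝ) (S : Finset ℝ) : Matrix S S ℝ :=
  Matrix.of fun s t : S => R s t

/-- `θ = Σ⁻¹ 𝟏`. -/
def theta (R : ℝ → ℝ → ℝ) (S : Finset ℝ) : S → ℝ :=
  (covMatrix R S)⁻¹ *ᵥ 1

/-- The Gaussian regression function `E(X_t | X_s = x_s for all s ∈ S) = (R(t,s))_s Σ⁻¹ x`. -/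
def regression (R : ℝ → ℝ → ℝ) (S : Finset ℝ) (t : ℝ) (x : S → ℝ) : ℝ :=
  (fun s : S => R t s) ⬝ᵥ ((covMatrix R S)⁻¹ *ᵥ x)

/-- `μ(t) = E(X_t | X_s = 1 for all s ∈ S)`. -/
def mu (R : ℝ → ℝ → ℝ) (S : Finset ℝ) (t : ℝ) : ℝ :=
  regression R S t 1

/-- The essential set `{t ∈ [a,b] : μ(t) = 1}`. -/
def essentialSet (R : ℝ → ℝ → ℝ) (S : Finset ℝ) (a b : ℝ) : Set ℝ :=
  {t ∈ Icc a b | mu R S t = 1}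

section paths

variable {Ω : Type*} [MeasurableSpace Ω]

/-- `Y_t = E(X_t | X_s, s ∈ S)`, in the version with smooth sample paths. -/
def procY (X : ℝ → Ω → ℝ) (P : Measure Ω) (S : Finset ℝ) (t : ℝ) (ω : Ω) : ℝ :=
  regression (covFn X P) S t fun s => X s ω

/-- `Z_t = X_t - Y_t`. -/
def procZ (X : ℝ → Ω → ℝ) (P : Measure Ω) (S : Finset ℝ) (t : ℝ) (ω : Ω) : ℝ :=
  X t ω - procY X P S t ω

/-- The derivative `Z_t^{(1)}` of the sample path of `Z`. -/
def derivZ (X : ℝ → Ω → ℝ) (P : Measure Ω) (S : Finset ℝ) (t : ℝ) (ω : Ω) : ℝ :=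
  deriv (fun s => procZ X P S s ω) t

/-- `exp(-θ z² / (2m))`, read as `0` when `m = 0`. -/
def expFactor (θ m z : ℝ) : ℝ :=
  if m = 0 then 0 else Real.exp (-(θ / (2 * m) * z ^ 2))

/-- The contribution `W_{(a,b)}` of the interior points of `S`. -/
def wInt (X : ℝ → Ω → ℝ) (P : Measure Ω) (S : Finset ℝ) (a b : ℝ) (ω : Ω) : ℝ :=
  ∏ s : S, if (s : ℝ) ∈ Ioo a b then
    expFactor (theta (covFn X P) S s) (iteratedDeriv 2 (mu (covFn X P) S) s) (derivZ X P S s ω)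
  else 1

/-- The contribution `W_a` of the left endpoint. -/
def wLeft (X : ℝ → Ω → ℝ) (P : Measure Ω) (S : Finset ℝ) (a : ℝ) (ω : Ω) : ℝ :=
  if h : a ∈ S ∧ deriv (mu (covFn X P) S) a = 0 then
    if 0 < derivZ X P S a ω then 1
    else if derivZ X P S a ω < 0 then
      expFactor (theta (covFn X P) S ⟨a, h.1⟩) (iteratedDeriv 2 (mu (covFn X P) S) a)
        (derivZ X P S a ω)
    else 0
  else 1

/-- The contribution `W_b` of the right endpoint. -/
def wRight (X : ℝ → Ω → ℝ) (P : Measure Ω) (S : Finset ℝ) (b : ℝ) (ω : Ω) : ℝ :=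
  if h : b ∈ S ∧ deriv (mu (covFn X P) S) b = 0 then
    if derivZ X P S b ω < 0 then 1
    else if 0 < derivZ X P S b ω then
      expFactor (theta (covFn X P) S ⟨b, h.1⟩) (iteratedDeriv 2 (mu (covFn X P) S) b)
        (derivZ X P S b ω)
    else 0
  else 1

/-- `W = W_{(a,b)} W_a W_b ∏_{t ∈ E \ S} 1(Z_t > 0)`. -/
def randW (X : ℝ → Ω → ℝ) (P : Measure Ω) (S E : Finset ℝ) (a b : ℝ) (ω : Ω) : ℝ :=
  wInt X P S a b ω * wLeft X P S a ω * wRight X P S b ω *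
    ∏ t ∈ E \ S, if 0 < procZ X P S t ω then 1 else 0

/-- `min_{t ∈ K} X_t` (attained for continuous paths and non-empty compact `K`). -/
def minOver (X : ℝ → Ω → ℝ) (K : Set ℝ) (ω : Ω) : ℝ :=
  sInf ((fun t => X t ω) '' K)

/-- `P(min_{t ∈ K} X_t > u)`. -/
def probMinGt (X : ℝ → Ω → ℝ) (P : Measure Ω) (K : Set ℝ) (u : ℝ) : ℝ :=
  P.real {ω | u < minOver X K ω}

end paths

end HighMinima

end

/-! Decompose `X` into its regression on the values at `S` and the residual `Z`, which is
independent of these values (`indepFun_procZ`). If `X_s = u + y_s/u` on `S`, and `ρ` denotes the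
regression function with data `y`, then `u (X_t - u) = u² (μ(t) - 1) + u Z_t + ρ(t)`. So the
question is when this expression is positive on all of `[a,b]`.

The variational problem supplies the geometry. The potential `t ↦ ∫ R(s,t) ν(ds)` of an optimal `ν`
is at least the minimal energy `V` on `[a,b]`, with equality on the support. It is an entire
function. If it took the value `V` infinitely often in `[a,b]` it would be constant, which both sets
of assumptions exclude. Hence the support and the contact set are finite. Comparing the equations on
`S` gives `θ_s = ν{s}/V > 0`, and `μ` is the potential divided by `V`, so `μ ≥ 1` on `[a,b]`
(`exists_optimalStructure`).

As `u → ∞` only the contact points `μ = 1` matter. Outside `S` the sign of `Z_t` decides. At an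
interior point `s` of `S` both `Z_s` and `μ'(s)` vanish, and zooming in by `t = s + x/u` leaves the
parabola `μ''(s) x²/2 + Z'_s x + y_s`, which is positive for all `x` when `y_s > Z'_s² / (2
μ''(s))`. At a flat endpoint only half of the parabola is visible, and at an endpoint with `μ' ≠ 0`
there is no further constraint. This is the deterministic statement `eventually_forall_pos_iff`. Its
borderline cases are null events because non-degenerate Gaussian variables have no atoms.

The density of the values on `S` at `u + y/u` is asymptotically a constant times `exp(-u²/(2V))
exp(-y·θ)`, and the substitution contributes `u^{-k}` (`tendsto_laplace`). Thus the scaled excesses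
`y_s` behave like independent exponential variables of rates `θ_s`, independent of `Z`. An
exponential variable of rate `θ` exceeds `z²/(2m)` with probability `exp(-θ z²/(2m))`, and these
probabilities are the factors of `W`. The constant is positive because values and derivatives of `X`
charge every open set, so all sign conditions hold together with positive probability.

Both sets of assumptions enter only through `SmoothLaw`. In the stationary case, `R` is the Gram
kernel of the functions `x ↦ cas(t x)`, `cas = cos + sin`, in `L²(F)`. Analyticity in `x` and the
accumulation point of the support give non-degeneracy and exclude constant potentials, and the power
series of `cas` is carried from `L²(F)` to `L²(P)` to produce smooth paths. -/

namespace HighMinima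

/-! ### Everywhere convergent power series and potentials -/

/-- `f` is the sum of the power series with coefficients `c` on the whole real line. -/
def HasEntireSeries (f : ℝ → ℝ) (c : ℕ → ℝ) : Prop :=
  ∀ t, HasSum (fun n => c n * t ^ n) (f t)

namespace HasEntireSeries

variable {f g : ℝ → ℝ} {c d : ℕ → ℝ}

lemma hasFPowerSeriesOnBall (h : HasEntireSeries f c) :
    HasFPowerSeriesOnBall f (FormalMultilinearSeries.ofScalars ℝ c) 0 ⊤ where
  r_le := by
    refine le_of_forall_lt fun r hr => ?_
    lift r to NNReal using hr.ne
    -- Convergence at `r + 1` makes the radius at least `r + 1`, which is strictly larger than `r`.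
    have hs := (h ((r : ℝ) + 1)).summable.norm
    refine lt_of_lt_of_le (b := ((r + 1 : NNReal) : ENNReal)) (by exact_mod_cast lt_add_one r) ?_
    refine FormalMultilinearSeries.le_radius_of_summable_norm _ ?_
    refine Summable.of_nonneg_of_le (fun n => by positivity) (fun n => ?_) hs
    rw [FormalMultilinearSeries.ofScalars_norm, norm_mul, norm_pow]
    gcongr
    simp only [NNReal.coe_add, NNReal.coe_one]
    exact le_abs_self _
  r_pos := by simp
  hasSum := by
    intro y _
    simpa [FormalMultilinearSeries.ofScalars_apply_eq, smul_eq_mul, mul_comm] using h y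

lemma analyticOnNhd (h : HasEntireSeries f c) : AnalyticOnNhd ℝ f univ := by
  have := h.hasFPowerSeriesOnBall.analyticOnNhd
  simpa using this

lemma contDiff (h : HasEntireSeries f c) : ContDiff ℝ ((⊤ : ℕ∞) : WithTop ℕ∞) f :=
  h.analyticOnNhd.contDiff

lemma continuous (h : HasEntireSeries f c) : Continuous f := h.contDiff.continuous

/-- The identity theorem for everywhere convergent power series. -/
lemma eq_of_accPt (hf : HasEntireSeries f c) {v x : ℝ} {s : Set ℝ} (hx : AccPt x (𝓟 s))
    (hs : ∀ y ∈ s, f y = v) (t : ℝ) : f t = v := by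
  have hfr : ∃ᶠ y in 𝓝[≠] x, f y = v := by
    rw [accPt_iff_frequently_nhdsNE] at hx
    exact hx.mono hs
  have := hf.analyticOnNhd.eqOn_of_preconnected_of_frequently_eq (g := fun _ => v)
    analyticOnNhd_const isPreconnected_univ (mem_univ x) hfr
  exact this (mem_univ t)

lemma coeff_eq_zero (hf : HasEntireSeries f c) (h0 : ∀ t, f t = 0) (n : ℕ) : c n = 0 := by
  have h1 := hf.hasFPowerSeriesOnBall.hasFPowerSeriesAt
  have h2 : f = 0 := funext h0
  rw [h2] at h1
  have h3 := h1.eq_zero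
  rw [← FormalMultilinearSeries.coeff_ofScalars (𝕜 := ℝ) (p := c) (n := n), h3]
  rfl

end HasEntireSeries

/-- If an everywhere convergent power series takes a value infinitely often in a compact interval,
it is constant. -/
lemma HasEntireSeries.eq_of_infinite {f : ℝ → ℝ} {c : ℕ → ℝ} (hf : HasEntireSeries f c)
    {a b v : ℝ} (hinf : {t ∈ Icc a b | f t = v}.Infinite) (t : ℝ) : f t = v := by
  obtain ⟨x, _, hx⟩ := hinf.exists_accPt_of_subset_isCompact (isCompact_Icc (a := a) (b := b))
    (fun t ht => ht.1)
  exact hf.eq_of_accPt hx (fun y hy => hy.2) t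

section PowerExpansion

variable {R : ℝ → ℝ → ℝ}

/-- The coefficients of `s ↦ R s t` in a double power series expansion. -/
lemma hasEntireSeries_of_double {r : ℕ → ℕ → ℝ}
    (hr : ∀ s t : ℝ, HasSum (fun p : ℕ × ℕ => r p.1 p.2 * s ^ p.1 * t ^ p.2) (R s t)) (t : ℝ) :
    HasEntireSeries (fun s => R s t) (fun m => ∑' n, r m n * t ^ n) := by
  intro s
  have hs := hr s t
  have h1 : ∀ m, HasSum (fun n => r m n * s ^ m * t ^ n) ((∑' n, r m n * t ^ n) * s ^ m) := by
    intro m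
    have hsum : Summable fun n => r m n * t ^ n := by
      have := (hr 1 t).summable.prod_factor m
      simpa using this
    have h2 : (fun n => r m n * s ^ m * t ^ n) = fun n => r m n * t ^ n * s ^ m := by
      ext n; ring
    rw [h2]
    exact hsum.hasSum.mul_right (s ^ m)
  exact hs.prod_fiberwise h1

lemma HasPowerExpansion.exists_hasEntireSeries (h : HasPowerExpansion R) (t : ℝ) :
    ∃ c, HasEntireSeries (fun s => R s t) c := by
  obtain ⟨r, hr⟩ := h
  exact ⟨_, hasEntireSeries_of_double hr t⟩

/-- The potential of a finite measure on a compact interval is an entire function. -/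
lemma HasPowerExpansion.exists_hasEntireSeries_integral (h : HasPowerExpansion R) {a b : ℝ}
    {ν : Measure ℝ} (hν : ν ∈ probOn a b) :
    ∃ c, HasEntireSeries (fun t => ∫ s, R s t ∂ν) c := by
  obtain ⟨r, hr⟩ := h
  have := hν.1
  set M := max |a| |b|
  have hM : ∀ᵐ s ∂ν, |s| ≤ M := by
    have : ∀ᵐ s ∂ν, s ∈ Icc a b := by rw [ae_iff]; exact hν.2
    filter_upwards [this] with s hs
    exact abs_le_max_abs_abs hs.1 hs.2
  refine ⟨fun n => ∑' m, r m n * ∫ s, s ^ m ∂ν, fun t => ?_⟩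
  have hsum := (hr M t).summable.norm
  have h_int : ∀ m, Integrable (fun s : ℝ => s ^ m) ν := fun m =>
    Integrable.of_bound (by fun_prop) (M ^ m) (by
      filter_upwards [hM] with s hs
      rw [norm_pow]; gcongr; exact hs)
  have hbd : ∀ m, ‖∫ s, s ^ m ∂ν‖ ≤ M ^ m := by
    intro m
    refine (norm_integral_le_of_norm_le_const (C := M ^ m) ?_).trans (by simp)
    filter_upwards [hM] with s hs
    rw [norm_pow]; gcongr; exact hs
  -- On `[a,b]` the terms are dominated by their absolute values at `(M, t)`, so the double series
  -- may be integrated termwise and then regrouped by powers of `t`.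
  have key : HasSum (fun p : ℕ × ℕ => ∫ s, r p.1 p.2 * s ^ p.1 * t ^ p.2 ∂ν) (∫ s, R s t ∂ν) := by
    refine hasSum_integral_of_dominated_convergence
      (fun p _ => ‖r p.1 p.2 * M ^ p.1 * t ^ p.2‖) (fun p => by fun_prop) (fun p => ?_)
      (ae_of_all _ fun _ => hsum) (by simp) (ae_of_all _ fun s => hr s t)
    filter_upwards [hM] with s hs
    rw [norm_mul, norm_mul, norm_mul, norm_mul, norm_pow, norm_pow, norm_pow]
    gcongr
    exact hs.trans (le_abs_self M)
  have hkey : (fun p : ℕ × ℕ => ∫ s, r p.1 p.2 * s ^ p.1 * t ^ p.2 ∂ν) =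
      fun p => r p.1 p.2 * (∫ s, s ^ p.1 ∂ν) * t ^ p.2 := by
    ext p
    rw [integral_mul_const, integral_const_mul]
  rw [hkey] at key
  have key2 := (Equiv.prodComm ℕ ℕ).hasSum_iff.mpr key
  refine key2.prod_fiberwise fun n => ?_
  have hsn : Summable fun m => r m n * ∫ s, s ^ m ∂ν := by
    have h1 := ((hr M 1).summable.norm.prod_symm).prod_factor n
    refine Summable.of_norm_bounded h1 fun m => ?_
    simp only [Prod.swap, norm_mul, one_pow, mul_one, norm_pow]
    gcongr
    exact (hbd m).trans (pow_le_pow_left₀ (by positivity) (le_abs_self _) _)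
  simpa using hsn.hasSum.mul_right (t ^ n)

/-- A double power series that converges everywhere is jointly continuous. -/
lemma HasPowerExpansion.continuous (h : HasPowerExpansion R) :
    Continuous fun p : ℝ × ℝ => R p.1 p.2 := by
  obtain ⟨r, hr⟩ := h
  refine continuous_iff_continuousAt.mpr fun x => ?_
  obtain ⟨s₀, t₀⟩ := x
  obtain ⟨A, hA⟩ : ∃ A : ℝ, A = |s₀| + 1 := ⟨_, rfl⟩
  obtain ⟨B, hB⟩ : ∃ B : ℝ, B = |t₀| + 1 := ⟨_, rfl⟩
  have hU : Metric.ball s₀ 1 ×ˢ Metric.ball t₀ 1 ∈ 𝓝 (s₀, t₀) :=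
    prod_mem_nhds (Metric.ball_mem_nhds _ one_pos) (Metric.ball_mem_nhds _ one_pos)
  have heq : (fun p : ℝ × ℝ => R p.1 p.2) =
      fun p => ∑' q : ℕ × ℕ, r q.1 q.2 * p.1 ^ q.1 * p.2 ^ q.2 := by
    ext p; exact (hr p.1 p.2).tsum_eq.symm
  have hsum : Summable fun q : ℕ × ℕ => ‖r q.1 q.2‖ * ‖A‖ ^ q.1 * ‖B‖ ^ q.2 := by
    simpa only [norm_mul, norm_pow] using (hr A B).summable.norm
  have hcont : ContinuousOn (fun p : ℝ × ℝ => ∑' q : ℕ × ℕ, r q.1 q.2 * p.1 ^ q.1 * p.2 ^ q.2)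
      (Metric.ball s₀ 1 ×ˢ Metric.ball t₀ 1) := by
    refine continuousOn_tsum (fun q => Continuous.continuousOn (by fun_prop)) hsum ?_
    intro q x hx
    have hs' : ‖x.1‖ ≤ ‖A‖ := by
      have := abs_sub_abs_le_abs_sub x.1 s₀
      have hs := hx.1
      rw [Metric.mem_ball, Real.dist_eq] at hs
      rw [Real.norm_eq_abs, Real.norm_eq_abs]
      exact le_trans (by linarith) (le_abs_self _)
    have ht' : ‖x.2‖ ≤ ‖B‖ := by
      have := abs_sub_abs_le_abs_sub x.2 t₀
      have ht := hx.2
      rw [Metric.mem_ball, Real.dist_eq] at ht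
      rw [Real.norm_eq_abs, Real.norm_eq_abs]
      exact le_trans (by linarith) (le_abs_self _)
    rw [norm_mul, norm_mul, norm_pow, norm_pow]
    exact mul_le_mul (mul_le_mul_of_nonneg_left (pow_le_pow_left₀ (norm_nonneg _) hs' _)
      (norm_nonneg _)) (pow_le_pow_left₀ (norm_nonneg _) ht' _) (by positivity) (by positivity)
  rw [heq]
  exact hcont.continuousAt hU

end PowerExpansion

end HighMinima

/-! ### Local analysis of `u² (m - 1) + u z + ρ` -/

namespace HighMinima

section LocalAnalysis

variable {m z ρ : ℝ → ℝ} {s x y : ℝ}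

lemma isLittleO_second_order (hm : ContDiff ℝ 2 m) (hm0 : m s = 1) (hm1 : deriv m s = 0) :
    (fun t => m t - 1 - iteratedDeriv 2 m s / 2 * (t - s) ^ 2) =o[𝓝 s]
      fun t => (t - s) ^ 2 := by
  have h := taylor_isLittleO_univ (f := m) (x₀ := s) (n := 2) hm
  refine h.congr_left fun t => ?_
  rw [taylorWithinEval_succ, taylorWithinEval_succ, taylor_within_zero_eval,
    iteratedDerivWithin_univ, iteratedDerivWithin_univ, iteratedDeriv_one, hm0, hm1]
  simp
  ring

lemma tendsto_add_div_atTop (s x : ℝ) : Tendsto (fun u : ℝ => s + x / u) atTop (𝓝 s) := by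
  simpa using (tendsto_const_nhds (x := x)).div_atTop tendsto_id |>.const_add s

lemma tendsto_scaled_sq (hm : ContDiff ℝ 2 m) (hm0 : m s = 1) (hm1 : deriv m s = 0) (x : ℝ) :
    Tendsto (fun u : ℝ => u ^ 2 * (m (s + x / u) - 1)) atTop
      (𝓝 (iteratedDeriv 2 m s / 2 * x ^ 2)) := by
  have h := (isLittleO_second_order hm hm0 hm1).comp_tendsto (tendsto_add_div_atTop s x)
  have h2 : Tendsto (fun u : ℝ => u ^ 2 * (m (s + x / u) - 1 -
      iteratedDeriv 2 m s / 2 * (s + x / u - s) ^ 2)) atTop (𝓝 0) := by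
    have h3 : (fun u : ℝ => u ^ 2 * (m (s + x / u) - 1 -
      iteratedDeriv 2 m s / 2 * (s + x / u - s) ^ 2)) =o[atTop] fun _ => (1 : ℝ) := by
      have h4 := (Asymptotics.isBigO_refl (fun u : ℝ => u ^ 2) atTop).mul_isLittleO h
      refine h4.trans_isBigO ?_
      refine Asymptotics.IsBigO.of_bound (x ^ 2) ?_
      filter_upwards [eventually_gt_atTop 0] with u hu
      have : u ^ 2 * ((fun t => (t - s) ^ 2) ∘ fun u => s + x / u) u = x ^ 2 := by
        simp only [Function.comp]; field_simp; ring
      rw [this]; simp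
    exact (Asymptotics.isLittleO_one_iff ℝ).mp h3
  have h5 := h2.add_const (iteratedDeriv 2 m s / 2 * x ^ 2)
  rw [zero_add] at h5
  refine h5.congr' ?_
  filter_upwards [eventually_gt_atTop 0] with u hu
  field_simp
  ring

lemma tendsto_scaled_linear (hz : DifferentiableAt ℝ z s) (hz0 : z s = 0) (x : ℝ) :
    Tendsto (fun u : ℝ => u * z (s + x / u)) atTop (𝓝 (deriv z s * x)) := by
  have h := (hasDerivAt_iff_isLittleO.mp hz.hasDerivAt).comp_tendsto (tendsto_add_div_atTop s x)
  have h3 : (fun u : ℝ => u * (z (s + x / u) - z s - (s + x / u - s) • deriv z s))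
      =o[atTop] fun _ => (1 : ℝ) := by
    have h4 := (Asymptotics.isBigO_refl (fun u : ℝ => u) atTop).mul_isLittleO h
    refine h4.trans_isBigO ?_
    refine Asymptotics.IsBigO.of_bound |x| ?_
    filter_upwards [eventually_gt_atTop 0] with u hu
    have : u * ((fun t => t - s) ∘ fun u => s + x / u) u = x := by
      simp only [Function.comp]; field_simp; ring
    rw [this]; simp
  have h5 := ((Asymptotics.isLittleO_one_iff ℝ).mp h3).add_const (deriv z s * x)
  rw [zero_add] at h5
  refine h5.congr' ?_
  filter_upwards [eventually_gt_atTop 0] with u hu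
  simp only [hz0, smul_eq_mul]
  field_simp
  ring

/-- The scaling limit at a point of contact. -/
lemma tendsto_scaled (hm : ContDiff ℝ 2 m) (hm0 : m s = 1) (hm1 : deriv m s = 0)
    (hz : DifferentiableAt ℝ z s) (hz0 : z s = 0) (hρ : ContinuousAt ρ s) (x : ℝ) :
    Tendsto (fun u : ℝ => u ^ 2 * (m (s + x / u) - 1) + u * z (s + x / u) + ρ (s + x / u)) atTop
      (𝓝 (iteratedDeriv 2 m s / 2 * x ^ 2 + deriv z s * x + ρ s)) :=
  ((tendsto_scaled_sq hm hm0 hm1 x).add (tendsto_scaled_linear hz hz0 x)).add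
    (hρ.tendsto.comp (tendsto_add_div_atTop s x))

/-- Away from contact points the term of order `u²` beats the other two, uniformly near `s`. -/
lemma eventually_pos_of_one_lt {K : Set ℝ} (hm : ContinuousAt m s) (hz : ContinuousAt z s)
    (hρ : ContinuousAt ρ s) (h : 1 < m s) :
    ∀ᶠ p : ℝ × ℝ in atTop ×ˢ 𝓝[K] s, 0 < p.1 ^ 2 * (m p.2 - 1) + p.1 * z p.2 + ρ p.2 := by
  obtain ⟨d, hd, hd'⟩ : ∃ d, 0 < d ∧ 1 + d < m s := ⟨(m s - 1) / 2, by linarith, by linarith⟩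
  have e1 : ∀ᶠ t in 𝓝[K] s, 1 + d < m t := nhdsWithin_le_nhds (hm.eventually_const_lt hd')
  have e2 : ∀ᶠ t in 𝓝[K] s, z s - 1 < z t :=
    nhdsWithin_le_nhds (hz.eventually_const_lt (by linarith))
  have e3 : ∀ᶠ t in 𝓝[K] s, ρ s - 1 < ρ t :=
    nhdsWithin_le_nhds (hρ.eventually_const_lt (by linarith))
  have e4 : ∀ᶠ u : ℝ in atTop, 1 ≤ u ∧ |z s - 1| + |ρ s - 1| < u * d :=
    (eventually_ge_atTop 1).and ((tendsto_id.atTop_mul_const hd).eventually_gt_atTop _)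
  filter_upwards [e4.prod_mk ((e1.and e2).and e3)] with p hp
  obtain ⟨⟨hu1, hu2⟩, ⟨h1, h2⟩, h3⟩ := hp
  have hu0 : 0 < p.1 := by linarith
  have g1 : p.1 ^ 2 * d ≤ p.1 ^ 2 * (m p.2 - 1) := by gcongr; linarith
  have g2 : p.1 * (z s - 1) ≤ p.1 * z p.2 := by gcongr
  have g3 : p.1 * (-|z s - 1|) ≤ p.1 * (z s - 1) := by gcongr; exact neg_abs_le _
  have g4 := neg_abs_le (ρ s - 1)
  have g5 : p.1 * (|z s - 1| + |ρ s - 1|) < p.1 * (p.1 * d) := by gcongr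
  nlinarith [abs_nonneg (ρ s - 1)]

/-- The first term is non-negative on `K`, and the term of order `u` beats the bounded one. -/
lemma eventually_pos_of_pos {K : Set ℝ} (hmK : ∀ t ∈ K, 1 ≤ m t) (hz : ContinuousAt z s)
    (hρ : ContinuousAt ρ s) (h : 0 < z s) :
    ∀ᶠ p : ℝ × ℝ in atTop ×ˢ 𝓝[K] s, 0 < p.1 ^ 2 * (m p.2 - 1) + p.1 * z p.2 + ρ p.2 := by
  have e1 : ∀ᶠ t in 𝓝[K] s, 1 ≤ m t := eventually_mem_nhdsWithin.mono hmK
  have e2 : ∀ᶠ t in 𝓝[K] s, z s / 2 < z t :=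
    nhdsWithin_le_nhds (hz.eventually_const_lt (by linarith))
  have e3 : ∀ᶠ t in 𝓝[K] s, ρ s - 1 < ρ t :=
    nhdsWithin_le_nhds (hρ.eventually_const_lt (by linarith))
  have e4 : ∀ᶠ u : ℝ in atTop, 1 ≤ u ∧ |ρ s - 1| < u * (z s / 2) :=
    (eventually_ge_atTop 1).and
      ((tendsto_id.atTop_mul_const (half_pos h)).eventually_gt_atTop _)
  filter_upwards [e4.prod_mk ((e1.and e2).and e3)] with p hp
  obtain ⟨⟨hu1, hu2⟩, ⟨h1, h2⟩, h3⟩ := hp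
  have hu0 : 0 < p.1 := by linarith
  have g1 : 0 ≤ p.1 ^ 2 * (m p.2 - 1) := mul_nonneg (by positivity) (by linarith)
  have g2 : p.1 * (z s / 2) ≤ p.1 * z p.2 := by gcongr
  have g4 := neg_abs_le (ρ s - 1)
  linarith

lemma eventually_linear_bound {K : Set ℝ} (hz : DifferentiableAt ℝ z s) (hz0 : z s = 0) {ε : ℝ}
    (hε : 0 < ε) : ∀ᶠ t in 𝓝[K] s, |z t - deriv z s * (t - s)| ≤ ε * |t - s| := by
  have h := (hasDerivAt_iff_isLittleO.mp hz.hasDerivAt).bound hε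
  refine nhdsWithin_le_nhds ?_
  filter_upwards [h] with t ht
  simpa [hz0, mul_comm] using ht

/-- In the variable `v = u |t - s|` the expression is at least a quadratic polynomial in `v` whose
coefficients are those of the limiting parabola up to `ε`. The assumption makes the discriminant of
the limit negative, so it stays negative for small `ε`. This gives uniformity in `t`, not only for
fixed `x`. -/
lemma eventually_pos_of_quadratic {K : Set ℝ} (hm : ContDiff ℝ 2 m) (hm0 : m s = 1)
    (hm1 : deriv m s = 0) (hz : DifferentiableAt ℝ z s) (hz0 : z s = 0) (hρ : ContinuousAt ρ s)
    (hm2 : 0 < iteratedDeriv 2 m s) (h : deriv z s ^ 2 / (2 * iteratedDeriv 2 m s) < ρ s) :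
    ∀ᶠ p : ℝ × ℝ in atTop ×ˢ 𝓝[K] s, 0 < p.1 ^ 2 * (m p.2 - 1) + p.1 * z p.2 + ρ p.2 := by
  set M := iteratedDeriv 2 m s with hM
  set w := deriv z s with hw
  have hlt : w ^ 2 < 2 * M * ρ s := by
    rw [div_lt_iff₀ (by positivity)] at h; linarith
  -- At `ε = 0` the discriminant condition reads `w² < 2 M ρ(s)`, and both sides are continuous in
  -- `ε`.
  obtain ⟨ε, hε, hε1, hε2⟩ : ∃ ε > 0, 0 < M / 2 - ε ∧
      (|w| + ε) ^ 2 < 4 * (M / 2 - ε) * (ρ s - ε) := by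
    have hc : ContinuousAt (fun ε : ℝ => 4 * (M / 2 - ε) * (ρ s - ε) - (|w| + ε) ^ 2) 0 := by
      fun_prop
    have e1 : ∀ᶠ ε : ℝ in 𝓝 0, 0 < 4 * (M / 2 - ε) * (ρ s - ε) - (|w| + ε) ^ 2 := by
      refine hc.eventually_const_lt ?_
      simp only [sub_zero, add_zero, sq_abs]; linarith
    have e2 : ∀ᶠ ε : ℝ in 𝓝 0, ε < M / 2 := eventually_lt_nhds (by positivity)
    have e3 : ∀ᶠ ε : ℝ in 𝓝[>] 0, 0 < ε := eventually_mem_nhdsWithin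
    obtain ⟨ε, h1, h2, h3⟩ := (e3.and (nhdsWithin_le_nhds (e1.and e2))).exists
    exact ⟨ε, h1, by linarith, by linarith⟩
  have e1 : ∀ᶠ t in 𝓝[K] s, |m t - 1 - M / 2 * (t - s) ^ 2| ≤ ε * (t - s) ^ 2 := by
    refine nhdsWithin_le_nhds ?_
    filter_upwards [(isLittleO_second_order hm hm0 hm1).bound hε] with t ht
    simpa using ht
  have e2 := eventually_linear_bound (K := K) hz hz0 hε
  have e3 : ∀ᶠ t in 𝓝[K] s, ρ s - ε < ρ t :=
    nhdsWithin_le_nhds (hρ.eventually_const_lt (by linarith))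
  filter_upwards [(eventually_gt_atTop (0 : ℝ)).prod_mk ((e1.and e2).and e3)] with p hp
  obtain ⟨hu, ⟨h1, h2⟩, h3⟩ := hp
  obtain ⟨u, t⟩ := p
  simp only at hu h1 h2 h3 ⊢
  set v := u * |t - s| with hv
  have g1 : (M / 2 - ε) * v ^ 2 ≤ u ^ 2 * (m t - 1) := by
    have : (M / 2 - ε) * (t - s) ^ 2 ≤ m t - 1 := by linarith [(abs_le.mp h1).1]
    calc (M / 2 - ε) * v ^ 2 = u ^ 2 * ((M / 2 - ε) * (t - s) ^ 2) := by
          rw [hv, mul_pow, sq_abs]; ring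
      _ ≤ _ := by gcongr
  have g2 : -((|w| + ε) * v) ≤ u * z t := by
    have h4 : -(|w| * |t - s|) ≤ w * (t - s) := by rw [← abs_mul]; exact neg_abs_le _
    have : -((|w| + ε) * |t - s|) ≤ z t := by linarith [(abs_le.mp h2).1]
    calc -((|w| + ε) * v) = u * (-((|w| + ε) * |t - s|)) := by rw [hv]; ring
      _ ≤ _ := by gcongr
  have g3 : 0 < (M / 2 - ε) * v ^ 2 - (|w| + ε) * v + (ρ s - ε) := by
    have : 0 < 4 * (M / 2 - ε) * ((M / 2 - ε) * v ^ 2 - (|w| + ε) * v + (ρ s - ε)) := by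
      -- Completing the square: `4A (A v² - B v + C) = (2 A v - B)² + (4 A C - B²)` with `A = M/2 -
      -- ε`, `B = |w| + ε`, `C = ρ s - ε`.
      nlinarith [sq_nonneg (2 * (M / 2 - ε) * v - (|w| + ε))]
    exact (pos_iff_pos_of_mul_pos this).mp (by positivity)
  linarith

/-- Here `σ = ±1` is the direction in which `K` lies, seen from `s`. -/
lemma eventually_pos_of_linear {K : Set ℝ} {σ : ℝ} (hσ : ∀ t ∈ K, |t - s| = σ * (t - s))
    (hm : DifferentiableAt ℝ m s) (hm0 : m s = 1) (hm1 : 0 < σ * deriv m s)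
    (hσ1 : σ * σ = 1)
    (hz : DifferentiableAt ℝ z s) (hz0 : z s = 0) (hρ : ContinuousAt ρ s) (h : 0 < ρ s) :
    ∀ᶠ p : ℝ × ℝ in atTop ×ˢ 𝓝[K] s, 0 < p.1 ^ 2 * (m p.2 - 1) + p.1 * z p.2 + ρ p.2 := by
  set D := σ * deriv m s with hD
  have e1 := eventually_linear_bound (K := K) (z := fun t => m t - 1) (s := s)
    (hm.sub_const 1) (by simp [hm0]) (half_pos hm1)
  have e2 := eventually_linear_bound (K := K) hz hz0 one_pos
  have e3 : ∀ᶠ t in 𝓝[K] s, 0 < ρ t := nhdsWithin_le_nhds (hρ.eventually_const_lt h)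
  have e4 : ∀ᶠ u : ℝ in atTop, 1 ≤ u ∧ |deriv z s| + 1 < u * (D / 2) :=
    (eventually_ge_atTop 1).and
      ((tendsto_id.atTop_mul_const (half_pos hm1)).eventually_gt_atTop _)
  filter_upwards [e4.prod_mk (((e1.and e2).and e3).and eventually_mem_nhdsWithin)] with p hp
  obtain ⟨⟨hu1, hu2⟩, ⟨⟨h1, h2⟩, h3⟩, hK⟩ := hp
  obtain ⟨u, t⟩ := p
  simp only at hu1 hu2 h1 h2 h3 hK ⊢
  have hu0 : 0 < u := by linarith
  rw [deriv_sub_const] at h1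
  have hd : deriv m s * (t - s) = D * |t - s| := by
    rw [hσ t hK, hD]; linear_combination (-(deriv m s * (t - s))) * hσ1
  -- The gain `u² (D/2) |t - s|` from the slope of `m` absorbs the loss `u (|z'| + 1) |t - s|` once
  -- `u` is large.
  have g1 : D / 2 * |t - s| ≤ m t - 1 := by
    rw [hd] at h1; linarith [(abs_le.mp h1).1]
  have g2 : -((|deriv z s| + 1) * |t - s|) ≤ z t := by
    have h4 : -(|deriv z s| * |t - s|) ≤ deriv z s * (t - s) := by
      rw [← abs_mul]; exact neg_abs_le _
    linarith [(abs_le.mp h2).1]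
  have g3 : u ^ 2 * (D / 2 * |t - s|) ≤ u ^ 2 * (m t - 1) := by gcongr
  have g4 : u * (-((|deriv z s| + 1) * |t - s|)) ≤ u * z t := by gcongr
  have g5 : u * ((|deriv z s| + 1) * |t - s|) ≤ u * (u * (D / 2) * |t - s|) := by gcongr
  nlinarith

lemma eventually_pos_of_outward {K : Set ℝ} {σ : ℝ} (hσ : ∀ t ∈ K, |t - s| = σ * (t - s))
    (hσ1 : σ * σ = 1) (hmK : ∀ t ∈ K, 1 ≤ m t)
    (hz : DifferentiableAt ℝ z s) (hz0 : z s = 0) (hz1 : 0 < σ * deriv z s)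
    (hρ : ContinuousAt ρ s) (h : 0 < ρ s) :
    ∀ᶠ p : ℝ × ℝ in atTop ×ˢ 𝓝[K] s, 0 < p.1 ^ 2 * (m p.2 - 1) + p.1 * z p.2 + ρ p.2 := by
  -- Taking the error in the linear approximation equal to the slope `σ z'` itself is enough for `z
  -- ≥ 0` near `s` on `K`.
  have e2 := eventually_linear_bound (K := K) hz hz0 hz1
  have e3 : ∀ᶠ t in 𝓝[K] s, 0 < ρ t := nhdsWithin_le_nhds (hρ.eventually_const_lt h)
  filter_upwards [(eventually_ge_atTop (0 : ℝ)).prod_mk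
    ((e2.and e3).and eventually_mem_nhdsWithin)] with p hp
  obtain ⟨hu, ⟨h2, h3⟩, hK⟩ := hp
  obtain ⟨u, t⟩ := p
  simp only at hu h2 h3 hK ⊢
  have hd : deriv z s * (t - s) = σ * deriv z s * |t - s| := by
    rw [hσ t hK]; linear_combination (-(deriv z s * (t - s))) * hσ1
  have g1 : 0 ≤ z t := by rw [hd] at h2; linarith [(abs_le.mp h2).1]
  have g2 : 0 ≤ u ^ 2 * (m t - 1) := mul_nonneg (by positivity) (by linarith [hmK t hK])
  have g3 : 0 ≤ u * z t := mul_nonneg hu g1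
  linarith

/-- Passes from local to uniform statements: finitely many of the neighbourhoods cover `K`, and the
largest of the corresponding thresholds for `u` serves for all. -/
lemma eventually_forall_of_isCompact {K : Set ℝ} (hK : IsCompact K) {Q : ℝ × ℝ → Prop}
    (h : ∀ s ∈ K, ∀ᶠ p in atTop ×ˢ 𝓝[K] s, Q p) : ∀ᶠ u : ℝ in atTop, ∀ t ∈ K, Q (u, t) := by
  refine hK.induction_on (p := fun A => ∀ᶠ u : ℝ in atTop, ∀ t ∈ A, Q (u, t)) (by simp)
    (fun A B hAB hB => hB.mono fun u hu t ht => hu t (hAB ht))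
    (fun A B hA hB => by
      filter_upwards [hA, hB] with u h1 h2 t ht
      exact ht.elim (h1 t) (h2 t)) ?_
  intro s hs
  obtain ⟨pa, hpa, pb, hpb, hab⟩ := eventually_prod_iff.mp (h s hs)
  exact ⟨{t | pb t}, hpb, hpa.mono fun u hu t ht => hab hu ht⟩

end LocalAnalysis

end HighMinima

/-! ### Contact points and the pathwise limit theorem -/

namespace HighMinima

section Contact

variable {m z ρ : ℝ → ℝ} {a b s : ℝ}

lemma eventually_add_div_mem_of_lt (has : a ≤ s) (hsb : s < b) {x : ℝ} (hx : 0 ≤ x) :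
    ∀ᶠ u : ℝ in atTop, s + x / u ∈ Icc a b := by
  filter_upwards [eventually_gt_atTop 0, (tendsto_add_div_atTop s x).eventually_lt_const hsb]
    with u hu h
  exact ⟨by have : 0 ≤ x / u := by positivity
            linarith, h.le⟩

lemma eventually_add_div_mem_of_gt (has : a < s) (hsb : s ≤ b) {x : ℝ} (hx : x ≤ 0) :
    ∀ᶠ u : ℝ in atTop, s + x / u ∈ Icc a b := by
  filter_upwards [eventually_gt_atTop 0, (tendsto_add_div_atTop s x).eventually_const_lt has]
    with u hu h
  exact ⟨h.le, by have : x / u ≤ 0 := div_nonpos_of_nonpos_of_nonneg hx hu.le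
                  linarith⟩

lemma deriv_eq_zero_of_contact (hmK : ∀ t ∈ Icc a b, 1 ≤ m t) (hs : s ∈ Ioo a b)
    (hm0 : m s = 1) : deriv m s = 0 := by
  have : IsLocalMin m s := by
    filter_upwards [Ioo_mem_nhds hs.1 hs.2] with t ht
    rw [hm0]; exact hmK t (Ioo_subset_Icc_self ht)
  exact this.deriv_eq_zero

lemma deriv_nonneg_of_contact (hm : Differentiable ℝ m) (hmK : ∀ t ∈ Icc a b, 1 ≤ m t)
    (has : a ≤ s) (hsb : s < b) (hm0 : m s = 1) : 0 ≤ deriv m s := by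
  have h := tendsto_scaled_linear (z := fun t => m t - 1) (s := s)
    ((hm s).sub_const 1) (by simp [hm0]) 1
  rw [deriv_sub_const, mul_one] at h
  refine ge_of_tendsto h ?_
  filter_upwards [eventually_gt_atTop 0, eventually_add_div_mem_of_lt has hsb zero_le_one]
    with u hu hm
  exact mul_nonneg hu.le (by linarith [hmK _ hm])

lemma deriv_nonpos_of_contact (hm : Differentiable ℝ m) (hmK : ∀ t ∈ Icc a b, 1 ≤ m t)
    (has : a < s) (hsb : s ≤ b) (hm0 : m s = 1) : deriv m s ≤ 0 := by
  have h := tendsto_scaled_linear (z := fun t => m t - 1) (s := s)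
    ((hm s).sub_const 1) (by simp [hm0]) (-1)
  rw [deriv_sub_const] at h
  have : 0 ≤ deriv m s * -1 := by
    refine ge_of_tendsto h ?_
    filter_upwards [eventually_gt_atTop 0,
      eventually_add_div_mem_of_gt has hsb (x := -1) (by norm_num)] with u hu hm
    exact mul_nonneg hu.le (by linarith [hmK _ hm])
  linarith

/-- The scaled limit along one direction `x = ±1` that stays inside `[a,b]` suffices, so this covers
the endpoints too. -/
lemma second_deriv_nonneg_of_contact (hab : a < b) (hm : ContDiff ℝ 2 m)
    (hmK : ∀ t ∈ Icc a b, 1 ≤ m t) (hs : s ∈ Icc a b) (hm0 : m s = 1) (hm1 : deriv m s = 0) :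
    0 ≤ iteratedDeriv 2 m s := by
  obtain ⟨x, hx, hmem⟩ : ∃ x : ℝ, x ^ 2 = 1 ∧ ∀ᶠ u : ℝ in atTop, s + x / u ∈ Icc a b := by
    rcases hs.2.lt_or_eq with h | h
    · exact ⟨1, by norm_num, eventually_add_div_mem_of_lt hs.1 h zero_le_one⟩
    · exact ⟨-1, by norm_num, eventually_add_div_mem_of_gt (h ▸ hab) hs.2 (by norm_num)⟩
  have h := tendsto_scaled_sq hm hm0 hm1 x
  have h0 : 0 ≤ iteratedDeriv 2 m s / 2 * x ^ 2 := by
    refine ge_of_tendsto h ?_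
    filter_upwards [hmem] with u hu
    exact mul_nonneg (by positivity) (by linarith [hmK _ hu])
  rw [hx] at h0
  linarith

/-- The contact point `s` constrains the limit: it is interior, or it is an endpoint at which
the conditional mean is flat and the residual path points into the lower half plane. -/
def IsCritical (a b s m₁ z₁ : ℝ) : Prop :=
  s ∈ Ioo a b ∨ (m₁ = 0 ∧ ((s = a ∧ z₁ < 0) ∨ (s = b ∧ 0 < z₁)))

open Classical in
/-- The excesses at the contact point `s` that are compatible with a high minimum. -/
noncomputable def limitSet (a b s m₁ m₂ z₁ : ℝ) : Set ℝ :=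
  if IsCritical a b s m₁ z₁ then (if m₂ = 0 then ∅ else Ioi (z₁ ^ 2 / (2 * m₂))) else Ioi 0

/-- Three mechanisms keep the path above the level near `s`: a limiting parabola without real zeros,
a flat endpoint at which the residual increases into the interval, and an endpoint at which `m`
itself increases into the interval. -/
lemma eventually_pos_of_mem_limitSet (hab : a < b) (hm : ContDiff ℝ 2 m) (hz : Differentiable ℝ z)
    (hρ : Continuous ρ) (hmK : ∀ t ∈ Icc a b, 1 ≤ m t) (hs : s ∈ Icc a b) (hm0 : m s = 1)
    (hz0 : z s = 0) (hz1 : deriv z s ≠ 0)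
    (h : ρ s ∈ limitSet a b s (deriv m s) (iteratedDeriv 2 m s) (deriv z s)) :
    ∀ᶠ p : ℝ × ℝ in atTop ×ˢ 𝓝[Icc a b] s,
      0 < p.1 ^ 2 * (m p.2 - 1) + p.1 * z p.2 + ρ p.2 := by
  have hmd : Differentiable ℝ m := hm.differentiable (by norm_num)
  unfold limitSet at h
  split_ifs at h with hc h2
  · exact h.elim
  · have hm1 : deriv m s = 0 :=
      hc.elim (fun hi => deriv_eq_zero_of_contact hmK hi hm0) (fun hi => hi.1)
    have hm2 := second_deriv_nonneg_of_contact hab hm hmK hs hm0 hm1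
    exact eventually_pos_of_quadratic hm hm0 hm1 (hz s) hz0 hρ.continuousAt
      (lt_of_le_of_ne hm2 (Ne.symm h2)) h
  · simp only [IsCritical, not_or, not_and, not_lt] at hc
    obtain ⟨h_int, hout⟩ := hc
    have hend : s = a ∨ s = b := by
      by_contra hcon
      push Not at hcon
      exact h_int ⟨lt_of_le_of_ne hs.1 (Ne.symm hcon.1), lt_of_le_of_ne hs.2 hcon.2⟩
    rcases hend with rfl | rfl
    · have hσ : ∀ t ∈ Icc s b, |t - s| = 1 * (t - s) := fun t ht => by
        rw [one_mul, abs_of_nonneg (by linarith [ht.1])]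
      have hd := deriv_nonneg_of_contact hmd hmK le_rfl hab hm0
      rcases hd.eq_or_lt with hd | hd
      · refine eventually_pos_of_outward hσ (by norm_num) hmK (hz s) hz0 ?_ hρ.continuousAt h
        rw [one_mul]
        exact lt_of_le_of_ne ((hout hd.symm).1 rfl) (Ne.symm hz1)
      · exact eventually_pos_of_linear hσ (hmd s) hm0 (by linarith) (by norm_num) (hz s) hz0
          hρ.continuousAt h
    · have hσ : ∀ t ∈ Icc a s, |t - s| = (-1) * (t - s) := fun t ht => by
        rw [abs_of_nonpos (by linarith [ht.2])]; ring
      have hd := deriv_nonpos_of_contact hmd hmK hab le_rfl hm0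
      rcases hd.eq_or_lt with hd | hd
      · refine eventually_pos_of_outward hσ (by norm_num) hmK (hz s) hz0 ?_ hρ.continuousAt h
        have := lt_of_le_of_ne ((hout hd).2 rfl) hz1
        linarith
      · exact eventually_pos_of_linear hσ (hmd s) hm0 (by linarith) (by norm_num) (hz s) hz0
          hρ.continuousAt h

/-- A direction into `[a,b]` along which the limiting parabola becomes negative. -/
lemma exists_neg_direction (hab : a < b) (hs : s ∈ Icc a b) {m₁ m₂ z₁ y : ℝ} (hm2 : 0 ≤ m₂)
    (hz1 : z₁ ≠ 0) (hy : 0 < y) (hc : IsCritical a b s m₁ z₁)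
    (hneg : m₂ = 0 ∨ y < z₁ ^ 2 / (2 * m₂)) :
    ∃ x : ℝ, (∀ᶠ u : ℝ in atTop, s + x / u ∈ Icc a b) ∧ m₂ / 2 * x ^ 2 + z₁ * x + y < 0 := by
  -- The candidate is `x = -z₁ q`, whose sign is opposite to that of `z₁`; this is the admissible
  -- side at an endpoint. For `m₂ = 0` the choice of `q` makes the linear function equal to `-1`;
  -- for `m₂ > 0` the vertex `x = -z₁/m₂` is used.
  obtain ⟨q, hq, hx⟩ : ∃ q : ℝ, 0 ≤ q ∧
      m₂ / 2 * (-(z₁ * q)) ^ 2 + z₁ * (-(z₁ * q)) + y < 0 := by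
    have hz2 : 0 < z₁ ^ 2 := by positivity
    rcases hm2.eq_or_lt with h0 | h0
    · refine ⟨(y + 1) / z₁ ^ 2, by positivity, ?_⟩
      have : z₁ * (z₁ * ((y + 1) / z₁ ^ 2)) = y + 1 := by field_simp
      rw [← h0]
      linarith
    · have hlt := hneg.resolve_left h0.ne'
      rw [lt_div_iff₀ (by positivity)] at hlt
      refine ⟨1 / m₂, by positivity, ?_⟩
      have : m₂ / 2 * (-(z₁ * (1 / m₂))) ^ 2 + z₁ * (-(z₁ * (1 / m₂))) + y =
          (y * (2 * m₂) - z₁ ^ 2) / (2 * m₂) := by field_simp; ring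
      rw [this]
      exact div_neg_of_neg_of_pos (by linarith) (by positivity)
  refine ⟨-(z₁ * q), ?_, hx⟩
  rcases hc with hi | ⟨-, ⟨rfl, hz⟩ | ⟨rfl, hz⟩⟩
  · rcases le_total 0 (-(z₁ * q)) with h | h
    · exact eventually_add_div_mem_of_lt hi.1.le hi.2 h
    · exact eventually_add_div_mem_of_gt hi.1 hi.2.le h
  · exact eventually_add_div_mem_of_lt le_rfl hab (by nlinarith)
  · exact eventually_add_div_mem_of_gt hab le_rfl (by nlinarith)

/-- The limiting parabola is strictly negative at some admissible `x`, so the point `s + x/u`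
violates the inequality for large `u`. Excluding equality removes the case of a double zero, which
the limit does not decide. -/
lemma eventually_not_pos_of_notMem_limitSet (hab : a < b) (hm : ContDiff ℝ 2 m)
    (hz : Differentiable ℝ z)
    (hρ : Continuous ρ) (hmK : ∀ t ∈ Icc a b, 1 ≤ m t) (hs : s ∈ Icc a b) (hm0 : m s = 1)
    (hz0 : z s = 0) (hz1 : deriv z s ≠ 0) (hy : 0 < ρ s)
    (hne : ρ s ≠ deriv z s ^ 2 / (2 * iteratedDeriv 2 m s))
    (h : ρ s ∉ limitSet a b s (deriv m s) (iteratedDeriv 2 m s) (deriv z s)) :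
    ∀ᶠ u : ℝ in atTop, ¬ ∀ t ∈ Icc a b, 0 < u ^ 2 * (m t - 1) + u * z t + ρ t := by
  unfold limitSet at h
  by_cases hc : IsCritical a b s (deriv m s) (deriv z s)
  swap
  · rw [if_neg hc] at h; exact absurd hy h
  rw [if_pos hc] at h
  have hm1 : deriv m s = 0 :=
    hc.elim (fun hi => deriv_eq_zero_of_contact hmK hi hm0) (fun hi => hi.1)
  have hm2 := second_deriv_nonneg_of_contact hab hm hmK hs hm0 hm1
  have hneg : iteratedDeriv 2 m s = 0 ∨ ρ s < deriv z s ^ 2 / (2 * iteratedDeriv 2 m s) := by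
    by_cases h0 : iteratedDeriv 2 m s = 0
    · exact Or.inl h0
    · rw [if_neg h0, mem_Ioi, not_lt] at h
      exact Or.inr (lt_of_le_of_ne h hne)
  obtain ⟨x, hx, hlt⟩ := exists_neg_direction hab hs hm2 hz1 hy hc hneg
  have hlim := tendsto_scaled hm hm0 hm1 (hz s) hz0 hρ.continuousAt x
  filter_upwards [hx, hlim.eventually_lt_const hlt] with u hu hlt' hall
  exact absurd (hall _ hu) (not_lt.mpr hlt'.le)

lemma eventually_not_pos_of_neg (hm0 : m s = 1) (hs : s ∈ Icc a b) (hz : z s < 0) :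
    ∀ᶠ u : ℝ in atTop, ¬ ∀ t ∈ Icc a b, 0 < u ^ 2 * (m t - 1) + u * z t + ρ t := by
  have h : Tendsto (fun u : ℝ => u * z s + ρ s) atTop atBot :=
    tendsto_atBot_add_const_right _ _ (tendsto_id.atTop_mul_const_of_neg hz)
  filter_upwards [h.eventually_lt_atBot 0] with u hu hall
  have := hall s hs
  rw [hm0] at this
  linarith

/-- The pathwise limit theorem: for large `u` the whole path stays above the level exactly when
the residual path is positive at the contact points outside `S` and the excesses at the points of
`S` belong to the limiting sets. -/
lemma eventually_forall_pos_iff (hab : a < b) (hm : ContDiff ℝ 2 m) (hz : Differentiable ℝ z)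
    (hρ : Continuous ρ) (hmK : ∀ t ∈ Icc a b, 1 ≤ m t) {S E : Finset ℝ} (hSE : S ⊆ E)
    (hE : ∀ t, t ∈ E ↔ t ∈ Icc a b ∧ m t = 1) (hz0 : ∀ s ∈ S, z s = 0)
    (hz1 : ∀ s ∈ S, deriv z s ≠ 0) (hzE : ∀ t ∈ E \ S, z t ≠ 0) (hy : ∀ s ∈ S, 0 < ρ s)
    (hne : ∀ s ∈ S, ρ s ≠ deriv z s ^ 2 / (2 * iteratedDeriv 2 m s)) :
    ∀ᶠ u : ℝ in atTop, (∀ t ∈ Icc a b, 0 < u ^ 2 * (m t - 1) + u * z t + ρ t) ↔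
      (∀ t ∈ E \ S, 0 < z t) ∧
        ∀ s ∈ S, ρ s ∈ limitSet a b s (deriv m s) (iteratedDeriv 2 m s) (deriv z s) := by
  have hSE' : ∀ s ∈ S, s ∈ Icc a b ∧ m s = 1 := fun s hs => (hE s).mp (hSE hs)
  by_cases hgood : (∀ t ∈ E \ S, 0 < z t) ∧
      ∀ s ∈ S, ρ s ∈ limitSet a b s (deriv m s) (iteratedDeriv 2 m s) (deriv z s)
  · have : ∀ᶠ u : ℝ in atTop, ∀ t ∈ Icc a b, 0 < u ^ 2 * (m t - 1) + u * z t + ρ t := by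
      refine eventually_forall_of_isCompact isCompact_Icc
        (Q := fun p => 0 < p.1 ^ 2 * (m p.2 - 1) + p.1 * z p.2 + ρ p.2) fun s hs => ?_
      rcases (hmK s hs).eq_or_lt with h1 | h1
      · by_cases hsS : s ∈ S
        · exact eventually_pos_of_mem_limitSet hab hm hz hρ hmK hs h1.symm (hz0 s hsS)
            (hz1 s hsS) (hgood.2 s hsS)
        · exact eventually_pos_of_pos hmK hz.continuous.continuousAt hρ.continuousAt
            (hgood.1 s (Finset.mem_sdiff.mpr ⟨(hE s).mpr ⟨hs, h1.symm⟩, hsS⟩))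
      · exact eventually_pos_of_one_lt hm.continuous.continuousAt hz.continuous.continuousAt
          hρ.continuousAt h1
    filter_upwards [this] with u hu
    exact iff_of_true hu hgood
  · have : ∀ᶠ u : ℝ in atTop, ¬ ∀ t ∈ Icc a b, 0 < u ^ 2 * (m t - 1) + u * z t + ρ t := by
      rw [not_and_or] at hgood
      push Not at hgood
      rcases hgood with ⟨t, ht, hzt⟩ | ⟨s, hs, hρs⟩
      · have := (hE t).mp (Finset.mem_sdiff.mp ht).1
        exact eventually_not_pos_of_neg this.2 this.1 (lt_of_le_of_ne hzt (hzE t ht))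
      · exact eventually_not_pos_of_notMem_limitSet hab hm hz hρ hmK (hSE' s hs).1 (hSE' s hs).2
          (hz0 s hs) (hz1 s hs) (hy s hs) (hne s hs) hρs
    filter_upwards [this] with u hu
    exact iff_of_false hu hgood

end Contact

end HighMinima

/-! ### Limits and densities of Gaussian vectors -/

namespace HighMinima

section GaussianLimit

variable {Ω : Type*} [MeasurableSpace Ω] {P : Measure Ω}

/-- An almost sure limit of centered Gaussian variables is centered Gaussian, and the variances
converge. -/
lemma gaussian_of_tendsto [IsProbabilityMeasure P] {f : ℕ → Ω → ℝ} {g : Ω → ℝ}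
    (hf : ∀ n, HasGaussianLaw (f n) P)
    (hf0 : ∀ n, ∫ ω, f n ω ∂P = 0) (hlim : ∀ᵐ ω ∂P, Tendsto (fun n => f n ω) atTop (𝓝 (g ω))) :
    HasGaussianLaw g P ∧ ∫ ω, g ω ∂P = 0 ∧
      Tendsto (fun n => Var[f n; P]) atTop (𝓝 Var[g; P]) := by
  have hg : AEMeasurable g P :=
    aemeasurable_of_tendsto_metrizable_ae' (fun n => (hf n).aemeasurable) hlim
  have hchar : ∀ ξ : ℝ, Tendsto (fun n => charFun (P.map (f n)) ξ) atTop
      (𝓝 (charFun (P.map g) ξ)) := by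
    intro ξ
    have e : ∀ h : Ω → ℝ, AEMeasurable h P →
        charFun (P.map h) ξ = ∫ ω, Complex.exp (ξ * h ω * Complex.I) ∂P := by
      intro h hh
      rw [charFun_apply_real, integral_map hh (by fun_prop)]
    rw [e g hg]
    simp_rw [fun n => e (f n) (hf n).aemeasurable]
    refine tendsto_integral_of_dominated_convergence (fun _ => 1) (fun n => ?_) (by simp)
      (fun n => ae_of_all _ fun ω => ?_) ?_
    · have := (hf n).aemeasurable
      exact (Measurable.comp_aemeasurable (g := fun x : ℝ => Complex.exp (ξ * x * Complex.I))
        (by fun_prop) this).aestronglyMeasurable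
    · rw [← Complex.ofReal_mul, Complex.norm_exp_ofReal_mul_I]
    · filter_upwards [hlim] with ω hω
      exact ((Complex.continuous_exp.comp ((continuous_const.mul Complex.continuous_ofReal).mul
        continuous_const)).tendsto (g ω)).comp hω
  set v : ℕ → ℝ := fun n => Var[f n; P] with hv
  have hv0 : ∀ n, 0 ≤ v n := fun n => variance_nonneg _ _
  -- Writing the characteristic functions as `r_n ^ (ξ²)` with `r_n = exp(-v_n/2)` reduces their
  -- convergence for all `ξ` to the convergence of `r_n`, which is read off at `ξ = 1`.
  have hcf : ∀ n (ξ : ℝ), charFun (P.map (f n)) ξ =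
      ((Real.exp (-(v n) / 2) ^ (ξ ^ 2) : ℝ) : ℂ) := by
    intro n ξ
    rw [(hf n).map_eq_gaussianReal, hf0, charFun_gaussianReal, ← Real.exp_mul,
      Real.coe_toNNReal _ (hv0 n), Complex.ofReal_exp]
    congr 1
    simp only [hv]
    push_cast
    ring
  set r : ℝ := (charFun (P.map g) 1).re with hr
  have hr1 : Tendsto (fun n => Real.exp (-(v n) / 2)) atTop (𝓝 r) := by
    have h := (Complex.continuous_re.tendsto _).comp (hchar 1)
    refine h.congr fun n => ?_
    simp only [Function.comp, hcf n 1]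
    rw [Complex.ofReal_re]; simp
  have hr0 : 0 ≤ r := ge_of_tendsto' hr1 fun n => (Real.exp_pos _).le
  have hφ : ∀ ξ : ℝ, ξ ≠ 0 → charFun (P.map g) ξ = ((r ^ (ξ ^ 2) : ℝ) : ℂ) := by
    intro ξ hξ
    refine tendsto_nhds_unique (hchar ξ) ?_
    simp_rw [fun n => hcf n ξ]
    exact (Complex.continuous_ofReal.tendsto _).comp
      (hr1.rpow_const (Or.inr (by positivity)))
  have : IsProbabilityMeasure (P.map g) := Measure.isProbabilityMeasure_map hg
  -- If `r = 0`, that is, if the variances escaped to infinity, the limiting characteristic function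
  -- would vanish off `0` while being `1` at `0`, against its continuity.
  have hrpos : 0 < r := by
    refine lt_of_le_of_ne hr0 fun h0 => ?_
    have hc : Tendsto (charFun (P.map g)) (𝓝[≠] 0) (𝓝 (charFun (P.map g) 0)) :=
      (continuous_charFun.tendsto 0).mono_left nhdsWithin_le_nhds
    have hc' : Tendsto (charFun (P.map g)) (𝓝[≠] 0) (𝓝 0) := by
      refine tendsto_const_nhds.congr' ?_
      filter_upwards [eventually_mem_nhdsWithin] with ξ hξ
      have hξ' : ξ ≠ 0 := hξ
      rw [hφ ξ hξ', ← h0, Real.zero_rpow (by positivity)]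
      simp
    have := tendsto_nhds_unique hc hc'
    rw [charFun_zero] at this
    simp at this
  have hvlim : Tendsto v atTop (𝓝 (-2 * Real.log r)) := by
    have h := (hr1.log hrpos.ne').const_mul (-2)
    refine h.congr fun n => ?_
    rw [Real.log_exp]; ring
  have hw0 : 0 ≤ -2 * Real.log r := ge_of_tendsto' hvlim hv0
  have hlaw : P.map g = gaussianReal 0 (-2 * Real.log r).toNNReal := by
    refine Measure.ext_of_charFun ?_
    ext ξ
    rw [charFun_gaussianReal, Real.coe_toNNReal _ hw0]
    by_cases hξ : ξ = 0
    · simp [hξ]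
    · rw [hφ ξ hξ, Real.rpow_def_of_pos hrpos, Complex.ofReal_exp]
      congr 1
      push_cast
      ring
  have hG : HasGaussianLaw g P := ⟨by rw [hlaw]; infer_instance⟩
  have hmean : ∫ ω, g ω ∂P = 0 := by
    have : ∫ x, x ∂(P.map g) = ∫ ω, g ω ∂P := integral_map hg (by fun_prop)
    rw [← this, hlaw, integral_id_gaussianReal]
  refine ⟨hG, hmean, ?_⟩
  have hvar : Var[g; P] = -2 * Real.log r := by
    have : Var[fun x => x; P.map g] = Var[g; P] := by
      rw [variance_map (by fun_prop) hg]; rfl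
    rw [← this, hlaw, variance_fun_id_gaussianReal, Real.coe_toNNReal _ hw0]
  rw [hvar]
  exact hvlim

/-- A centered Gaussian variable that does not vanish almost surely has no atoms. -/
lemma ae_ne_of_gaussian {g : Ω → ℝ} (hg : HasGaussianLaw g P) (h0 : ∫ ω, g ω ∂P = 0)
    (hne : ¬ ∀ᵐ ω ∂P, g ω = 0) (x : ℝ) : ∀ᵐ ω ∂P, g ω ≠ x := by
  have hlaw := hg.map_eq_gaussianReal
  rw [h0] at hlaw
  have hv : Var[g; P].toNNReal ≠ 0 := by
    intro hv
    rw [hv, gaussianReal_zero_var] at hlaw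
    refine hne ?_
    have : ∀ᵐ y ∂(P.map g), y = 0 := by
      rw [hlaw]; simp
    exact ae_of_ae_map hg.aemeasurable this
  have := nullSingletonClass_gaussianReal (μ := 0) hv
  have h1 : ∀ᵐ y ∂(P.map g), y ≠ x := by
    rw [hlaw, ae_iff]
    simp
  exact ae_of_ae_map hg.aemeasurable h1

end GaussianLimit

section Density

variable {ι : Type*} [Fintype ι]

lemma pi_gaussianReal_eq_withDensity :
    (Measure.pi fun _ : ι => gaussianReal 0 1) = (volume : Measure (ι → ℝ)).withDensity
      fun x => ENNReal.ofReal (∏ i, gaussianPDFReal 0 1 (x i)) := by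
  refine Measure.pi_eq fun s hs => ?_
  rw [withDensity_apply _ (MeasurableSet.univ_pi hs), volume_pi, Measure.restrict_pi_pi,
    ← ofReal_integral_eq_lintegral_ofReal]
  · rw [integral_fintype_prod_eq_prod,
      ENNReal.ofReal_prod_of_nonneg fun i _ =>
        integral_nonneg fun x => gaussianPDFReal_nonneg _ _ _]
    exact Finset.prod_congr rfl fun i _ =>
      (gaussianReal_apply_eq_integral 0 one_ne_zero (s i)).symm
  · exact Integrable.fintype_prod fun i => (integrable_gaussianPDFReal 0 1).restrict
  · exact ae_of_all _ fun x => Finset.prod_nonneg fun i _ => gaussianPDFReal_nonneg _ _ _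

lemma prod_gaussianPDFReal (x : ι → ℝ) : ∏ i, gaussianPDFReal 0 1 (x i) =
    ((2 * Real.pi) ^ ((Fintype.card ι : ℝ) / 2))⁻¹ * Real.exp (-(x ⬝ᵥ x) / 2) := by
  simp only [gaussianPDFReal, NNReal.coe_one, mul_one, sub_zero]
  rw [Finset.prod_mul_distrib, Finset.prod_const, ← Real.exp_sum, Finset.card_univ, inv_pow]
  congr 2
  · rw [Real.sqrt_eq_rpow, ← Real.rpow_natCast, ← Real.rpow_mul (by positivity)]
    congr 1; ring
  · rw [← Finset.sum_div, Finset.sum_neg_distrib, dotProduct]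
    simp only [sq]

variable [DecidableEq ι]

/-- The density of the centered normal distribution with covariance matrix `M`. -/
noncomputable def gaussDensity (M : Matrix ι ι ℝ) (x : ι → ℝ) : ℝ :=
  ((2 * Real.pi) ^ ((Fintype.card ι : ℝ) / 2) * Real.sqrt M.det)⁻¹ *
    Real.exp (-(x ⬝ᵥ (M⁻¹ *ᵥ x)) / 2)

lemma continuous_gaussDensity (M : Matrix ι ι ℝ) : Continuous (gaussDensity M) := by
  unfold gaussDensity
  fun_prop

lemma gaussDensity_pos {M : Matrix ι ι ℝ} (hM : 0 < M.det) (x : ι → ℝ) :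
    0 < gaussDensity M x := by
  unfold gaussDensity
  positivity

variable {Ω : Type*} [MeasurableSpace Ω] {P : Measure Ω} [IsProbabilityMeasure P]

open scoped MatrixOrder in
/-- A centered Gaussian vector with positive definite covariance matrix has a density. -/
lemma map_eq_withDensity_gaussDensity {G : ι → Ω → ℝ} (hG : HasGaussianLaw (fun ω i => G i ω) P)
    (h0 : ∀ i, ∫ ω, G i ω ∂P = 0) {M : Matrix ι ι ℝ} (hM : M.PosDef)
    (hcov : ∀ i j, ∫ ω, G i ω * G j ω ∂P = M i j) :
    P.map (fun ω i => G i ω) = (volume : Measure (ι → ℝ)).withDensity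
      fun x => ENNReal.ofReal (gaussDensity M x) := by
  have hL2 : ∀ i, MemLp (G i) 2 P := fun i => (hG.eval i).memLp_two
  have hmulti : P.map (fun ω => WithLp.toLp 2 (fun i => G i ω)) =
      multivariateGaussian (0 : EuclideanSpace ℝ ι) M := by
    have hG2 : HasGaussianLaw (fun ω => WithLp.toLp 2 (fun i => G i ω)) P := hG.toLp_pi 2
    have := hG2.isGaussian_map
    refine Measure.ext_of_charFun ?_
    ext c
    rw [hG2.charFun_map_eq, charFun_multivariateGaussian hM.posSemidef]
    have e1 : ∀ ω, inner ℝ c (WithLp.toLp 2 (fun i => G i ω)) = ∑ i, c i * G i ω := by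
      intro ω; simp [PiLp.inner_apply, mul_comm]
    simp_rw [e1]
    have h_int : ∀ i, Integrable (fun ω => c i * G i ω) P :=
      fun i => ((hL2 i).integrable (by norm_num)).const_mul _
    have e2 : ∫ ω, ∑ i, c i * G i ω ∂P = 0 := by
      rw [integral_finsetSum _ fun i _ => h_int i]
      simp [integral_const_mul, h0]
    have e3 : Var[fun ω => ∑ i, c i * G i ω; P] = (c : ι → ℝ) ⬝ᵥ M *ᵥ c := by
      rw [variance_of_integral_eq_zero (by
        exact Finset.aemeasurable_fun_sum _ fun i _ => (h_int i).aemeasurable) e2]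
      have e4 : ∀ ω, (∑ i, c i * G i ω) ^ 2 = ∑ i, ∑ j, c i * c j * (G i ω * G j ω) := by
        intro ω
        rw [sq, Finset.sum_mul_sum]
        refine Finset.sum_congr rfl fun i _ => Finset.sum_congr rfl fun j _ => by ring
      simp_rw [e4]
      have hint2 : ∀ i j, Integrable (fun ω => c i * c j * (G i ω * G j ω)) P :=
        fun i j => ((hL2 i).integrable_mul (hL2 j)).const_mul _
      rw [integral_finsetSum _ fun i _ => integrable_finsetSum _ fun j _ => hint2 i j]
      simp_rw [integral_finsetSum _ fun j _ => hint2 _ j, integral_const_mul, hcov]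
      simp only [dotProduct, Matrix.mulVec, Finset.mul_sum]
      refine Finset.sum_congr rfl fun i _ => Finset.sum_congr rfl fun j _ => by ring
    rw [e2, e3]
    simp
  -- The vector has the law of `A` applied to a standard normal vector. The density then follows
  -- from a linear change of variables with Jacobian `det A = √(det M)`.
  set A : Matrix ι ι ℝ := CFC.sqrt M with hA
  have hAA : A * A = M := CFC.sqrt_mul_sqrt_self M hM.posSemidef.nonneg
  have hAT : Aᵀ = A := by
    have : A.PosSemidef := Matrix.nonneg_iff_posSemidef.mp (CFC.sqrt_nonneg M)
    simpa using this.isHermitian.eq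
  have hdetA : A.det = Real.sqrt M.det := by
    have h := hM.posSemidef.det_sqrt
    simpa using h
  have hMdet := hM.det_pos
  have hdet0 : 0 < A.det := by rw [hdetA]; exact Real.sqrt_pos.mpr hMdet
  have hlaw : P.map (fun ω i => G i ω) =
      (Measure.pi fun _ : ι => gaussianReal 0 1).map (Matrix.toLin' A) := by
    have h1 : P.map (fun ω i => G i ω) =
        (P.map (fun ω => WithLp.toLp 2 (fun i => G i ω))).map WithLp.ofLp := by
      rw [AEMeasurable.map_map_of_aemeasurable (by fun_prop) (hG.toLp_pi 2).aemeasurable]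
      rfl
    rw [h1, hmulti, multivariateGaussian, ← map_pi_eq_stdGaussian,
      Measure.map_map (by fun_prop) (by fun_prop), Measure.map_map (by fun_prop) (by fun_prop)]
    congr 1
    ext x i
    simp [hA]
  have hmeas : Measurable (Matrix.toLin' A) :=
    (LinearMap.continuous_of_finiteDimensional _).measurable
  ext s hs
  have hvol := Real.map_matrix_volume_pi_eq_smul_volume_pi hdet0.ne'
  rw [abs_of_pos (inv_pos.mpr hdet0)] at hvol
  have hvol' : (volume : Measure (ι → ℝ)) =
      ENNReal.ofReal A.det • Measure.map (Matrix.toLin' A) volume := by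
    rw [hvol, smul_smul, ← ENNReal.ofReal_mul hdet0.le, mul_inv_cancel₀ hdet0.ne']
    simp
  rw [hlaw, Measure.map_apply hmeas hs, pi_gaussianReal_eq_withDensity,
    withDensity_apply _ (hmeas hs), withDensity_apply _ hs]
  conv_rhs => rw [hvol']
  have hdm : Measurable fun x => ENNReal.ofReal (gaussDensity M x) :=
    (continuous_gaussDensity M).measurable.ennreal_ofReal
  rw [Measure.restrict_smul, lintegral_smul_measure, setLIntegral_map hs hdm hmeas, smul_eq_mul,
    ← lintegral_const_mul _ (show Measurable fun x => ENNReal.ofReal (gaussDensity M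
      (Matrix.toLin' A x)) from hdm.comp hmeas)]
  refine lintegral_congr fun x => ?_
  rw [← ENNReal.ofReal_mul hdet0.le, prod_gaussianPDFReal]
  congr 1
  have hquad : (Matrix.toLin' A x) ⬝ᵥ (M⁻¹ *ᵥ (Matrix.toLin' A x)) = x ⬝ᵥ x := by
    have hu : IsUnit A.det := hdet0.ne'.isUnit
    have : M⁻¹ *ᵥ (A *ᵥ x) = A⁻¹ *ᵥ x := by
      rw [← hAA, Matrix.mul_inv_rev, Matrix.mulVec_mulVec, Matrix.mul_assoc,
        Matrix.nonsing_inv_mul _ hu, Matrix.mul_one]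
    rw [Matrix.toLin'_apply, this, Matrix.dotProduct_mulVec, ← Matrix.mulVec_transpose,
      Matrix.transpose_nonsing_inv, hAT, Matrix.mulVec_mulVec, Matrix.nonsing_inv_mul _ hu,
      Matrix.one_mulVec]
  rw [gaussDensity, hquad, ← hdetA, mul_inv]
  field_simp

/-- A centered Gaussian vector with positive definite covariance matrix charges every non-empty
open set. -/
lemma measure_pos_of_isOpen {G : ι → Ω → ℝ} (hG : HasGaussianLaw (fun ω i => G i ω) P)
    (h0 : ∀ i, ∫ ω, G i ω ∂P = 0) {M : Matrix ι ι ℝ} (hM : M.PosDef)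
    (hcov : ∀ i j, ∫ ω, G i ω * G j ω ∂P = M i j) {U : Set (ι → ℝ)} (hU : IsOpen U)
    (hne : U.Nonempty) : 0 < P {ω | (fun i => G i ω) ∈ U} := by
  have hlaw := map_eq_withDensity_gaussDensity hG h0 hM hcov
  have hac : (volume : Measure (ι → ℝ)) ≪ P.map (fun ω i => G i ω) := by
    rw [hlaw]
    refine withDensity_absolutelyContinuous' ?_ (ae_of_all _ fun x => ?_)
    · exact (continuous_gaussDensity M).measurable.ennreal_ofReal.aemeasurable
    · exact (ENNReal.ofReal_pos.mpr (gaussDensity_pos hM.det_pos x)).ne'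
  have hpos : 0 < P.map (fun ω i => G i ω) U := hac.pos_mono (hU.measure_pos volume hne)
  rwa [Measure.map_apply_of_aemeasurable hG.aemeasurable hU.measurableSet] at hpos

end Density

end HighMinima

/-! ### Energy minimization on an interval -/

namespace HighMinima

section Energy

variable {R : ℝ → ℝ → ℝ} {a b : ℝ} {ν ν' : Measure ℝ}

lemma ae_mem_Icc_of_mem_probOn (hν : ν ∈ probOn a b) : ∀ᵐ s ∂ν, s ∈ Icc a b := by
  rw [ae_iff]; exact hν.2

lemma restrict_Icc_of_mem_probOn (hν : ν ∈ probOn a b) : ν.restrict (Icc a b) = ν :=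
  Measure.restrict_eq_self_of_ae_mem (ae_mem_Icc_of_mem_probOn hν)

lemma integrable_of_continuous (hν : ν ∈ probOn a b) {f : ℝ → ℝ} (hf : Continuous f) :
    Integrable f ν := by
  have := hν.1
  have h : IntegrableOn f (Icc a b) ν := hf.continuousOn.integrableOn_compact isCompact_Icc
  rwa [IntegrableOn, restrict_Icc_of_mem_probOn hν] at h

lemma integrable_prod_of_continuous (hν : ν ∈ probOn a b) (hν' : ν' ∈ probOn a b)
    (hR : Continuous fun p : ℝ × ℝ => R p.1 p.2) :
    Integrable (fun p : ℝ × ℝ => R p.1 p.2) (ν.prod ν') := by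
  have := hν.1
  have := hν'.1
  have h : IntegrableOn (fun p : ℝ × ℝ => R p.1 p.2) (Icc a b ×ˢ Icc a b) (ν.prod ν') :=
    hR.continuousOn.integrableOn_compact (isCompact_Icc.prod isCompact_Icc)
  rwa [IntegrableOn, ← Measure.prod_restrict, restrict_Icc_of_mem_probOn hν,
    restrict_Icc_of_mem_probOn hν'] at h

/-- The mutual energy is symmetric. -/
lemma mutual_energy_comm (hν : ν ∈ probOn a b) (hν' : ν' ∈ probOn a b)
    (hR : Continuous fun p : ℝ × ℝ => R p.1 p.2) (hsymm : ∀ s t, R s t = R t s) :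
    ∫ t, ∫ s, R s t ∂ν ∂ν' = ∫ t, ∫ s, R s t ∂ν' ∂ν := by
  have := hν.1
  have := hν'.1
  rw [integral_integral_swap (f := fun t s => R s t)]
  · refine integral_congr_ae (ae_of_all _ fun t => integral_congr_ae (ae_of_all _ fun s => ?_))
    exact hsymm _ _
  · have := integrable_prod_of_continuous hν' hν hR
    refine this.congr (ae_of_all _ fun p => ?_)
    exact hsymm _ _

/-- Mixtures stay in the class of admissible measures. -/
lemma mix_mem_probOn (hν : ν ∈ probOn a b) (hν' : ν' ∈ probOn a b) {ε : ℝ} (h0 : 0 ≤ ε)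
    (h1 : ε ≤ 1) : ENNReal.ofReal (1 - ε) • ν + ENNReal.ofReal ε • ν' ∈ probOn a b := by
  have := hν.1
  have := hν'.1
  refine ⟨⟨?_⟩, ?_⟩
  · simp [← ENNReal.ofReal_add (sub_nonneg.mpr h1) h0]
  · simp [hν.2, hν'.2]

lemma energy_mix (hν : ν ∈ probOn a b) (hν' : ν' ∈ probOn a b)
    (hR : HasPowerExpansion R) (hsymm : ∀ s t, R s t = R t s) {ε : ℝ}
    (h0 : 0 ≤ ε) (h1 : ε ≤ 1) :
    energy R (ENNReal.ofReal (1 - ε) • ν + ENNReal.ofReal ε • ν') =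
      (1 - ε) ^ 2 * energy R ν + 2 * ε * (1 - ε) * (∫ t, ∫ s, R s t ∂ν ∂ν') +
        ε ^ 2 * energy R ν' := by
  have hcont := hR.continuous
  have hp : ∀ ν ∈ probOn a b, Continuous fun t => ∫ s, R s t ∂ν := fun ν hν => by
    obtain ⟨c, hc⟩ := hR.exists_hasEntireSeries_integral hν
    exact hc.continuous
  have key : ∀ f : ℝ → ℝ, Continuous f →
      ∫ x, f x ∂(ENNReal.ofReal (1 - ε) • ν + ENNReal.ofReal ε • ν') =
        (1 - ε) * ∫ x, f x ∂ν + ε * ∫ x, f x ∂ν' := by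
    intro f hf
    rw [integral_add_measure
      ((integrable_of_continuous hν hf).smul_measure ENNReal.ofReal_ne_top)
      ((integrable_of_continuous hν' hf).smul_measure ENNReal.ofReal_ne_top),
      integral_smul_measure, integral_smul_measure, ENNReal.toReal_ofReal (by linarith),
      ENNReal.toReal_ofReal h0]
    rfl
  have hinner : ∀ t, ∫ s, R s t ∂(ENNReal.ofReal (1 - ε) • ν + ENNReal.ofReal ε • ν') =
      (1 - ε) * ∫ s, R s t ∂ν + ε * ∫ s, R s t ∂ν' :=
    fun t => key _ (hcont.comp (by fun_prop : Continuous fun s : ℝ => (s, t)))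
  have hcomb : Continuous fun t => (1 - ε) * ∫ s, R s t ∂ν + ε * ∫ s, R s t ∂ν' :=
    ((hp ν hν).const_mul _).add ((hp ν' hν').const_mul _)
  have hsplit : ∀ ρ ∈ probOn a b, ∫ t, ((1 - ε) * ∫ s, R s t ∂ν + ε * ∫ s, R s t ∂ν') ∂ρ =
      (1 - ε) * (∫ t, ∫ s, R s t ∂ν ∂ρ) + ε * ∫ t, ∫ s, R s t ∂ν' ∂ρ := by
    intro ρ hρ
    rw [integral_add ((integrable_of_continuous hρ (hp ν hν)).const_mul _)
      ((integrable_of_continuous hρ (hp ν' hν')).const_mul _), integral_const_mul,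
      integral_const_mul]
  unfold energy
  simp_rw [hinner]
  rw [key _ hcomb, hsplit ν hν, hsplit ν' hν', mutual_energy_comm hν' hν hcont hsymm]
  ring

/-- First order condition at an optimal measure. -/
lemma IsOptimal.energy_le (h : IsOptimal R a b ν) (hν' : ν' ∈ probOn a b)
    (hR : HasPowerExpansion R) (hsymm : ∀ s t, R s t = R t s) :
    energy R ν ≤ ∫ t, ∫ s, R s t ∂ν ∂ν' := by
  set V := energy R ν
  set I := ∫ t, ∫ s, R s t ∂ν ∂ν'
  set V' := energy R ν'
  -- Minimality against the mixture with weight `ε` on `ν'`, divided by `ε`; letting `ε` tend to `0`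
  -- leaves the linear term.
  have hineq : ∀ ε : ℝ, 0 < ε → ε ≤ 1 → 0 ≤ 2 * (I - V) + ε * (V - 2 * I + V') := by
    intro ε h0 h1
    have hmin := h.2 (mix_mem_probOn h.1 hν' h0.le h1)
    simp only [mem_ofPred_eq] at hmin
    rw [energy_mix h.1 hν' hR hsymm h0.le h1] at hmin
    have : 0 ≤ ε * (2 * (I - V) + ε * (V - 2 * I + V')) := by
      simp only [V, I, V'] at hmin ⊢
      nlinarith
    exact nonneg_of_mul_nonneg_right this h0
  have hlim : Tendsto (fun ε : ℝ => 2 * (I - V) + ε * (V - 2 * I + V')) (𝓝[>] 0)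
      (𝓝 (2 * (I - V) + 0 * (V - 2 * I + V'))) :=
    (Continuous.tendsto (by fun_prop) 0).mono_left nhdsWithin_le_nhds
  have : 0 ≤ 2 * (I - V) + 0 * (V - 2 * I + V') := by
    refine ge_of_tendsto hlim ?_
    filter_upwards [Ioc_mem_nhdsGT (zero_lt_one' ℝ)] with ε hε
    exact hineq ε hε.1 hε.2
  linarith

lemma dirac_mem_probOn {t : ℝ} (ht : t ∈ Icc a b) : Measure.dirac t ∈ probOn a b :=
  ⟨inferInstance, by rw [Measure.dirac_apply' _ measurableSet_Icc.compl]; simp [ht.1, ht.2]⟩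

lemma IsOptimal.energy_le_potential (h : IsOptimal R a b ν)
    (hR : HasPowerExpansion R) (hsymm : ∀ s t, R s t = R t s) {t : ℝ} (ht : t ∈ Icc a b) :
    energy R ν ≤ ∫ s, R s t ∂ν := by
  have := h.energy_le (dirac_mem_probOn ht) hR hsymm
  simpa using this

/-- The potential is at least the minimal energy on `[a,b]`, and its `ν`-mean is that energy. So
equality holds `ν`-almost everywhere, and on the support because the equality set is closed. -/
lemma IsOptimal.support_subset (h : IsOptimal R a b ν)
    (hR : HasPowerExpansion R) (hsymm : ∀ s t, R s t = R t s) :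
    ν.support ⊆ {t ∈ Icc a b | ∫ s, R s t ∂ν = energy R ν} := by
  have := h.1.1
  obtain ⟨c, hc⟩ := hR.exists_hasEntireSeries_integral h.1
  have h_int := integrable_of_continuous h.1 hc.continuous
  have hae : ∀ᵐ t ∂ν, ∫ s, R s t ∂ν = energy R ν := by
    have h0 : ∫ t, (∫ s, R s t ∂ν - energy R ν) ∂ν = 0 := by
      rw [integral_sub h_int (integrable_const _)]
      simp [energy]
    rw [integral_eq_zero_iff_of_nonneg_ae] at h0
    · filter_upwards [h0] with t ht
      simpa [sub_eq_zero] using ht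
    · filter_upwards [ae_mem_Icc_of_mem_probOn h.1] with t ht
      exact sub_nonneg.mpr (h.energy_le_potential hR hsymm ht)
    · exact h_int.sub (integrable_const _)
  refine Measure.support_subset_of_isClosed ?_ ?_
  · exact isClosed_Icc.inter (isClosed_singleton.preimage hc.continuous)
  · filter_upwards [hae, ae_mem_Icc_of_mem_probOn h.1] with t h1 h2
    exact ⟨h2, h1⟩

/-- Optimal measures exist. -/
lemma exists_isOptimal (hab : a ≤ b) (hcont : Continuous fun p : ℝ × ℝ => R p.1 p.2) :
    ∃ ν, IsOptimal R a b ν := by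
  have : Inhabited (Icc a b) := ⟨⟨a, left_mem_Icc.mpr hab⟩⟩
  let f : BoundedContinuousFunction (Icc a b × Icc a b) ℝ :=
    BoundedContinuousFunction.mkOfCompact
      ⟨fun p => R p.1 p.2, hcont.comp (by fun_prop : Continuous fun p : Icc a b × Icc a b =>
        ((p.1 : ℝ), (p.2 : ℝ)))⟩
  -- The probability measures on `[a,b]` are weakly compact, and the energy is weakly continuous
  -- because `π ↦ π ⊗ π` is.
  let e : ProbabilityMeasure (Icc a b) → ℝ := fun π => ∫ p, f p ∂(π.prod π : Measure _)
  have he : Continuous e := by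
    rw [continuous_iff_continuousAt]
    intro π
    have h1 : Tendsto (fun π : ProbabilityMeasure (Icc a b) => π.prod π) (𝓝 π) (𝓝 (π.prod π)) :=
      (ProbabilityMeasure.continuous_prod.comp (by fun_prop :
        Continuous fun π : ProbabilityMeasure (Icc a b) => (π, π))).tendsto π
    exact (ProbabilityMeasure.tendsto_iff_forall_integral_tendsto.mp h1) f
  have hmap : ∀ π : ProbabilityMeasure (Icc a b),
      (π : Measure (Icc a b)).map Subtype.val ∈ probOn a b := by
    intro π
    refine ⟨Measure.isProbabilityMeasure_map (by fun_prop), ?_⟩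
    rw [Measure.map_apply (by fun_prop) measurableSet_Icc.compl]
    simp
  have hen : ∀ π : ProbabilityMeasure (Icc a b),
      energy R ((π : Measure (Icc a b)).map Subtype.val) = e π := by
    intro π
    have hme : MeasurableEmbedding (Subtype.val : Icc a b → ℝ) :=
      MeasurableEmbedding.subtype_coe measurableSet_Icc
    simp only [energy, e, ProbabilityMeasure.toMeasure_prod]
    rw [hme.integral_map]
    simp_rw [hme.integral_map]
    rw [integral_prod_symm]
    · rfl
    · exact f.integrable _
  obtain ⟨π, -, hπ⟩ := isCompact_univ.exists_isMinOn (univ_nonempty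
    (α := ProbabilityMeasure (Icc a b))) he.continuousOn
  refine ⟨_, hmap π, fun ν' hν' => ?_⟩
  have := hν'.1
  let π' : ProbabilityMeasure (Icc a b) := ⟨ν'.comap Subtype.val, by
    refine ⟨?_⟩
    rw [comap_subtype_coe_apply measurableSet_Icc, image_univ, Subtype.range_coe]
    rw [← prob_compl_eq_zero_iff measurableSet_Icc]; exact hν'.2⟩
  have hπ' : (π' : Measure (Icc a b)).map Subtype.val = ν' := by
    change (ν'.comap Subtype.val).map Subtype.val = ν'
    rw [map_comap_subtype_coe measurableSet_Icc, restrict_Icc_of_mem_probOn hν']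
  have := hπ (mem_univ π')
  simp only [mem_ofPred_eq] at this ⊢
  rw [hen, ← hπ', hen]
  exact this

lemma eq_sum_dirac_of_compl_null {T : Finset ℝ} (hT : ν (T : Set ℝ)ᶜ = 0) :
    ν = ∑ s ∈ T, ν {s} • Measure.dirac s := by
  ext A hA
  have h1 : ν A = ν (⋃ s ∈ T, A ∩ {s}) := by
    have : A ∩ (T : Set ℝ) = ⋃ s ∈ T, A ∩ {s} := by
      ext x; simp
    rw [← this]
    exact (measure_inter_conull hT).symm
  rw [h1, measure_biUnion_finset]
  · rw [Measure.finsetSum_apply]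
    refine Finset.sum_congr rfl fun s _ => ?_
    by_cases hs : s ∈ A
    · simp [hs, hA]
    · have : A ∩ {s} = ∅ := by ext x; simp; rintro h rfl; exact hs h
      simp [this, hs, hA]
  · intro s _ t _ hst
    exact (disjoint_singleton.mpr hst).mono inter_subset_right inter_subset_right
  · exact fun s _ => hA.inter (measurableSet_singleton s)

lemma integral_eq_sum_of_compl_null [IsFiniteMeasure ν] {T : Finset ℝ}
    (hT : ν (T : Set ℝ)ᶜ = 0) (f : ℝ → ℝ) : ∫ x, f x ∂ν = ∑ s ∈ T, ν.real {s} * f s := by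
  conv_lhs => rw [eq_sum_dirac_of_compl_null hT]
  rw [integral_finsetSum_measure]
  · refine Finset.sum_congr rfl fun s _ => ?_
    rw [integral_smul_measure, integral_dirac]
    rfl
  · exact fun s _ => (integrable_dirac (by simp)).smul_measure (measure_ne_top _ _)

/-- Positive definiteness of a kernel, in a form convenient for finitely supported measures. -/
def StrictlyPositive (R : ℝ → ℝ → ℝ) : Prop :=
  ∀ (T : Finset ℝ) (c : ℝ → ℝ), ∑ t ∈ T, ∑ s ∈ T, c t * c s * R s t ≤ 0 → ∀ t ∈ T, c t = 0

/-- The quadratic form at the signed measure `ν - ν'` equals `2V` minus twice the mutual energy,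
which is at most `0` by the first order condition. Strict positivity on finite sets of points forces
`ν = ν'`. -/
lemma eq_of_isOptimal_of_finite (hR : HasPowerExpansion R) (hsymm : ∀ s t, R s t = R t s)
    (hpos : StrictlyPositive R) (h : IsOptimal R a b ν) (h' : IsOptimal R a b ν')
    (hfin : ν.support.Finite) (hfin' : ν'.support.Finite) : ν = ν' := by
  have := h.1.1
  have := h'.1.1
  set T : Finset ℝ := hfin.toFinset ∪ hfin'.toFinset with hTdef
  have hT : ν (T : Set ℝ)ᶜ = 0 := by
    refine measure_mono_null (compl_subset_compl.mpr ?_) Measure.measure_compl_support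
    simp [hTdef]
  have hT' : ν' (T : Set ℝ)ᶜ = 0 := by
    refine measure_mono_null (compl_subset_compl.mpr ?_) Measure.measure_compl_support
    simp [hTdef]
  have hVV : energy R ν = energy R ν' := le_antisymm (h.2 h'.1) (h'.2 h.1)
  have hI := h.energy_le h'.1 hR hsymm
  have hI2 := mutual_energy_comm h.1 h'.1 hR.continuous hsymm
  have hsum : ∑ t ∈ T, ∑ s ∈ T, (ν.real {t} - ν'.real {t}) * (ν.real {s} - ν'.real {s}) * R s t
      ≤ 0 := by
    have e : ∀ ρ ρ' : Measure ℝ, [IsFiniteMeasure ρ] → [IsFiniteMeasure ρ'] →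
        ρ (T : Set ℝ)ᶜ = 0 → ρ' (T : Set ℝ)ᶜ = 0 →
        ∫ t, ∫ s, R s t ∂ρ ∂ρ' = ∑ t ∈ T, ∑ s ∈ T, ρ'.real {t} * ρ.real {s} * R s t := by
      intro ρ ρ' _ _ h1 h2
      rw [integral_eq_sum_of_compl_null h2]
      refine Finset.sum_congr rfl fun t _ => ?_
      rw [integral_eq_sum_of_compl_null h1, Finset.mul_sum]
      exact Finset.sum_congr rfl fun s _ => by ring
    have e1 : ∑ t ∈ T, ∑ s ∈ T,
        (ν.real {t} - ν'.real {t}) * (ν.real {s} - ν'.real {s}) * R s t =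
        energy R ν + energy R ν' - ∫ t, ∫ s, R s t ∂ν ∂ν' - ∫ t, ∫ s, R s t ∂ν' ∂ν := by
      rw [energy, energy, e ν ν hT hT, e ν' ν' hT' hT', e ν ν' hT hT', e ν' ν hT' hT]
      simp only [← Finset.sum_add_distrib, ← Finset.sum_sub_distrib]
      exact Finset.sum_congr rfl fun t _ => Finset.sum_congr rfl fun s _ => by ring
    rw [e1, ← hI2, ← hVV]
    linarith
  have hw := hpos T (fun t => ν.real {t} - ν'.real {t}) hsum
  rw [eq_sum_dirac_of_compl_null hT, eq_sum_dirac_of_compl_null hT']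
  refine Finset.sum_congr rfl fun s hs => ?_
  have h1 : ν.real {s} = ν'.real {s} := sub_eq_zero.mp (hw s hs)
  rw [(measureReal_eq_measureReal_iff (measure_ne_top _ _) (measure_ne_top _ _)).mp h1]

/-- Every point of a finite support is isolated in it, so the mass of a small neighbourhood sits at
the point. -/
lemma measure_singleton_pos_of_finite_support [IsFiniteMeasure ν] (hfin : ν.support.Finite)
    {s : ℝ} (hs : s ∈ ν.support) : 0 < ν.real {s} := by
  have hU : (ν.support \ {s})ᶜ ∈ 𝓝 s :=
    (hfin.subset sdiff_subset).isClosed.isOpen_compl.mem_nhds (by simp)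
  have h1 := (Measure.mem_support_iff_forall s).mp hs _ hU
  have h2 : ν (ν.support \ {s})ᶜ ≤ ν {s} := by
    have : (ν.support \ {s})ᶜ ⊆ ν.supportᶜ ∪ {s} := by
      intro x hx
      by_cases h : x ∈ ν.support
      · right; by_contra h'; exact hx ⟨h, h'⟩
      · left; exact h
    refine (measure_mono this).trans ((measure_union_le _ _).trans ?_)
    simp
  exact ENNReal.toReal_pos (h1.trans_le h2).ne' (measure_ne_top _ _)

end Energy

section Structure

variable {R : ℝ → ℝ → ℝ} {a b : ℝ}

lemma covMatrix_posDef (hsymm : ∀ s t, R s t = R t s) (hpos : StrictlyPositive R)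
    (S : Finset ℝ) : (covMatrix R S).PosDef := by
  classical
  refine Matrix.PosDef.of_dotProduct_mulVec_pos ?_ fun x hx => ?_
  · ext s t; simp [covMatrix, hsymm]
  · by_contra hle
    rw [not_lt] at hle
    refine hx ?_
    set c : ℝ → ℝ := fun t => if h : t ∈ S then x ⟨t, h⟩ else 0 with hc
    have hc' : ∀ s : S, c s = x s := fun s => by simp [hc]
    have := hpos S c (by
      rw [← Finset.sum_coe_sort]
      simp_rw [← Finset.sum_coe_sort S]
      refine le_trans (le_of_eq ?_) hle
      simp only [dotProduct, Matrix.mulVec, covMatrix, Matrix.of_apply, Finset.mul_sum,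
        Pi.star_apply, star_trivial, hc']
      exact Finset.sum_congr rfl fun t _ => Finset.sum_congr rfl fun s _ => by
        rw [hsymm s t]; ring)
    ext s
    rw [← hc']
    exact this s s.2

lemma regression_self {S : Finset ℝ} (hM : (covMatrix R S).PosDef) (s : S) (x : S → ℝ) :
    regression R S s x = x s := by
  have hu : IsUnit (covMatrix R S).det := hM.det_pos.ne'.isUnit
  have : regression R S s x = (covMatrix R S *ᵥ ((covMatrix R S)⁻¹ *ᵥ x)) s := rfl
  rw [this, Matrix.mulVec_mulVec, Matrix.mul_nonsing_inv _ hu, Matrix.one_mulVec]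

/-- What the variational problem says about the optimal measure and its support. -/
structure OptimalStructure (R : ℝ → ℝ → ℝ) (a b : ℝ) (ν : Measure ℝ) (S : Finset ℝ) : Prop where
  optimal : IsOptimal R a b ν
  unique : ∀ ν', IsOptimal R a b ν' → ν' = ν
  support_eq : (S : Set ℝ) = ν.support
  nonempty : S.Nonempty
  subset : ∀ s ∈ S, s ∈ Icc a b
  posDef : (covMatrix R S).PosDef
  theta_pos : ∀ s, 0 < theta R S s
  sum_theta : ∑ s, theta R S s = (energy R ν)⁻¹
  energy_pos : 0 < energy R ν
  one_le_mu : ∀ t ∈ Icc a b, 1 ≤ mu R S t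
  finite_essential : (essentialSet R S a b).Finite

/-- An infinite contact set would make the entire potential constant, against `hconst`. With finite
support `S`, the equality of the potential with `V` on `S` says that `Σ` maps the weights `ν{s}/V`
to `1`. Thus these weights are `θ`, `μ` is the potential over `V`, and the remaining claims follow
from the first order condition. -/
lemma exists_optimalStructure (hab : a ≤ b) (hR : HasPowerExpansion R)
    (hsymm : ∀ s t, R s t = R t s) (hpos : StrictlyPositive R)
    (henergy : ∀ ν ∈ probOn a b, 0 < energy R ν)
    (hconst : ∀ ν ∈ probOn a b, ∀ V : ℝ, 0 < V → ¬ ∀ t, ∫ s, R s t ∂ν = V) :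
    ∃ ν S, OptimalStructure R a b ν S := by
  obtain ⟨ν, hν⟩ := exists_isOptimal hab hR.continuous
  have hfinE : ∀ ν, IsOptimal R a b ν →
      {t ∈ Icc a b | ∫ s, R s t ∂ν = energy R ν}.Finite := by
    intro ν hν
    by_contra hinf
    obtain ⟨c, hc⟩ := hR.exists_hasEntireSeries_integral hν.1
    exact hconst ν hν.1 _ (henergy ν hν.1) fun t => hc.eq_of_infinite hinf t
  have hfin : ∀ ν, IsOptimal R a b ν → ν.support.Finite := fun ν hν =>
    (hfinE ν hν).subset (hν.support_subset hR hsymm)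
  have := hν.1.1
  set S := (hfin ν hν).toFinset with hS
  have hSs : (S : Set ℝ) = ν.support := by simp [hS]
  have hnull : ν (S : Set ℝ)ᶜ = 0 := by rw [hSs]; exact Measure.measure_compl_support
  have hsub := hν.support_subset hR hsymm
  have hV := henergy ν hν.1
  have hM := covMatrix_posDef hsymm hpos S
  have hu : IsUnit (covMatrix R S).det := hM.det_pos.ne'.isUnit
  have hpot : ∀ t, ∫ s, R s t ∂ν = ∑ s : S, ν.real {(s : ℝ)} * R s t := fun t => by
    rw [integral_eq_sum_of_compl_null hnull, ← Finset.sum_coe_sort]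
  have hθ : theta R S = fun s : S => (energy R ν)⁻¹ * ν.real {(s : ℝ)} := by
    have h1 : covMatrix R S *ᵥ (fun s : S => (energy R ν)⁻¹ * ν.real {(s : ℝ)}) = 1 := by
      ext t
      have ht : (t : ℝ) ∈ ν.support := by rw [← hSs]; exact t.2
      have h2 := (hsub ht).2
      rw [hpot] at h2
      simp only [Matrix.mulVec, dotProduct, covMatrix, Matrix.of_apply, Pi.one_apply]
      calc ∑ s : S, R t s * ((energy R ν)⁻¹ * ν.real {(s : ℝ)})
          = (energy R ν)⁻¹ * ∑ s : S, ν.real {(s : ℝ)} * R s t := by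
            rw [Finset.mul_sum]
            exact Finset.sum_congr rfl fun s _ => by rw [hsymm t s]; ring
        _ = 1 := by rw [h2, inv_mul_cancel₀ hV.ne']
    rw [theta, ← h1, Matrix.mulVec_mulVec, Matrix.nonsing_inv_mul _ hu, Matrix.one_mulVec]
  have hmu : ∀ t, mu R S t = (energy R ν)⁻¹ * ∫ s, R s t ∂ν := by
    intro t
    have : mu R S t = (fun s : S => R t s) ⬝ᵥ theta R S := rfl
    rw [this, hθ, hpot, dotProduct, Finset.mul_sum]
    exact Finset.sum_congr rfl fun s _ => by rw [hsymm t s]; ring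
  refine ⟨ν, S, hν, fun ν' hν' => ?_, hSs, ?_, fun s hs => ?_, hM, fun s => ?_, ?_, hV,
    fun t ht => ?_, ?_⟩
  · exact eq_of_isOptimal_of_finite hR hsymm hpos hν' hν (hfin ν' hν') (hfin ν hν)
  · rw [← Finset.coe_nonempty, hSs]
    exact Measure.nonempty_support (NeZero.ne ν)
  · exact (hsub (hSs ▸ hs : s ∈ ν.support)).1
  · rw [hθ]
    exact mul_pos (inv_pos.mpr hV)
      (measure_singleton_pos_of_finite_support (hfin ν hν) (hSs ▸ s.2 : (s : ℝ) ∈ ν.support))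
  · rw [hθ, ← Finset.mul_sum]
    have := integral_eq_sum_of_compl_null hnull (fun _ => 1)
    simp only [integral_const, probReal_univ, smul_eq_mul, mul_one] at this
    rw [Finset.sum_coe_sort S (fun s => ν.real {s}), ← this, mul_one]
  · rw [hmu, ← inv_mul_cancel₀ hV.ne']
    exact mul_le_mul_of_nonneg_left (hν.energy_le_potential hR hsymm ht) (inv_pos.mpr hV).le
  · refine (hfinE ν hν).subset ?_
    rintro t ⟨ht, hm⟩
    refine ⟨ht, ?_⟩
    rw [hmu] at hm
    field_simp at hm
    exact hm

end Structure

end HighMinima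

/-! ### Regression and the independent residual -/

namespace HighMinima

section Regression

variable {R : ℝ → ℝ → ℝ} {S : Finset ℝ}

/-- The coefficient of `x_s` in the regression function. -/
noncomputable def regCoeff (R : ℝ → ℝ → ℝ) (S : Finset ℝ) (t : ℝ) (s : S) : ℝ :=
  ∑ r : S, R t r * (covMatrix R S)⁻¹ r s

lemma regression_eq_sum (t : ℝ) (x : S → ℝ) :
    regression R S t x = ∑ s, regCoeff R S t s * x s := by
  simp only [regression, regCoeff, dotProduct, Matrix.mulVec, Finset.mul_sum, Finset.sum_mul]
  rw [Finset.sum_comm]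
  exact Finset.sum_congr rfl fun s _ => Finset.sum_congr rfl fun r _ => by ring

/-- The data are a column of `Σ`, so `Σ⁻¹` turns them into a unit vector. These are the normal
equations that make the residual uncorrelated with `X_s`. -/
lemma regression_covariance (hM : (covMatrix R S).PosDef) (hsymm : ∀ s t, R s t = R t s)
    (t : ℝ) (s : S) : regression R S t (fun r => R s r) = R t s := by
  have hu : IsUnit (covMatrix R S).det := hM.det_pos.ne'.isUnit
  have h1 : (fun r : S => R s r) = covMatrix R S *ᵥ Pi.single s 1 := by
    ext r
    simp [covMatrix, hsymm]
  rw [regression, h1, Matrix.mulVec_mulVec, Matrix.nonsing_inv_mul _ hu, Matrix.one_mulVec]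
  simp

lemma contDiff_regCoeff (hR : HasPowerExpansion R) (s : S) :
    ContDiff ℝ ((⊤ : ℕ∞) : WithTop ℕ∞) fun t => regCoeff R S t s := by
  unfold regCoeff
  refine ContDiff.sum fun r _ => ?_
  obtain ⟨c, hc⟩ := hR.exists_hasEntireSeries (r : ℝ)
  exact hc.contDiff.mul contDiff_const

lemma contDiff_regression (hR : HasPowerExpansion R) (x : S → ℝ) :
    ContDiff ℝ ((⊤ : ℕ∞) : WithTop ℕ∞) fun t => regression R S t x := by
  simp_rw [regression_eq_sum]
  exact ContDiff.sum fun s _ => (contDiff_regCoeff hR s).mul contDiff_const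

lemma deriv_regression (hR : HasPowerExpansion R) (x : S → ℝ) (t : ℝ) :
    deriv (fun t => regression R S t x) t =
      ∑ s, deriv (fun t => regCoeff R S t s) t * x s := by
  simp_rw [regression_eq_sum]
  rw [deriv_fun_sum fun s _ => ?_]
  · refine Finset.sum_congr rfl fun s _ => ?_
    rw [deriv_mul_const ((contDiff_regCoeff hR s).differentiable (by simp) t)]
  · exact ((contDiff_regCoeff hR s).differentiable (by simp) t).mul_const _

lemma measurable_regression (t : ℝ) : Measurable fun x : S → ℝ => regression R S t x := by
  simp_rw [regression_eq_sum]
  fun_prop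

lemma regression_add (t : ℝ) (x y : S → ℝ) :
    regression R S t (x + y) = regression R S t x + regression R S t y := by
  simp [regression_eq_sum, mul_add, Finset.sum_add_distrib]

lemma regression_smul (t c : ℝ) (x : S → ℝ) :
    regression R S t (c • x) = c * regression R S t x := by
  simp only [regression_eq_sum, Pi.smul_apply, smul_eq_mul, Finset.mul_sum]
  exact Finset.sum_congr rfl fun s _ => by ring

end Regression

section Gaussian

variable {Ω : Type*} [MeasurableSpace Ω] {P : Measure Ω} {X : ℝ → Ω → ℝ} {S : Finset ℝ}

lemma covFn_comm (s t : ℝ) : covFn X P s t = covFn X P t s := by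
  simp only [covFn, mul_comm]

lemma memLp_two_of_gaussian (hX : IsGaussianProcess X P) (t : ℝ) : MemLp (X t) 2 P :=
  (hX.hasGaussianLaw_eval t).memLp_two

lemma measurable_procY (hm : ∀ t, Measurable (X t)) (t : ℝ) : Measurable (procY X P S t) :=
  (measurable_regression t).comp (measurable_pi_lambda _ fun s => hm s)

lemma measurable_procZ (hm : ∀ t, Measurable (X t)) (t : ℝ) : Measurable (procZ X P S t) :=
  (hm t).sub (measurable_procY hm t)

lemma procZ_eq (t : ℝ) (ω : Ω) :
    procZ X P S t ω = X t ω - ∑ s : S, regCoeff (covFn X P) S t s * X s ω := by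
  rw [procZ, procY, regression_eq_sum]

lemma integral_procZ (hX : IsGaussianProcess X P) (h0 : ∀ t, ∫ ω, X t ω ∂P = 0) (t : ℝ) :
    ∫ ω, procZ X P S t ω ∂P = 0 := by
  have hi : ∀ t, Integrable (X t) P := fun t => (hX.hasGaussianLaw_eval t).integrable
  simp_rw [procZ_eq]
  rw [integral_sub (hi t) (integrable_finsetSum _ fun (s : S) _ => (hi s).const_mul _), h0,
    integral_finsetSum _ fun (s : S) _ => (hi s).const_mul _]
  simp [integral_const_mul, h0]

lemma integral_mul_procZ (hX : IsGaussianProcess X P)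
    (hM : (covMatrix (covFn X P) S).PosDef) (s : S) (t : ℝ) :
    ∫ ω, X s ω * procZ X P S t ω ∂P = 0 := by
  have hi : ∀ s t, Integrable (fun ω => X s ω * X t ω) P := fun s t =>
    (memLp_two_of_gaussian hX s).integrable_mul (memLp_two_of_gaussian hX t)
  have e : ∀ ω, X s ω * procZ X P S t ω =
      X s ω * X t ω - ∑ r : S, regCoeff (covFn X P) S t r * (X s ω * X r ω) := by
    intro ω
    rw [procZ_eq, mul_sub, Finset.mul_sum]
    congr 1
    exact Finset.sum_congr rfl fun r _ => by ring
  simp_rw [e]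
  rw [integral_sub (hi _ _) (integrable_finsetSum _ fun r _ => (hi _ _).const_mul _),
    integral_finsetSum _ fun r _ => (hi _ _).const_mul _]
  simp_rw [integral_const_mul]
  have := regression_covariance hM covFn_comm t s
  rw [regression_eq_sum] at this
  change covFn X P s t - ∑ r : S, regCoeff (covFn X P) S t r * covFn X P s r = 0
  rw [this, covFn_comm, sub_self]

/-- The residual process is independent of the values on `S`. -/
lemma indepFun_procZ (hX : IsGaussianProcess X P) (hm : ∀ t, Measurable (X t))
    (h0 : ∀ t, ∫ ω, X t ω ∂P = 0) (hM : (covMatrix (covFn X P) S).PosDef) :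
    IndepFun (fun ω (s : S) => X s ω) (fun ω t => procZ X P S t ω) P := by
  classical
  refine IsGaussianProcess.indepFun_of_covariance_eq_zero (X := fun s : S => X s)
    (Y := procZ X P S) ?_ (fun s => (hm s).aemeasurable)
    (fun t => (measurable_procZ hm t).aemeasurable) fun s t => ?_
  · refine hX.of_isGaussianProcess fun i => ?_
    rcases i with s | t
    · exact ⟨{(s : ℝ)}, ContinuousLinearMap.proj ⟨(s : ℝ), by simp⟩, fun ω => rfl⟩
    · refine ⟨insert t S, ContinuousLinearMap.proj ⟨t, by simp⟩ -
        ∑ s : S, regCoeff (covFn X P) S t s •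
          ContinuousLinearMap.proj (⟨(s : ℝ), by simp⟩ : (insert t S : Finset ℝ)), fun ω => ?_⟩
      simp [procZ_eq]
  · have := hX.isProbabilityMeasure
    have hZ2 : MemLp (procZ X P S t) 2 P := by
      have : procZ X P S t = fun ω => X t ω - ∑ s : S, regCoeff (covFn X P) S t s * X s ω := by
        ext ω; exact procZ_eq t ω
      rw [this]
      exact (memLp_two_of_gaussian hX t).sub
        (memLp_finsetSum _ fun s _ => (memLp_two_of_gaussian hX s).const_mul _)
    rw [covariance_eq_sub (memLp_two_of_gaussian hX s) hZ2, h0, zero_mul, sub_zero]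
    exact integral_mul_procZ hX hM s t

/-- In `X = Y + Z` the first summand is a function of the values on `S`, while the second is
independent of them and centered. -/
lemma procY_ae_eq_condExp (hX : IsGaussianProcess X P) (hm : ∀ t, Measurable (X t))
    (h0 : ∀ t, ∫ ω, X t ω ∂P = 0) (hM : (covMatrix (covFn X P) S).PosDef) (t : ℝ) :
    procY X P S t =ᵐ[P]
      P[X t | MeasurableSpace.comap (fun ω (s : S) => X s ω) MeasurableSpace.pi] := by
  have := hX.isProbabilityMeasure
  have hi : ∀ t, Integrable (X t) P := fun t => (hX.hasGaussianLaw_eval t).integrable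
  have hmS : Measurable fun ω (s : S) => X s ω := measurable_pi_lambda _ fun s => hm s
  have hmZ : Measurable fun ω t => procZ X P S t ω :=
    measurable_pi_lambda _ fun t => measurable_procZ hm t
  have hYi : Integrable (procY X P S t) P := by
    have : procY X P S t = fun ω => ∑ s : S, regCoeff (covFn X P) S t s * X s ω := by
      ext ω; rw [procY, regression_eq_sum]
    rw [this]
    exact integrable_finsetSum _ fun s _ => (hi s).const_mul _
  have hZi : Integrable (procZ X P S t) P := (hi t).sub hYi
  have hsum : X t = procY X P S t + procZ X P S t := by
    ext ω; simp [procZ]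
  have h1 : P[procZ X P S t | MeasurableSpace.comap (fun ω (s : S) => X s ω) MeasurableSpace.pi]
      =ᵐ[P] fun _ => 0 := by
    have hind := (IndepFun_iff_Indep _ _ _).mp (indepFun_procZ hX hm h0 hM).symm
    have := condExp_indep_eq (f := procZ X P S t) hmZ.comap_le hmS.comap_le ?_ hind
    · rwa [integral_procZ hX h0] at this
    · exact (Measurable.comp (g := fun z : ℝ → ℝ => z t) (measurable_pi_apply t)
        (comap_measurable fun ω t => procZ X P S t ω)).stronglyMeasurable
  have h2 : P[procY X P S t | MeasurableSpace.comap (fun ω (s : S) => X s ω) MeasurableSpace.pi]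
      = procY X P S t := by
    refine condExp_of_stronglyMeasurable hmS.comap_le ?_ hYi
    exact ((measurable_regression t).comp (comap_measurable _)).stronglyMeasurable
  conv_rhs => rw [hsum]
  refine (EventuallyEq.trans (condExp_add hYi hZi _) ?_).symm
  rw [h2]
  filter_upwards [h1] with ω hω
  simp [hω]

end Gaussian

end HighMinima

/-! ### Joint non-degeneracy of values and derivatives -/

namespace HighMinima

section Combinations

variable {Ω : Type*} {X : ℝ → Ω → ℝ}

/-- A linear combination of values of the process and of its derivative. -/
noncomputable def jetComb (X : ℝ → Ω → ℝ) (T : Finset ℝ) (c d : ℝ → ℝ) (ω : Ω) : ℝ :=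
  ∑ t ∈ T, (c t * X t ω + d t * deriv (fun s => X s ω) t)

/-- The same combination with difference quotients in place of derivatives. -/
noncomputable def jetApprox (X : ℝ → Ω → ℝ) (T : Finset ℝ) (c d : ℝ → ℝ) (n : ℕ) (ω : Ω) : ℝ :=
  ∑ t ∈ T, (c t * X t ω + d t * (((n : ℝ) + 1) * (X (t + 1 / ((n : ℝ) + 1)) ω - X t ω)))

lemma tendsto_diffQuot {f : ℝ → ℝ} {t : ℝ} (hf : DifferentiableAt ℝ f t) :
    Tendsto (fun n : ℕ => ((n : ℝ) + 1) * (f (t + 1 / ((n : ℝ) + 1)) - f t)) atTop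
      (𝓝 (deriv f t)) := by
  have h := hf.hasDerivAt.tendsto_slope_zero
  have hlim : Tendsto (fun n : ℕ => 1 / ((n : ℝ) + 1)) atTop (𝓝[≠] 0) := by
    refine tendsto_nhdsWithin_iff.mpr ⟨tendsto_one_div_add_atTop_nhds_zero_nat, ?_⟩
    exact Eventually.of_forall fun n => (by positivity : (1 : ℝ) / ((n : ℝ) + 1) ≠ 0)
  refine (h.comp hlim).congr fun n => ?_
  simp

lemma tendsto_jetApprox {ω : Ω} (hω : Differentiable ℝ fun t => X t ω) (T : Finset ℝ)
    (c d : ℝ → ℝ) :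
    Tendsto (fun n => jetApprox X T c d n ω) atTop (𝓝 (jetComb X T c d ω)) :=
  tendsto_finsetSum _ fun t _ => tendsto_const_nhds.add ((tendsto_diffQuot (hω t)).const_mul _)

variable [MeasurableSpace Ω] {P : Measure Ω}

lemma hasGaussianLaw_jetApprox (hX : IsGaussianProcess X P) (T : Finset ℝ) (c d : ℝ → ℝ) (n : ℕ) :
    HasGaussianLaw (jetApprox X T c d n) P := by
  classical
  have hY : IsGaussianProcess (fun t ω => c t * X t ω +
      d t * (((n : ℝ) + 1) * (X (t + 1 / ((n : ℝ) + 1)) ω - X t ω))) P := by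
    refine hX.of_isGaussianProcess fun t => ?_
    let I : Finset ℝ := {t, t + 1 / ((n : ℝ) + 1)}
    let p : (I → ℝ) →L[ℝ] ℝ := ContinuousLinearMap.proj ⟨t, by simp [I]⟩
    let q : (I → ℝ) →L[ℝ] ℝ := ContinuousLinearMap.proj ⟨t + 1 / ((n : ℝ) + 1), by simp [I]⟩
    refine ⟨I, c t • p + (d t * ((n : ℝ) + 1)) • (q - p), fun ω => ?_⟩
    simp [p, q, mul_assoc]
  exact hY.hasGaussianLaw_fun_sum

lemma integral_jetApprox (hX : IsGaussianProcess X P) (h0 : ∀ t, ∫ ω, X t ω ∂P = 0)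
    (T : Finset ℝ) (c d : ℝ → ℝ) (n : ℕ) : ∫ ω, jetApprox X T c d n ω ∂P = 0 := by
  have hi : ∀ t, Integrable (X t) P := fun t => (hX.hasGaussianLaw_eval t).integrable
  have hi1 : ∀ t, Integrable (fun ω => c t * X t ω) P := fun t => (hi t).const_mul _
  have hi2 : ∀ t, Integrable (fun ω => d t * (((n : ℝ) + 1) *
      (X (t + 1 / ((n : ℝ) + 1)) ω - X t ω))) P := fun t =>
    (((hi _).sub (hi t)).const_mul _).const_mul _
  have hi3 : ∀ t, Integrable (fun ω => c t * X t ω + d t * (((n : ℝ) + 1) *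
      (X (t + 1 / ((n : ℝ) + 1)) ω - X t ω))) P := fun t => (hi1 t).add (hi2 t)
  unfold jetApprox
  rw [integral_finsetSum _ fun t _ => hi3 t]
  refine Finset.sum_eq_zero fun t _ => ?_
  rw [integral_add (hi1 t) (hi2 t),
    integral_const_mul, integral_const_mul, integral_const_mul, integral_sub (hi _) (hi t)]
  simp [h0]

/-- Linear combinations of values and derivatives are centered Gaussian. -/
lemma gaussian_jetComb (hX : IsGaussianProcess X P) (h0 : ∀ t, ∫ ω, X t ω ∂P = 0)
    (hd : ∀ᵐ ω ∂P, Differentiable ℝ fun t => X t ω) (T : Finset ℝ) (c d : ℝ → ℝ) :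
    HasGaussianLaw (jetComb X T c d) P ∧ ∫ ω, jetComb X T c d ω ∂P = 0 ∧
      Tendsto (fun n => Var[jetApprox X T c d n; P]) atTop (𝓝 Var[jetComb X T c d; P]) := by
  have := hX.isProbabilityMeasure
  refine gaussian_of_tendsto (hasGaussianLaw_jetApprox hX T c d)
    (integral_jetApprox hX h0 T c d) ?_
  filter_upwards [hd] with ω hω
  exact tendsto_jetApprox hω T c d

end Combinations

/-- The standing assumptions on a version of the process all of whose paths are smooth. -/
structure SmoothModel {Ω : Type*} [MeasurableSpace Ω] (X : ℝ → Ω → ℝ) (P : Measure Ω)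
    (a b : ℝ) : Prop where
  measurable : ∀ t, Measurable (X t)
  smooth : ∀ ω, ContDiff ℝ ((⊤ : ℕ∞) : WithTop ℕ∞) fun t => X t ω
  gaussian : IsGaussianProcess X P
  centered : ∀ t, ∫ ω, X t ω ∂P = 0
  power : HasPowerExpansion (covFn X P)
  nondegenerate : ∀ (T : Finset ℝ) (c d : ℝ → ℝ), (∀ᵐ ω ∂P, jetComb X T c d ω = 0) →
    ∀ t ∈ T, c t = 0 ∧ d t = 0
  energy_pos : ∀ ν ∈ probOn a b, 0 < energy (covFn X P) ν
  potential_ne_const : ∀ ν ∈ probOn a b, ∀ V : ℝ, 0 < V → ¬ ∀ t, ∫ s, covFn X P s t ∂ν = V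

namespace SmoothModel

variable {Ω : Type*} [MeasurableSpace Ω] {P : Measure Ω} {X : ℝ → Ω → ℝ} {a b : ℝ}
  {S : Finset ℝ}

lemma differentiable (h : SmoothModel X P a b) (ω : Ω) : Differentiable ℝ fun t => X t ω :=
  (h.smooth ω).differentiable (by simp)

/-- The quadratic form is the second moment of `∑ c_t X_t`. If it is not positive, the sum vanishes
almost surely. -/
lemma strictlyPositive (h : SmoothModel X P a b) : StrictlyPositive (covFn X P) := by
  intro T c hle
  have hi : ∀ s t, Integrable (fun ω => X s ω * X t ω) P := fun s t =>
    (memLp_two_of_gaussian h.gaussian s).integrable_mul (memLp_two_of_gaussian h.gaussian t)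
  have hexp : ∀ ω, (∑ t ∈ T, c t * X t ω) ^ 2 =
      ∑ t ∈ T, ∑ s ∈ T, c t * c s * (X s ω * X t ω) := by
    intro ω
    rw [sq, Finset.sum_mul_sum]
    exact Finset.sum_congr rfl fun t _ => Finset.sum_congr rfl fun s _ => by ring
  have h_int : Integrable (fun ω => (∑ t ∈ T, c t * X t ω) ^ 2) P := by
    simp_rw [hexp]
    exact integrable_finsetSum _ fun t _ => integrable_finsetSum _ fun s _ => (hi s t).const_mul _
  have heq : ∫ ω, (∑ t ∈ T, c t * X t ω) ^ 2 ∂P =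
      ∑ t ∈ T, ∑ s ∈ T, c t * c s * covFn X P s t := by
    simp_rw [hexp]
    rw [integral_finsetSum _ fun t _ => integrable_finsetSum _ fun s _ => (hi s t).const_mul _]
    refine Finset.sum_congr rfl fun t _ => ?_
    rw [integral_finsetSum _ fun s _ => (hi s t).const_mul _]
    exact Finset.sum_congr rfl fun s _ => by rw [integral_const_mul]; rfl
  have hzero : ∫ ω, (∑ t ∈ T, c t * X t ω) ^ 2 ∂P = 0 :=
    le_antisymm (heq ▸ hle) (integral_nonneg fun ω => sq_nonneg _)
  rw [integral_eq_zero_iff_of_nonneg (fun ω => sq_nonneg _) h_int] at hzero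
  have := h.nondegenerate T c 0 (by
    filter_upwards [hzero] with ω hω
    simpa [jetComb] using hω)
  exact fun t ht => (this t ht).1

lemma exists_optimal (h : SmoothModel X P a b) (hab : a < b) :
    ∃ ν S, OptimalStructure (covFn X P) a b ν S :=
  exists_optimalStructure hab.le h.power covFn_comm h.strictlyPositive h.energy_pos
    h.potential_ne_const

lemma contDiff_procZ (h : SmoothModel X P a b) (ω : Ω) :
    ContDiff ℝ ((⊤ : ℕ∞) : WithTop ℕ∞) fun t => procZ X P S t ω :=
  (h.smooth ω).sub (contDiff_regression h.power _)

lemma derivZ_eq (h : SmoothModel X P a b) (t : ℝ) (ω : Ω) :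
    derivZ X P S t ω = deriv (fun s => X s ω) t -
      ∑ s : S, deriv (fun t => regCoeff (covFn X P) S t s) t * X s ω := by
  rw [derivZ, ← deriv_regression h.power (fun s : S => X s ω) t]
  exact deriv_fun_sub (h.differentiable ω t)
    ((contDiff_regression h.power _).differentiable (by simp) t)

lemma measurable_deriv (h : SmoothModel X P a b) (t : ℝ) :
    Measurable fun ω => deriv (fun s => X s ω) t := by
  refine measurable_of_tendsto_metrizable (f := fun (n : ℕ) ω =>
    ((n : ℝ) + 1) * (X (t + 1 / ((n : ℝ) + 1)) ω - X t ω)) (fun n => ?_) ?_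
  · have := h.measurable
    fun_prop
  · rw [tendsto_pi_nhds]
    exact fun ω => tendsto_diffQuot (h.differentiable ω t)

lemma measurable_derivZ (h : SmoothModel X P a b) (t : ℝ) : Measurable (derivZ X P S t) := by
  have e : derivZ X P S t = fun ω => deriv (fun s => X s ω) t -
      ∑ s : S, deriv (fun t => regCoeff (covFn X P) S t s) t * X s ω :=
    funext fun ω => h.derivZ_eq t ω
  rw [e]
  exact (h.measurable_deriv t).sub
    (Finset.measurable_fun_sum _ fun s _ => (h.measurable s).const_mul _)

/-- Extension of a family on `S` by zero. -/
noncomputable def extendZero (f : S → ℝ) (r : ℝ) : ℝ := if h : r ∈ S then f ⟨r, h⟩ else 0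

lemma sum_extendZero {T : Finset ℝ} (hST : S ⊆ T) (f : S → ℝ) (g : ℝ → ℝ) :
    ∑ r ∈ T, extendZero f r * g r = ∑ s : S, f s * g s := by
  rw [← Finset.sum_subset hST fun r _ hr => by simp [extendZero, hr], ← Finset.sum_coe_sort]
  exact Finset.sum_congr rfl fun s _ => by simp [extendZero]

/-- For `t ∉ S` the variable `X_t` occurs in `Z_t` with coefficient `1`, so `Z_t` is a
non-degenerate Gaussian variable. -/
lemma ae_procZ_ne_zero (h : SmoothModel X P a b) {t : ℝ} (ht : t ∉ S) :
    ∀ᵐ ω ∂P, procZ X P S t ω ≠ 0 := by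
  classical
  set c : ℝ → ℝ := fun r => (if r = t then 1 else 0) - extendZero (regCoeff (covFn X P) S t) r
  have hZ : jetComb X (insert t S) c 0 = procZ X P S t := by
    ext ω
    simp only [jetComb, c, Pi.zero_apply, zero_mul, add_zero, sub_mul, Finset.sum_sub_distrib]
    rw [sum_extendZero (Finset.subset_insert t S) _ (fun r => X r ω), procZ_eq]
    simp
  obtain ⟨hG, hG0, -⟩ := gaussian_jetComb h.gaussian h.centered
    (ae_of_all _ h.differentiable) (insert t S) c 0
  have := ae_ne_of_gaussian hG hG0 (fun hzero => by
    have := (h.nondegenerate _ c 0 hzero t (Finset.mem_insert_self t S)).1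
    simp [c, extendZero, ht] at this) 0
  rwa [hZ] at this

/-- The coefficient of `X'_t` in `Z'_t` is `1`. Regression on values cannot cancel it, so `t ∈ S` is
allowed here. -/
lemma ae_derivZ_ne (h : SmoothModel X P a b) (t x : ℝ) :
    ∀ᵐ ω ∂P, derivZ X P S t ω ≠ x := by
  classical
  set c : ℝ → ℝ := fun r => - extendZero (fun s => deriv (fun t => regCoeff (covFn X P) S t s) t) r
  set d : ℝ → ℝ := fun r => if r = t then 1 else 0
  have hZ : jetComb X (insert t S) c d = derivZ X P S t := by
    ext ω
    simp only [jetComb, c, d, Finset.sum_add_distrib, neg_mul, Finset.sum_neg_distrib]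
    rw [sum_extendZero (Finset.subset_insert t S) _ (fun r => X r ω), h.derivZ_eq]
    simp
    ring
  obtain ⟨hG, hG0, -⟩ := gaussian_jetComb h.gaussian h.centered
    (ae_of_all _ h.differentiable) (insert t S) c d
  have := ae_ne_of_gaussian hG hG0 (fun hzero => by
    have := (h.nondegenerate _ c d hzero t (Finset.mem_insert_self t S)).2
    simp [d] at this) x
  rwa [hZ] at this

/-- The joint law of values and derivatives charges every non-empty open set. -/
lemma measure_jet_pos (h : SmoothModel X P a b) (T : Finset ℝ) {U : Set (T ⊕ T → ℝ)}
    (hU : IsOpen U) (hne : U.Nonempty) :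
    0 < P {ω | Sum.elim (fun t : T => X t ω) (fun t : T => deriv (fun s => X s ω) t) ∈ U} := by
  classical
  have := h.gaussian.isProbabilityMeasure
  set G : T ⊕ T → Ω → ℝ := fun i ω =>
    Sum.elim (fun t : T => X t ω) (fun t : T => deriv (fun s => X s ω) t) i with hGdef
  have hcomb : ∀ x : T ⊕ T → ℝ, (fun ω => ∑ i, x i * G i ω) =
      jetComb X T (extendZero fun t => x (Sum.inl t)) (extendZero fun t => x (Sum.inr t)) := by
    intro x
    ext ω
    rw [jetComb, Finset.sum_add_distrib, sum_extendZero subset_rfl _ (fun r => X r ω),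
      sum_extendZero subset_rfl _ (fun r => deriv (fun s => X s ω) r), Fintype.sum_sum_type]
    rfl
  have hlin := fun x : T ⊕ T → ℝ => gaussian_jetComb h.gaussian h.centered
    (ae_of_all _ h.differentiable) T (extendZero fun t : T => x (Sum.inl t)) (extendZero fun t : T => x (Sum.inr t))
  simp_rw [← hcomb] at hlin
  have hGm : ∀ i, Measurable (G i) := by
    rintro (t | t)
    · exact h.measurable t
    · exact h.measurable_deriv t
  have hGm' : Measurable fun ω i => G i ω := measurable_pi_lambda _ hGm
  have hGL : HasGaussianLaw (fun ω i => G i ω) P := by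
    -- Joint normality is tested on linear functionals, which are again combinations of values and
    -- derivatives.
    refine ⟨isGaussian_of_isGaussian_map fun L => ?_⟩
    rw [Measure.map_map (by fun_prop) hGm']
    have e : (L ∘ fun ω i => G i ω) = fun ω => ∑ i, L (Pi.single i 1) * G i ω := by
      ext ω
      have : (fun i => G i ω) = ∑ i, G i ω • (Pi.single i (1 : ℝ) : T ⊕ T → ℝ) := by
        ext j
        simp [Finset.sum_apply, Pi.single_apply]
      simp only [Function.comp]
      rw [this, map_sum]
      exact Finset.sum_congr rfl fun i _ => by rw [map_smul, smul_eq_mul, mul_comm]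
    rw [e]
    exact (hlin fun i => L (Pi.single i 1)).1.isGaussian_map
  have hi : ∀ i j, Integrable (fun ω => G i ω * G j ω) P := fun i j =>
    (hGL.eval i).memLp_two.integrable_mul (hGL.eval j).memLp_two
  have hG0 : ∀ i, ∫ ω, G i ω ∂P = 0 := by
    intro i
    have := (hlin (Pi.single i 1)).2.1
    simpa [Pi.single_apply] using this
  set M : Matrix (T ⊕ T) (T ⊕ T) ℝ := Matrix.of fun i j => ∫ ω, G i ω * G j ω ∂P with hMdef
  have hM : M.PosDef := by
    refine Matrix.PosDef.of_dotProduct_mulVec_pos ?_ fun x hx => ?_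
    · ext i j; simp [hMdef, mul_comm]
    · have hexp : ∀ ω, (∑ i, x i * G i ω) ^ 2 = ∑ i, ∑ j, x i * x j * (G i ω * G j ω) := by
        intro ω
        rw [sq, Finset.sum_mul_sum]
        exact Finset.sum_congr rfl fun t _ => Finset.sum_congr rfl fun s _ => by ring
      have h_int : Integrable (fun ω => (∑ i, x i * G i ω) ^ 2) P := by
        simp_rw [hexp]
        exact integrable_finsetSum _ fun i _ => integrable_finsetSum _ fun j _ =>
          (hi i j).const_mul _
      have heq : star x ⬝ᵥ (M *ᵥ x) = ∫ ω, (∑ i, x i * G i ω) ^ 2 ∂P := by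
        simp_rw [hexp]
        rw [integral_finsetSum _ fun i _ => integrable_finsetSum _ fun j _ =>
          (hi i j).const_mul _]
        simp_rw [integral_finsetSum _ fun j _ => (hi _ j).const_mul _, integral_const_mul]
        simp only [dotProduct, Matrix.mulVec, hMdef, Matrix.of_apply, star_trivial,
          Finset.mul_sum]
        exact Finset.sum_congr rfl fun i _ => Finset.sum_congr rfl fun j _ => by ring
      rw [heq]
      refine lt_of_le_of_ne (integral_nonneg fun ω => sq_nonneg _) fun hzero => hx ?_
      have h2 := (integral_eq_zero_iff_of_nonneg (fun ω => sq_nonneg _) h_int).mp hzero.symm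
      have h3 := h.nondegenerate T _ _ (by
        rw [← hcomb x]
        filter_upwards [h2] with ω hω
        simpa using hω)
      ext i
      rcases i with t | t
      · simpa [extendZero] using (h3 t t.2).1
      · simpa [extendZero] using (h3 t t.2).2
  exact measure_pos_of_isOpen hGL hG0 hM (fun i j => rfl) hU hne

end SmoothModel

end HighMinima

/-! ### Laplace asymptotics -/

namespace HighMinima

section Laplace

variable {ι : Type*} [Fintype ι]

/-- The density of independent exponential variables up to normalization. -/
noncomputable def expWeight (θ : ι → ℝ) (y : ι → ℝ) : ℝ :=
  ∏ s, (Ioi (0 : ℝ)).indicator (fun v => Real.exp (-(θ s * v))) (y s)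

lemma integrableOn_exp_neg_mul {θ : ℝ} (hθ : 0 < θ) (c : ℝ) :
    IntegrableOn (fun v => Real.exp (-(θ * v))) (Ioi c) := by
  have := integrableOn_exp_mul_Ioi (a := -θ) (by linarith) c
  simpa [neg_mul] using this

lemma setIntegral_exp_neg_mul {θ : ℝ} (hθ : 0 < θ) (c : ℝ) :
    ∫ v in Ioi c, Real.exp (-(θ * v)) = Real.exp (-(θ * c)) / θ := by
  have := integral_exp_mul_Ioi (a := -θ) (by linarith) c
  simp only [neg_mul] at this
  rw [this, neg_div_neg_eq]

lemma integrable_expWeight {θ : ι → ℝ} (hθ : ∀ s, 0 < θ s) : Integrable (expWeight θ) :=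
  Integrable.fintype_prod fun s =>
    (integrable_indicator_iff measurableSet_Ioi).mpr (integrableOn_exp_neg_mul (hθ s) 0)

lemma expWeight_of_pos {θ y : ι → ℝ} (hy : ∀ s, 0 < y s) :
    expWeight θ y = Real.exp (-(y ⬝ᵥ θ)) := by
  rw [expWeight, dotProduct, ← Finset.sum_neg_distrib, Real.exp_sum]
  exact Finset.prod_congr rfl fun s _ => by rw [indicator_of_mem (mem_Ioi.mpr (hy s)), mul_comm]

lemma expWeight_of_nonpos {θ y : ι → ℝ} {s : ι} (hs : y s ≤ 0) : expWeight θ y = 0 :=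
  Finset.prod_eq_zero (Finset.mem_univ s) (indicator_of_notMem (by simpa using hs) _)

lemma expWeight_nonneg (θ y : ι → ℝ) : 0 ≤ expWeight θ y :=
  Finset.prod_nonneg fun _ _ => indicator_nonneg (fun _ _ => (Real.exp_pos _).le) _

lemma integral_expWeight {θ : ι → ℝ} (hθ : ∀ s, 0 < θ s) :
    ∫ y, expWeight θ y = (∏ s, θ s)⁻¹ := by
  unfold expWeight
  rw [integral_fintype_prod_volume_eq_prod
    (fun s : ι => (Ioi (0 : ℝ)).indicator (fun v => Real.exp (-(θ s * v)))),
    ← Finset.prod_inv_distrib]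
  refine Finset.prod_congr rfl fun s _ => ?_
  rw [integral_indicator measurableSet_Ioi, setIntegral_exp_neg_mul (hθ s)]
  simp

lemma integral_shift_scale {u : ℝ} (hu : 0 < u) (F : (ι → ℝ) → ℝ) :
    ∫ x, F x = (u ^ Fintype.card ι)⁻¹ * ∫ y : ι → ℝ, F (fun s => u + y s / u) := by
  have h1 := Measure.integral_comp_smul (volume : Measure (ι → ℝ))
    (fun x => F (u • (1 : ι → ℝ) + x)) u⁻¹
  rw [integral_add_left_eq_self (fun x => F x) (u • (1 : ι → ℝ)),
    Module.finrank_fintype_fun_eq_card, inv_pow, inv_inv, abs_of_pos (by positivity),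
    smul_eq_mul] at h1
  have h2 : (fun y : ι → ℝ => F (fun s => u + y s / u)) =
      fun y => F (u • (1 : ι → ℝ) + u⁻¹ • y) := by
    ext y
    congr 1
    ext s; simp; ring
  rw [h2, h1]
  field_simp

variable [DecidableEq ι]

/-- With `x = u + y/u` the quadratic form is `u²/V + 2 y·θ + (y·M⁻¹y)/u²`. The scaling is chosen so
that the cross term is free of `u`; it becomes the exponential weight. -/
lemma gaussDensity_shift {M : Matrix ι ι ℝ} (hM : M.PosDef) {V : ℝ}
    (hV : ∑ s, (M⁻¹ *ᵥ 1) s = V⁻¹) {u : ℝ} (hu : u ≠ 0) (y : ι → ℝ) :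
    gaussDensity M (fun s => u + y s / u) =
      ((2 * Real.pi) ^ ((Fintype.card ι : ℝ) / 2) * Real.sqrt M.det)⁻¹ *
        (Real.exp (-(u ^ 2 / (2 * V))) * (Real.exp (-(y ⬝ᵥ (M⁻¹ *ᵥ 1))) *
          Real.exp (-(y ⬝ᵥ (M⁻¹ *ᵥ y)) / (2 * u ^ 2)))) := by
  have hx : (fun s => u + y s / u) = u • (1 : ι → ℝ) + u⁻¹ • y := by
    ext s; simp; ring
  have hT : M⁻¹ᵀ = M⁻¹ := by
    have := hM.inv.isHermitian.eq
    simpa using this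
  have hsw : (1 : ι → ℝ) ⬝ᵥ (M⁻¹ *ᵥ y) = y ⬝ᵥ (M⁻¹ *ᵥ 1) := by
    rw [Matrix.dotProduct_mulVec, ← Matrix.mulVec_transpose, hT, dotProduct_comm]
  have h1 : (1 : ι → ℝ) ⬝ᵥ (M⁻¹ *ᵥ 1) = V⁻¹ := by
    rw [← hV, dotProduct]; simp
  rw [gaussDensity, ← Real.exp_add, ← Real.exp_add]
  congr 2
  rw [hx, Matrix.mulVec_add, Matrix.mulVec_smul, Matrix.mulVec_smul]
  simp only [add_dotProduct, dotProduct_add, smul_dotProduct, dotProduct_smul, smul_eq_mul, hsw, h1]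
  field_simp
  ring

/-- Laplace asymptotics of a Gaussian integral over a high orthant. -/
lemma tendsto_laplace {M : Matrix ι ι ℝ} (hM : M.PosDef) {θ : ι → ℝ} (hθ : θ = M⁻¹ *ᵥ 1)
    (hpos : ∀ s, 0 < θ s) {V : ℝ} (hV : ∑ s, θ s = V⁻¹) {q : ℝ → (ι → ℝ) → ℝ}
    (hqm : ∀ u, Measurable (q u)) (hq0 : ∀ u x, 0 ≤ q u x) (hq1 : ∀ u x, q u x ≤ 1)
    (hsupp : ∀ u x s, x s ≤ u → q u x = 0) {ℓ : (ι → ℝ) → ℝ}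
    (hlim : ∀ y, (∀ s, 0 < y s) →
      Tendsto (fun u => q u (fun s => u + y s / u)) atTop (𝓝 (ℓ y))) :
    Tendsto (fun u : ℝ => (∫ x, gaussDensity M x * q u x) /
        ((u ^ Fintype.card ι)⁻¹ * Real.exp (-(u ^ 2 / (2 * V))))) atTop
      (𝓝 (((2 * Real.pi) ^ ((Fintype.card ι : ℝ) / 2) * Real.sqrt M.det)⁻¹ *
        ∫ y, expWeight θ y * ℓ y)) := by
  set C := ((2 * Real.pi) ^ ((Fintype.card ι : ℝ) / 2) * Real.sqrt M.det)⁻¹ with hC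
  -- The weight `expWeight` dominates: `q` vanishes unless every `y_s` is positive, and the factor
  -- with `u²` in the denominator is at most `1` and tends to `1`.
  have hDCT : Tendsto (fun u : ℝ => ∫ y, Real.exp (-(y ⬝ᵥ θ)) *
      Real.exp (-(y ⬝ᵥ (M⁻¹ *ᵥ y)) / (2 * u ^ 2)) * q u (fun s => u + y s / u)) atTop
      (𝓝 (∫ y, expWeight θ y * ℓ y)) := by
    refine tendsto_integral_filter_of_dominated_convergence (expWeight θ) ?_ ?_
      (integrable_expWeight hpos) ?_
    · refine Eventually.of_forall fun u => Measurable.aestronglyMeasurable ?_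
      refine Measurable.mul (Continuous.measurable (by fun_prop)) ((hqm u).comp ?_)
      fun_prop
    · filter_upwards [eventually_gt_atTop 0] with u hu
      refine ae_of_all _ fun y => ?_
      by_cases hy : ∀ s, 0 < y s
      · rw [expWeight_of_pos hy, norm_mul, norm_mul, Real.norm_of_nonneg (Real.exp_pos _).le,
          Real.norm_of_nonneg (Real.exp_pos _).le, Real.norm_of_nonneg (hq0 _ _), mul_assoc]
        refine mul_le_of_le_one_right (Real.exp_pos _).le ?_
        refine mul_le_one₀ (Real.exp_le_one_iff.mpr ?_) (hq0 _ _) (hq1 _ _)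
        have hnn : 0 ≤ y ⬝ᵥ (M⁻¹ *ᵥ y) := by
          have := hM.inv.posSemidef.dotProduct_mulVec_nonneg y
          simpa using this
        rw [neg_div]
        exact neg_nonpos.mpr (by positivity)
      · push Not at hy
        obtain ⟨s, hs⟩ := hy
        rw [hsupp u _ s, mul_zero, norm_zero]
        · exact expWeight_nonneg _ _
        · have : y s / u ≤ 0 := div_nonpos_of_nonpos_of_nonneg hs hu.le
          linarith
    · refine ae_of_all _ fun y => ?_
      by_cases hy : ∀ s, 0 < y s
      · rw [expWeight_of_pos hy]
        refine Tendsto.mul ?_ (hlim y hy)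
        have : Tendsto (fun u : ℝ => -(y ⬝ᵥ (M⁻¹ *ᵥ y)) / (2 * u ^ 2)) atTop (𝓝 0) :=
          tendsto_const_nhds.div_atTop
            ((tendsto_pow_atTop two_ne_zero).const_mul_atTop two_pos)
        have h2 := ((Real.continuous_exp.tendsto 0).comp this).const_mul (Real.exp (-(y ⬝ᵥ θ)))
        simpa using h2
      · push Not at hy
        obtain ⟨s, hs⟩ := hy
        rw [expWeight_of_nonpos hs, zero_mul]
        refine tendsto_const_nhds.congr' ?_
        filter_upwards [eventually_gt_atTop 0] with u hu
        rw [hsupp u _ s, mul_zero]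
        have : y s / u ≤ 0 := div_nonpos_of_nonpos_of_nonneg hs hu.le
        linarith
  refine (hDCT.const_mul C).congr' ?_
  filter_upwards [eventually_gt_atTop 0] with u hu
  rw [integral_shift_scale hu (fun x => gaussDensity M x * q u x),
    mul_div_mul_left _ _ (by positivity), eq_div_iff (by positivity),
    ← integral_const_mul, ← integral_mul_const]
  refine integral_congr_ae (ae_of_all _ fun y => ?_)
  simp only
  rw [gaussDensity_shift hM (hθ ▸ hV) hu.ne', ← hθ, ← hC]
  ring

end Laplace

end HighMinima

/-! ### Disintegration over the values on `S` -/

namespace HighMinima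

section Minimum

variable {a b : ℝ}

/-- On a compact interval a continuous function above `u` has a uniform margin, and non-strict
inequalities extend from the rationals. The left side involves countably many coordinates, so it
defines a measurable set in the product `σ`-algebra. -/
lemma exists_rat_iff_forall_lt (hab : a < b) {g : ℝ → ℝ} (hg : Continuous g) (u : ℝ) :
    (∃ n : ℕ, ∀ q : ℚ, (q : ℝ) ∈ Icc a b → u + 1 / ((n : ℝ) + 1) ≤ g q) ↔
      ∀ t ∈ Icc a b, u < g t := by
  constructor
  · rintro ⟨n, hn⟩ t ht
    have hcl : IsClosed {t | u + 1 / ((n : ℝ) + 1) ≤ g t} := isClosed_le continuous_const hg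
    have hsub : Icc a b ⊆ {t | u + 1 / ((n : ℝ) + 1) ≤ g t} := by
      rw [← closure_Ioo hab.ne]
      refine closure_minimal (Subset.trans
        (Rat.isDenseEmbedding_coe_real.dense.open_subset_closure_inter isOpen_Ioo)
        (closure_minimal ?_ hcl)) hcl
      rintro _ ⟨hx, q, rfl⟩
      exact hn q (Ioo_subset_Icc_self hx)
    have h1 : u + 1 / ((n : ℝ) + 1) ≤ g t := hsub ht
    have h2 : (0 : ℝ) < 1 / ((n : ℝ) + 1) := by positivity
    linarith
  · intro h
    obtain ⟨x, hx, hmin⟩ := isCompact_Icc.exists_isMinOn (nonempty_Icc.mpr hab.le) hg.continuousOn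
    obtain ⟨n, hn⟩ := exists_nat_one_div_lt (sub_pos.mpr (h x hx))
    exact ⟨n, fun q hq => by linarith [show g x ≤ g q from hmin hq]⟩

lemma lt_minOver_finset_iff {Ω : Type*} {X : ℝ → Ω → ℝ} {S : Finset ℝ} (hS : S.Nonempty) (u : ℝ)
    (ω : Ω) :
    u < minOver X (S : Set ℝ) ω ↔ ∀ s : S, u < X s ω := by
  rw [minOver, S.finite_toSet.isCompact.lt_sInf_iff_of_continuous (by simpa using hS)
    (S.finite_toSet.continuousOn _)]
  simp

end Minimum

namespace SmoothModel

variable {Ω : Type*} [MeasurableSpace Ω] {P : Measure Ω} {X : ℝ → Ω → ℝ} {a b : ℝ}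
  {S : Finset ℝ}

lemma lt_minOver_iff (h : SmoothModel X P a b) (hab : a < b) (u : ℝ) (ω : Ω) :
    u < minOver X (Icc a b) ω ↔ ∀ t ∈ Icc a b, u < X t ω :=
  isCompact_Icc.lt_sInf_iff_of_continuous (nonempty_Icc.mpr hab.le)
    (h.smooth ω).continuous.continuousOn u

lemma map_eq_withDensity (h : SmoothModel X P a b) (hM : (covMatrix (covFn X P) S).PosDef) :
    P.map (fun ω (s : S) => X s ω) = (volume : Measure (S → ℝ)).withDensity
      fun x => ENNReal.ofReal (gaussDensity (covMatrix (covFn X P) S) x) := by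
  have := h.gaussian.isProbabilityMeasure
  exact map_eq_withDensity_gaussDensity (G := fun (s : S) ω => X s ω)
    (h.gaussian.hasGaussianLaw S) (fun s => h.centered s) hM (fun s t => rfl)

lemma toReal_lintegral_map (h : SmoothModel X P a b) (hM : (covMatrix (covFn X P) S).PosDef)
    {p : (S → ℝ) → ENNReal} (hp : Measurable p) (hp1 : ∀ x, p x ≤ 1) :
    (∫⁻ x, p x ∂(P.map fun ω (s : S) => X s ω)).toReal =
      ∫ x, gaussDensity (covMatrix (covFn X P) S) x * (p x).toReal := by
  have hd := continuous_gaussDensity (covMatrix (covFn X P) S)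
  have hdpos := gaussDensity_pos hM.det_pos
  rw [h.map_eq_withDensity hM, lintegral_withDensity_eq_lintegral_mul _
    hd.measurable.ennreal_ofReal hp, integral_eq_lintegral_of_nonneg_ae
    (ae_of_all _ fun x => mul_nonneg (hdpos x).le ENNReal.toReal_nonneg)
    (hd.measurable.mul hp.ennreal_toReal).aestronglyMeasurable]
  congr 1
  refine lintegral_congr fun x => ?_
  rw [ENNReal.ofReal_mul (hdpos x).le,
    ENNReal.ofReal_toReal ((hp1 x).trans_lt ENNReal.one_lt_top).ne]
  rfl

/-- The probability of a high minimum, given the values `x` on `S`. -/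
noncomputable def condProb (X : ℝ → Ω → ℝ) (P : Measure Ω) (S : Finset ℝ) (a b u : ℝ)
    (x : S → ℝ) : ENNReal :=
  P {ω | ∀ t ∈ Icc a b, u < regression (covFn X P) S t x + procZ X P S t ω}

lemma continuous_path (h : SmoothModel X P a b) (x : S → ℝ) (ω : Ω) :
    Continuous fun t => regression (covFn X P) S t x + procZ X P S t ω :=
  (contDiff_regression h.power x).continuous.add (h.contDiff_procZ ω).continuous

/-- The event of a high minimum in terms of the regression and the residual path. -/
def ratSet (R : ℝ → ℝ → ℝ) (S : Finset ℝ) (a b u : ℝ) : Set ((S → ℝ) × (ℝ → ℝ)) :=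
  {p | ∃ n : ℕ, ∀ q : ℚ, (q : ℝ) ∈ Icc a b →
    u + 1 / ((n : ℝ) + 1) ≤ regression R S q p.1 + p.2 q}

lemma measurableSet_ratSet (R : ℝ → ℝ → ℝ) (S : Finset ℝ) (a b u : ℝ) :
    MeasurableSet (ratSet R S a b u) := by
  have : ratSet R S a b u = ⋃ n : ℕ, ⋂ q : ℚ, ⋂ _ : (q : ℝ) ∈ Icc a b,
      {p | u + 1 / ((n : ℝ) + 1) ≤ regression R S q p.1 + p.2 q} := by
    ext p; simp [ratSet]
  rw [this]
  refine MeasurableSet.iUnion fun n => MeasurableSet.iInter fun q => MeasurableSet.iInter fun _ =>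
    measurableSet_le measurable_const ?_
  exact ((measurable_regression (q : ℝ)).comp measurable_fst).add
    ((measurable_pi_apply (q : ℝ)).comp measurable_snd)

lemma mem_ratSet_iff (h : SmoothModel X P a b) (hab : a < b) (u : ℝ) (x : S → ℝ) (ω : Ω) :
    (x, fun t => procZ X P S t ω) ∈ ratSet (covFn X P) S a b u ↔
      ∀ t ∈ Icc a b, u < regression (covFn X P) S t x + procZ X P S t ω :=
  exists_rat_iff_forall_lt hab (h.continuous_path x ω) u

lemma measurable_residual (h : SmoothModel X P a b) :
    Measurable fun ω t => procZ X P S t ω :=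
  measurable_pi_lambda _ fun t => measurable_procZ h.measurable t

lemma measurableSet_condEvent (h : SmoothModel X P a b) (hab : a < b) (u : ℝ) (x : S → ℝ) :
    MeasurableSet {ω | ∀ t ∈ Icc a b, u < regression (covFn X P) S t x + procZ X P S t ω} := by
  have : {ω | ∀ t ∈ Icc a b, u < regression (covFn X P) S t x + procZ X P S t ω} =
      (fun ω => (x, fun t => procZ X P S t ω)) ⁻¹' ratSet (covFn X P) S a b u := by
    ext ω; exact (h.mem_ratSet_iff hab u x ω).symm
  rw [this]
  exact (measurable_const.prodMk h.measurable_residual) (measurableSet_ratSet _ _ _ _ _)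

lemma condProb_eq (h : SmoothModel X P a b) (hab : a < b) (u : ℝ) (x : S → ℝ) :
    condProb X P S a b u x =
      P.map (fun ω t => procZ X P S t ω) (Prod.mk x ⁻¹' ratSet (covFn X P) S a b u) := by
  rw [Measure.map_apply h.measurable_residual
    (measurable_prodMk_left (measurableSet_ratSet _ _ _ _ _)), condProb]
  congr 1
  ext ω
  exact (h.mem_ratSet_iff hab u x ω).symm

lemma measurable_condProb (h : SmoothModel X P a b) (hab : a < b) (u : ℝ) :
    Measurable (condProb X P S a b u) := by
  have := h.gaussian.isProbabilityMeasure
  have e : condProb X P S a b u = fun x => P.map (fun ω t => procZ X P S t ω)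
      (Prod.mk x ⁻¹' ratSet (covFn X P) S a b u) := funext fun x => h.condProb_eq hab u x
  rw [e]
  exact measurable_measure_prodMk_left (measurableSet_ratSet _ _ _ _ _)

/-- Disintegration of the probability of a high minimum with respect to the values on `S`. -/
lemma probMinGt_Icc_eq (h : SmoothModel X P a b) (hab : a < b)
    (hM : (covMatrix (covFn X P) S).PosDef) (u : ℝ) :
    probMinGt X P (Icc a b) u = ∫ x, gaussDensity (covMatrix (covFn X P) S) x *
      (condProb X P S a b u x).toReal := by
  have := h.gaussian.isProbabilityMeasure
  have hmS : Measurable fun ω (s : S) => X s ω := measurable_pi_lambda _ fun s => h.measurable s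
  rw [← h.toReal_lintegral_map hM (h.measurable_condProb hab u) fun x => prob_le_one]
  simp_rw [h.condProb_eq hab u]
  -- By independence, the joint law of the values on `S` and the residual path is a product, so the
  -- conditional probability is the measure of a section of `ratSet`.
  have hprod := (indepFun_iff_map_prod_eq_prod_map_map hmS.aemeasurable
    h.measurable_residual.aemeasurable).mp
    (indepFun_procZ h.gaussian h.measurable h.centered hM)
  rw [← Measure.prod_apply (measurableSet_ratSet _ _ _ _ _), ← hprod,
    Measure.map_apply (hmS.prodMk h.measurable_residual) (measurableSet_ratSet _ _ _ _ _),
    probMinGt, Measure.real]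
  congr 2
  ext ω
  refine (h.lt_minOver_iff hab u ω).trans (Iff.trans ?_
    (h.mem_ratSet_iff hab u (fun s : S => X s ω) ω).symm)
  refine forall₂_congr fun t _ => ?_
  rw [procZ, procY, add_sub_cancel]

lemma probMinGt_finset_eq (h : SmoothModel X P a b) (hS : S.Nonempty)
    (hM : (covMatrix (covFn X P) S).PosDef) (u : ℝ) :
    probMinGt X P (S : Set ℝ) u = ∫ x, gaussDensity (covMatrix (covFn X P) S) x *
      ({x : S → ℝ | ∀ s, u < x s}.indicator 1 x : ENNReal).toReal := by
  have hmS : Measurable fun ω (s : S) => X s ω := measurable_pi_lambda _ fun s => h.measurable s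
  have hms : MeasurableSet {x : S → ℝ | ∀ s, u < x s} := by
    rw [ofPred_forall]
    exact MeasurableSet.iInter fun s => measurableSet_lt measurable_const (measurable_pi_apply s)
  rw [← h.toReal_lintegral_map hM (measurable_one.indicator hms)
    (fun x => indicator_le_self' (by simp) x), lintegral_indicator_one hms,
    Measure.map_apply hmS hms, probMinGt, Measure.real]
  congr 2
  ext ω
  exact lt_minOver_finset_iff hS u ω

lemma probMinGt_finset_pos (h : SmoothModel X P a b) (hS : S.Nonempty)
    (hM : (covMatrix (covFn X P) S).PosDef) (u : ℝ) : 0 < probMinGt X P (S : Set ℝ) u := by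
  have := h.gaussian.isProbabilityMeasure
  have hopen : IsOpen {x : S → ℝ | ∀ s, u < x s} := by
    rw [ofPred_forall]
    exact isOpen_iInter_of_finite fun s => isOpen_lt continuous_const (continuous_apply s)
  have hpos := measure_pos_of_isOpen (G := fun (s : S) ω => X s ω)
    (h.gaussian.hasGaussianLaw S) (fun s => h.centered s) hM (fun s t => rfl) hopen
    ⟨fun _ => u + 1, fun _ => by simp⟩
  have : {ω | u < minOver X (S : Set ℝ) ω} = {ω | (fun s : S => X s ω) ∈ {x | ∀ s, u < x s}} := by
    ext ω; exact lt_minOver_finset_iff hS u ω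
  rw [probMinGt, Measure.real, this]
  exact ENNReal.toReal_pos hpos.ne' (measure_ne_top _ _)

end SmoothModel

end HighMinima

/-! ### The weight `W` and the limit theorem for smooth models -/

namespace HighMinima

section Weights

/-- The factor that a point `s` of `S` contributes to the limit. -/
noncomputable def pointWeight (a b s m₁ m₂ θ z₁ : ℝ) : ℝ :=
  open Classical in if IsCritical a b s m₁ z₁ then expFactor θ m₂ z₁ else 1

lemma expFactor_nonneg (θ m z : ℝ) : 0 ≤ expFactor θ m z := by
  unfold expFactor
  split_ifs
  exacts [le_rfl, (Real.exp_pos _).le]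

lemma expFactor_pos {θ m z : ℝ} (hm : m ≠ 0) : 0 < expFactor θ m z := by
  rw [expFactor, if_neg hm]
  exact Real.exp_pos _

lemma mem_limitSet_iff {a b s m₁ m₂ z v : ℝ} :
    v ∈ limitSet a b s m₁ m₂ z ↔ (IsCritical a b s m₁ z ∧ m₂ ≠ 0 ∧ z ^ 2 / (2 * m₂) < v) ∨
      (¬ IsCritical a b s m₁ z ∧ 0 < v) := by
  unfold limitSet
  split_ifs with h1 h2
  · simp [h1, h2]
  · simp [h1, h2]
  · simp [h1]

lemma measurableSet_isCritical (a b s m₁ : ℝ) : MeasurableSet {z | IsCritical a b s m₁ z} := by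
  unfold IsCritical
  refine (MeasurableSet.const _).union ((MeasurableSet.const _).inter
    (MeasurableSet.union ?_ ?_))
  · exact (MeasurableSet.const _).inter measurableSet_Iio
  · exact (MeasurableSet.const _).inter measurableSet_Ioi

lemma measurableSet_limitSet (a b s m₁ m₂ : ℝ) :
    MeasurableSet {p : ℝ × ℝ | p.2 ∈ limitSet a b s m₁ m₂ p.1} := by
  simp_rw [mem_limitSet_iff]
  have hc : MeasurableSet {p : ℝ × ℝ | IsCritical a b s m₁ p.1} :=
    measurable_fst (measurableSet_isCritical a b s m₁)
  have h1 : MeasurableSet {p : ℝ × ℝ | p.1 ^ 2 / (2 * m₂) < p.2} :=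
    measurableSet_lt (by fun_prop) (by fun_prop)
  have h2 : MeasurableSet {p : ℝ × ℝ | 0 < p.2} := measurableSet_lt (by fun_prop) (by fun_prop)
  exact (hc.inter ((MeasurableSet.const _).inter h1)).union (hc.compl.inter h2)

/-- The tail of an exponential variable beyond `z² / (2 m₂)`, without the normalization `θ`. For a
critical point with `m₂ = 0` the limit set is empty, matching the value `0` of `expFactor`. -/
lemma integral_indicator_limitSet {a b s m₁ m₂ θ z : ℝ} (hθ : 0 < θ)
    (hm : IsCritical a b s m₁ z → 0 ≤ m₂) :
    ∫ v, (Ioi (0 : ℝ)).indicator (fun v => Real.exp (-(θ * v))) v *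
        (limitSet a b s m₁ m₂ z).indicator 1 v = pointWeight a b s m₁ m₂ θ z / θ := by
  have key : ∀ c : ℝ, 0 ≤ c → ∫ v, (Ioi (0 : ℝ)).indicator (fun v => Real.exp (-(θ * v))) v *
      (Ioi c).indicator 1 v = Real.exp (-(θ * c)) / θ := by
    intro c hc
    rw [← setIntegral_exp_neg_mul hθ, ← integral_indicator measurableSet_Ioi]
    refine integral_congr_ae (ae_of_all _ fun v => ?_)
    by_cases hv : c < v
    · simp [indicator, hv, hc.trans_lt hv]
    · simp [indicator, hv]
  unfold limitSet pointWeight expFactor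
  split_ifs with h1 h2
  · simp
  · rw [key _ (div_nonneg (sq_nonneg _) (by linarith [hm h1]))]
    congr 3
    field_simp
  · simpa using key 0 le_rfl

end Weights

namespace SmoothModel

variable {Ω : Type*} [MeasurableSpace Ω] {P : Measure Ω} {X : ℝ → Ω → ℝ} {a b : ℝ}
  {S E : Finset ℝ} {ν : Measure ℝ}

lemma procZ_self (hM : (covMatrix (covFn X P) S).PosDef) {s : ℝ} (hs : s ∈ S) (ω : Ω) :
    procZ X P S s ω = 0 := by
  rw [procZ, procY, regression_self hM ⟨s, hs⟩, sub_self]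

lemma condProb_eq_zero (hO : OptimalStructure (covFn X P) a b ν S) {u : ℝ} {x : S → ℝ} {s : S}
    (hs : x s ≤ u) : condProb X P S a b u x = 0 := by
  have : {ω | ∀ t ∈ Icc a b, u < regression (covFn X P) S t x + procZ X P S t ω} = ∅ := by
    refine eq_empty_of_forall_notMem fun ω hω => ?_
    have := hω s (hO.subset s s.2)
    rw [procZ_self hO.posDef s.2, regression_self hO.posDef] at this
    linarith
  rw [condProb, this, measure_empty]

/-- The limit of the indicator of a high minimum, given the values `u + y_s / u` on `S`. -/
noncomputable def limitInd (X : ℝ → Ω → ℝ) (P : Measure Ω) (S E : Finset ℝ) (a b : ℝ)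
    (y : S → ℝ) (ω : Ω) : ℝ :=
  (∏ t ∈ E \ S, if 0 < procZ X P S t ω then (1 : ℝ) else 0) *
    ∏ s : S, (limitSet a b s (deriv (mu (covFn X P) S) s)
      (iteratedDeriv 2 (mu (covFn X P) S) s) (derivZ X P S s ω)).indicator 1 (y s)

lemma limitInd_nonneg (y : S → ℝ) (ω : Ω) : 0 ≤ limitInd X P S E a b y ω :=
  mul_nonneg (Finset.prod_nonneg fun t _ => by split_ifs <;> simp)
    (Finset.prod_nonneg fun s _ => indicator_nonneg (fun _ _ => zero_le_one) _)

lemma limitInd_le_one (y : S → ℝ) (ω : Ω) : limitInd X P S E a b y ω ≤ 1 :=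
  mul_le_one₀ (Finset.prod_le_one (fun t _ => by split_ifs <;> simp)
      fun t _ => by split_ifs <;> simp)
    (Finset.prod_nonneg fun s _ => indicator_nonneg (fun _ _ => zero_le_one) _)
    (Finset.prod_le_one (fun s _ => indicator_nonneg (fun _ _ => zero_le_one) _)
      fun s _ => indicator_le_self' (by simp) _)

lemma limitInd_eq_ite (y : S → ℝ) (ω : Ω) [Decidable ((∀ t ∈ E \ S, 0 < procZ X P S t ω) ∧
    ∀ s : S, y s ∈ limitSet a b s (deriv (mu (covFn X P) S) s)
      (iteratedDeriv 2 (mu (covFn X P) S) s) (derivZ X P S s ω))] :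
    limitInd X P S E a b y ω = if (∀ t ∈ E \ S, 0 < procZ X P S t ω) ∧
      ∀ s : S, y s ∈ limitSet a b s (deriv (mu (covFn X P) S) s)
        (iteratedDeriv 2 (mu (covFn X P) S) s) (derivZ X P S s ω) then 1 else 0 := by
  unfold limitInd
  split_ifs with h
  · rw [Finset.prod_eq_one fun t ht => if_pos (h.1 t ht),
      Finset.prod_eq_one fun s _ => indicator_of_mem (h.2 s) _, one_mul]
  · rw [not_and_or] at h
    push Not at h
    rcases h with ⟨t, ht, h⟩ | ⟨s, h⟩
    · rw [Finset.prod_eq_zero ht (if_neg h.not_gt), zero_mul]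
    · rw [Finset.prod_eq_zero (Finset.mem_univ s) (indicator_of_notMem h _), mul_zero]

lemma measurable_limitInd (h : SmoothModel X P a b) :
    Measurable fun p : (S → ℝ) × Ω => limitInd X P S E a b p.1 p.2 := by
  unfold limitInd
  refine Measurable.mul (Finset.measurable_fun_prod _ fun t _ => ?_)
    (Finset.measurable_fun_prod _ fun s _ => ?_)
  · exact Measurable.ite (measurableSet_lt measurable_const
      ((measurable_procZ h.measurable t).comp measurable_snd)) measurable_const measurable_const
  · have h1 : Measurable fun p : (S → ℝ) × Ω => (derivZ X P S s p.2, p.1 s) :=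
      ((h.measurable_derivZ s).comp measurable_snd).prodMk
        ((measurable_pi_apply s).comp measurable_fst)
    exact (measurable_one.indicator (measurableSet_limitSet a b s
      (deriv (mu (covFn X P) S) s) (iteratedDeriv 2 (mu (covFn X P) S) s))).comp h1

lemma contDiff_mu (h : SmoothModel X P a b) : ContDiff ℝ 2 (mu (covFn X P) S) :=
  contDiff_infty.mp (contDiff_regression h.power 1) 2

lemma mu_self (hM : (covMatrix (covFn X P) S).PosDef) {s : ℝ} (hs : s ∈ S) :
    mu (covFn X P) S s = 1 := by
  rw [mu, regression_self hM ⟨s, hs⟩, Pi.one_apply]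

lemma second_deriv_nonneg (h : SmoothModel X P a b) (hab : a < b)
    (hO : OptimalStructure (covFn X P) a b ν S) {s z : ℝ} (hs : s ∈ S)
    (hc : IsCritical a b s (deriv (mu (covFn X P) S) s) z) :
    0 ≤ iteratedDeriv 2 (mu (covFn X P) S) s := by
  have h1 : deriv (mu (covFn X P) S) s = 0 := by
    rcases hc with hc | hc
    · exact deriv_eq_zero_of_contact hO.one_le_mu hc (mu_self hO.posDef hs)
    · exact hc.1
  exact second_deriv_nonneg_of_contact hab h.contDiff_mu hO.one_le_mu (hO.subset s hs)
    (mu_self hO.posDef hs) h1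

/-- Multiplying `X_t - u` by `u` brings the event into the form of `eventually_forall_pos_iff` with
`m = μ`, `z` the residual path and `ρ` the regression of `y`. What that theorem excludes has
probability zero: `Z'_s = 0`, `Z_t = 0` off `S`, and `y_s` on the boundary of its limit set. -/
lemma ae_eventually_iff (h : SmoothModel X P a b) (hab : a < b)
    (hO : OptimalStructure (covFn X P) a b ν S)
    (hE : (E : Set ℝ) = essentialSet (covFn X P) S a b) {y : S → ℝ} (hy : ∀ s, 0 < y s) :
    ∀ᵐ ω ∂P, ∀ᶠ u : ℝ in atTop, (∀ t ∈ Icc a b,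
      u < regression (covFn X P) S t (fun s => u + y s / u) + procZ X P S t ω) ↔
      (∀ t ∈ E \ S, 0 < procZ X P S t ω) ∧
        ∀ s : S, y s ∈ limitSet a b s (deriv (mu (covFn X P) S) s)
          (iteratedDeriv 2 (mu (covFn X P) S) s) (derivZ X P S s ω) := by
  have hE' : ∀ t, t ∈ E ↔ t ∈ Icc a b ∧ mu (covFn X P) S t = 1 := fun t => by
    rw [← Finset.mem_coe, hE]; rfl
  have hSE : S ⊆ E := fun s hs => (hE' s).mpr ⟨hO.subset s hs, mu_self hO.posDef hs⟩
  have h1 : ∀ᵐ ω ∂P, ∀ s ∈ S, derivZ X P S s ω ≠ 0 :=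
    (Finset.eventually_all S).mpr fun s _ => h.ae_derivZ_ne s 0
  have h2 : ∀ᵐ ω ∂P, ∀ t ∈ E \ S, procZ X P S t ω ≠ 0 :=
    (Finset.eventually_all _).mpr fun t ht => h.ae_procZ_ne_zero (Finset.mem_sdiff.mp ht).2
  have h3 : ∀ᵐ ω ∂P, ∀ s : S, y s ≠ derivZ X P S s ω ^ 2 /
      (2 * iteratedDeriv 2 (mu (covFn X P) S) s) := by
    refine ae_all_iff.mpr fun s => ?_
    -- Equality would put `Z'_s` at one of the two values `±√(2 μ'' y_s)`, each of probability zero.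
    -- If `μ'' = 0`, the quotient is `0` by convention and equality fails since `y_s > 0`.
    filter_upwards [h.ae_derivZ_ne (S := S) s
        (√(y s * (2 * iteratedDeriv 2 (mu (covFn X P) S) s))),
      h.ae_derivZ_ne (S := S) s
        (-√(y s * (2 * iteratedDeriv 2 (mu (covFn X P) S) s)))] with ω hω1 hω2 heq
    have hm : iteratedDeriv 2 (mu (covFn X P) S) s ≠ 0 := by
      intro h0
      rw [h0] at heq
      simp at heq
      exact (hy s).ne' heq
    have hz : derivZ X P S s ω ^ 2 = y s * (2 * iteratedDeriv 2 (mu (covFn X P) S) s) := by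
      rw [heq]; field_simp
    rw [← hz, Real.sqrt_sq_eq_abs] at hω1 hω2
    rcases abs_choice (derivZ X P S s ω) with h' | h' <;> rw [h'] at hω1 hω2 <;> simp at hω1 hω2
  filter_upwards [h1, h2, h3] with ω hω1 hω2 hω3
  have key := eventually_forall_pos_iff (m := mu (covFn X P) S)
    (z := fun t => procZ X P S t ω) (ρ := fun t => regression (covFn X P) S t y) hab
    h.contDiff_mu ((h.contDiff_procZ ω).differentiable (by simp))
    (contDiff_regression h.power y).continuous hO.one_le_mu hSE hE'
    (fun s hs => procZ_self hO.posDef hs ω) hω1 hω2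
    (fun s hs => by rw [regression_self hO.posDef ⟨s, hs⟩]; exact hy _)
    (fun s hs => by rw [regression_self hO.posDef ⟨s, hs⟩]; exact hω3 ⟨s, hs⟩)
  filter_upwards [key, eventually_gt_atTop 0] with u hu hu0
  have e : ∀ t, regression (covFn X P) S t (fun s => u + y s / u) =
      u * mu (covFn X P) S t + u⁻¹ * regression (covFn X P) S t y := by
    intro t
    have : (fun s => u + y s / u) = u • (1 : S → ℝ) + u⁻¹ • y := by
      ext s; simp [div_eq_inv_mul]
    rw [this, regression_add, regression_smul, regression_smul, mu]
  refine Iff.trans (forall₂_congr fun t _ => ?_) (hu.trans (and_congr Iff.rfl ?_))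
  · rw [e, ← sub_pos, ← mul_pos_iff_of_pos_left hu0]
    have : u * (u * mu (covFn X P) S t + u⁻¹ * regression (covFn X P) S t y +
        procZ X P S t ω - u) = u ^ 2 * (mu (covFn X P) S t - 1) + u * procZ X P S t ω +
        regression (covFn X P) S t y := by field_simp; ring
    rw [this]
  · constructor
    · intro hs s
      have := hs s s.2
      rwa [regression_self hO.posDef s] at this
    · intro hs s hsS
      rw [regression_self hO.posDef ⟨s, hsS⟩]
      exact hs ⟨s, hsS⟩

lemma tendsto_condProb (h : SmoothModel X P a b) (hab : a < b)
    (hO : OptimalStructure (covFn X P) a b ν S)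
    (hE : (E : Set ℝ) = essentialSet (covFn X P) S a b) {y : S → ℝ} (hy : ∀ s, 0 < y s) :
    Tendsto (fun u => (condProb X P S a b u (fun s => u + y s / u)).toReal) atTop
      (𝓝 (∫ ω, limitInd X P S E a b y ω ∂P)) := by
  classical
  have := h.gaussian.isProbabilityMeasure
  have e : ∀ u : ℝ, (condProb X P S a b u (fun s => u + y s / u)).toReal =
      ∫ ω, {ω | ∀ t ∈ Icc a b, u < regression (covFn X P) S t (fun s => u + y s / u) +
        procZ X P S t ω}.indicator 1 ω ∂P := fun u => by
    rw [integral_indicator_one (h.measurableSet_condEvent hab u _)]; rfl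
  simp_rw [e]
  refine tendsto_integral_filter_of_dominated_convergence (fun _ => 1) ?_ ?_
    (integrable_const _) ?_
  · exact Eventually.of_forall fun u =>
      (measurable_one.indicator (h.measurableSet_condEvent hab u _)).aestronglyMeasurable
  · refine Eventually.of_forall fun u => ae_of_all _ fun ω => ?_
    refine (norm_indicator_le_norm_self _ _).trans ?_
    simp
  · filter_upwards [h.ae_eventually_iff hab hO hE hy] with ω hω
    refine tendsto_const_nhds.congr' ?_
    filter_upwards [hω] with u hu
    rw [limitInd_eq_ite, indicator_apply]
    simp only [mem_ofPred_eq, hu, Pi.one_apply]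

/-- The weights of the points of `S` and the indicators at the points of `E \ S`. -/
noncomputable def limitWeight (X : ℝ → Ω → ℝ) (P : Measure Ω) (S E : Finset ℝ) (a b : ℝ)
    (ω : Ω) : ℝ :=
  (∏ t ∈ E \ S, if 0 < procZ X P S t ω then (1 : ℝ) else 0) *
    ∏ s : S, pointWeight a b s (deriv (mu (covFn X P) S) s)
      (iteratedDeriv 2 (mu (covFn X P) S) s) (theta (covFn X P) S s) (derivZ X P S s ω)

/-- For fixed `ω` the integrand is a product of functions of the single coordinates `y_s`, so the
integral factors into one-dimensional exponential tails. -/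
lemma integral_expWeight_mul_limitInd (h : SmoothModel X P a b) (hab : a < b)
    (hO : OptimalStructure (covFn X P) a b ν S) (ω : Ω) :
    ∫ y, expWeight (theta (covFn X P) S) y * limitInd X P S E a b y ω =
      (∏ s, theta (covFn X P) S s)⁻¹ * limitWeight X P S E a b ω := by
  have e : ∀ y : S → ℝ, expWeight (theta (covFn X P) S) y * limitInd X P S E a b y ω =
      (∏ t ∈ E \ S, if 0 < procZ X P S t ω then (1 : ℝ) else 0) *
      ∏ s : S, ((Ioi (0 : ℝ)).indicator (fun v => Real.exp (-(theta (covFn X P) S s * v))) (y s) *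
        (limitSet a b s (deriv (mu (covFn X P) S) s)
      (iteratedDeriv 2 (mu (covFn X P) S) s) (derivZ X P S s ω)).indicator 1 (y s)) := by
    intro y
    rw [Finset.prod_mul_distrib, limitInd, expWeight]
    ring
  simp_rw [e]
  rw [integral_const_mul, integral_fintype_prod_volume_eq_prod (fun (s : S) (v : ℝ) =>
    (Ioi (0 : ℝ)).indicator (fun v => Real.exp (-(theta (covFn X P) S s * v))) v *
        (limitSet a b s (deriv (mu (covFn X P) S) s)
      (iteratedDeriv 2 (mu (covFn X P) S) s) (derivZ X P S s ω)).indicator 1 v)]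
  rw [Finset.prod_congr rfl fun s _ => integral_indicator_limitSet (hO.theta_pos s)
    (h.second_deriv_nonneg hab hO s.2)]
  simp_rw [div_eq_mul_inv]
  rw [Finset.prod_mul_distrib, Finset.prod_inv_distrib, limitWeight]
  ring

lemma integrable_expWeight_mul_limitInd (h : SmoothModel X P a b)
    (hO : OptimalStructure (covFn X P) a b ν S) :
    Integrable (fun p : (S → ℝ) × Ω => expWeight (theta (covFn X P) S) p.1 *
      limitInd X P S E a b p.1 p.2) ((volume : Measure (S → ℝ)).prod P) := by
  have := h.gaussian.isProbabilityMeasure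
  refine ((integrable_expWeight hO.theta_pos).comp_fst P).mul_bdd (c := 1)
    h.measurable_limitInd.aestronglyMeasurable (ae_of_all _ fun p => ?_)
  rw [Real.norm_of_nonneg (limitInd_nonneg _ _)]
  exact limitInd_le_one _ _

/-- As a partial integral of a jointly measurable integrable function, the weight inherits
integrability from Fubini's theorem. -/
lemma limitWeight_eq_mul (h : SmoothModel X P a b) (hab : a < b)
    (hO : OptimalStructure (covFn X P) a b ν S) :
    limitWeight X P S E a b = fun ω => (∏ s, theta (covFn X P) S s) *
      ∫ y, expWeight (theta (covFn X P) S) y * limitInd X P S E a b y ω := by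
  ext ω
  rw [h.integral_expWeight_mul_limitInd hab hO, ← mul_assoc,
    mul_inv_cancel₀ (Finset.prod_pos fun s _ => hO.theta_pos s).ne', one_mul]

lemma integrable_limitWeight (h : SmoothModel X P a b) (hab : a < b)
    (hO : OptimalStructure (covFn X P) a b ν S) : Integrable (limitWeight X P S E a b) P := by
  have := h.gaussian.isProbabilityMeasure
  rw [h.limitWeight_eq_mul hab hO]
  exact (h.integrable_expWeight_mul_limitInd hO).integral_prod_right.const_mul _

lemma integral_expWeight_mul_integral_limitInd (h : SmoothModel X P a b) (hab : a < b)
    (hO : OptimalStructure (covFn X P) a b ν S) :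
    ∫ y, expWeight (theta (covFn X P) S) y * ∫ ω, limitInd X P S E a b y ω ∂P =
      (∏ s, theta (covFn X P) S s)⁻¹ * ∫ ω, limitWeight X P S E a b ω ∂P := by
  have := h.gaussian.isProbabilityMeasure
  simp_rw [← integral_const_mul]
  rw [integral_integral_swap (h.integrable_expWeight_mul_limitInd hO)]
  exact integral_congr_ae (ae_of_all _ fun ω => h.integral_expWeight_mul_limitInd hab hO ω)

/-- The condition `Z'_a ≠ 0` is needed: at a flat endpoint with `Z'_a = 0` the left side is `0` and
the right side is `1`. -/
lemma wLeft_eq (ha : (a : ℝ) ∈ S) {ω : Ω} (hz : derivZ X P S a ω ≠ 0) (hab : a < b) :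
    wLeft X P S a ω = pointWeight a b a (deriv (mu (covFn X P) S) a)
      (iteratedDeriv 2 (mu (covFn X P) S) a) (theta (covFn X P) S ⟨a, ha⟩) (derivZ X P S a ω) := by
  unfold wLeft pointWeight IsCritical
  rcases lt_or_gt_of_ne hz with h | h <;>
    by_cases h1 : deriv (mu (covFn X P) S) a = 0 <;>
    simp [ha, h1, h, h.not_gt, hab.ne]

lemma wRight_eq (hb : (b : ℝ) ∈ S) {ω : Ω} (hz : derivZ X P S b ω ≠ 0) (hab : a < b) :
    wRight X P S b ω = pointWeight a b b (deriv (mu (covFn X P) S) b)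
      (iteratedDeriv 2 (mu (covFn X P) S) b) (theta (covFn X P) S ⟨b, hb⟩) (derivZ X P S b ω) := by
  unfold wRight pointWeight IsCritical
  rcases lt_or_gt_of_ne hz with h | h <;>
    by_cases h1 : deriv (mu (covFn X P) S) b = 0 <;>
    simp [hb, h1, h, h.not_gt, hab.ne']

/-- Spreads an endpoint factor over `S`, so that interior and endpoint factors merge into a single
product. -/
lemma prod_ite_eq_coe {r v : ℝ} (hv : r ∉ S → v = 1) :
    ∏ s : S, (if (s : ℝ) = r then v else 1) = v := by
  by_cases hr : r ∈ S
  · rw [Finset.prod_eq_single ⟨r, hr⟩ (fun s _ hs => if_neg fun h => hs (Subtype.ext h))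
      (by simp), if_pos rfl]
  · rw [hv hr]; simp

lemma randW_ae_eq (h : SmoothModel X P a b) (hab : a < b)
    (hO : OptimalStructure (covFn X P) a b ν S) :
    randW X P S E a b =ᵐ[P] limitWeight X P S E a b := by
  filter_upwards [h.ae_derivZ_ne (S := S) a 0, h.ae_derivZ_ne (S := S) b 0] with ω ha hb
  rw [randW, limitWeight, mul_comm]
  congr 1
  rw [← prod_ite_eq_coe (S := S) (r := a) (v := wLeft X P S a ω)
      (fun h => dif_neg fun h' => h h'.1),
    ← prod_ite_eq_coe (S := S) (r := b) (v := wRight X P S b ω)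
      (fun h => dif_neg fun h' => h h'.1), wInt, ← Finset.prod_mul_distrib,
    ← Finset.prod_mul_distrib]
  refine Finset.prod_congr rfl fun s _ => ?_
  obtain ⟨s, hs⟩ := s
  have hI := hO.subset s hs
  by_cases h1 : s = a
  · subst h1
    simp [hab.ne, wLeft_eq hs ha hab]
  by_cases h2 : s = b
  · subst h2
    simp [hab.ne', wRight_eq hs hb hab]
  have : s ∈ Ioo a b := ⟨lt_of_le_of_ne hI.1 (Ne.symm h1), lt_of_le_of_ne hI.2 h2⟩
  simp only [this, h1, h2, if_true, if_false, mul_one, pointWeight, IsCritical, true_or]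

lemma integrable_randW (h : SmoothModel X P a b) (hab : a < b)
    (hO : OptimalStructure (covFn X P) a b ν S) : Integrable (randW X P S E a b) P :=
  (h.integrable_limitWeight hab hO).congr (h.randW_ae_eq hab hO).symm

/-- Laplace asymptotics with the conditional probability of a high minimum as `q`. Exchanging the
integrals over `y` and `ω` turns the limiting integral into `E(W) / ∏ θ_s`. -/
lemma tendsto_probMinGt_Icc (h : SmoothModel X P a b) (hab : a < b)
    (hO : OptimalStructure (covFn X P) a b ν S)
    (hE : (E : Set ℝ) = essentialSet (covFn X P) S a b) :
    Tendsto (fun u : ℝ => probMinGt X P (Icc a b) u / ((u ^ S.card)⁻¹ *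
      Real.exp (-(u ^ 2 / (2 * energy (covFn X P) ν))))) atTop
      (𝓝 ((∫ ω, randW X P S E a b ω ∂P) / ((2 * Real.pi) ^ ((S.card : ℝ) / 2) *
        (∏ s : S, theta (covFn X P) S s) * Real.sqrt (covMatrix (covFn X P) S).det))) := by
  have := h.gaussian.isProbabilityMeasure
  have key := tendsto_laplace hO.posDef (θ := theta (covFn X P) S) rfl hO.theta_pos hO.sum_theta
    (q := fun u x => (condProb X P S a b u x).toReal)
    (fun u => (h.measurable_condProb hab u).ennreal_toReal) (fun u x => ENNReal.toReal_nonneg)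
    (fun u x => by
      have : condProb X P S a b u x ≤ 1 := prob_le_one
      exact ENNReal.toReal_le_of_le_ofReal zero_le_one (by simpa using this))
    (fun u x s hs => by rw [condProb_eq_zero hO hs, ENNReal.toReal_zero])
    (fun y hy => h.tendsto_condProb hab hO hE hy)
  simp_rw [h.probMinGt_Icc_eq hab hO.posDef, integral_congr_ae (h.randW_ae_eq (E := E) hab hO)]
  rw [h.integral_expWeight_mul_integral_limitInd hab hO, Fintype.card_coe] at key
  convert key using 2
  rw [div_eq_mul_inv, mul_inv, mul_inv, mul_inv]
  ring

/-- The same asymptotics with `q` the indicator of the orthant, whose scaled limit is `1`; the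
constants cancel in the ratio. -/
lemma tendsto_probMinGt_finset (h : SmoothModel X P a b)
    (hO : OptimalStructure (covFn X P) a b ν S) :
    Tendsto (fun u : ℝ => probMinGt X P (S : Set ℝ) u / ((u ^ S.card)⁻¹ *
      Real.exp (-(u ^ 2 / (2 * energy (covFn X P) ν))))) atTop
      (𝓝 (((2 * Real.pi) ^ ((S.card : ℝ) / 2) *
        (∏ s : S, theta (covFn X P) S s) * Real.sqrt (covMatrix (covFn X P) S).det)⁻¹)) := by
  have hms : ∀ u : ℝ, MeasurableSet {x : S → ℝ | ∀ s, u < x s} := fun u => by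
    rw [ofPred_forall]
    exact MeasurableSet.iInter fun s => measurableSet_lt measurable_const (measurable_pi_apply s)
  have hle : ∀ (u : ℝ) (x : S → ℝ),
      ({x : S → ℝ | ∀ s, u < x s}.indicator 1 x : ENNReal) ≤ 1 :=
    fun u x => indicator_le_self' (by simp) x
  have key := tendsto_laplace hO.posDef (θ := theta (covFn X P) S) rfl hO.theta_pos hO.sum_theta
    (q := fun u x => ({x : S → ℝ | ∀ s, u < x s}.indicator 1 x : ENNReal).toReal)
    (ℓ := fun _ => 1)
    (fun u => (measurable_one.indicator (hms u)).ennreal_toReal)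
    (fun u x => ENNReal.toReal_nonneg)
    (fun u x => ENNReal.toReal_le_of_le_ofReal zero_le_one (by simpa using hle u x))
    (fun u x s hs => by
      rw [indicator_of_notMem (fun hx => (hx s).not_ge hs), ENNReal.toReal_zero])
    (fun y hy => by
      refine tendsto_const_nhds.congr' ?_
      filter_upwards [eventually_gt_atTop 0] with u hu
      rw [indicator_of_mem (fun s => by simpa using div_pos (hy s) hu)]
      simp)
  simp_rw [h.probMinGt_finset_eq hO.nonempty hO.posDef]
  simp only [mul_one] at key
  rw [integral_expWeight hO.theta_pos, Fintype.card_coe] at key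
  convert key using 2
  rw [mul_inv, mul_inv, mul_inv]
  ring

lemma tendsto_ratio (h : SmoothModel X P a b) (hab : a < b)
    (hO : OptimalStructure (covFn X P) a b ν S)
    (hE : (E : Set ℝ) = essentialSet (covFn X P) S a b) :
    Tendsto (fun u => probMinGt X P (Icc a b) u / probMinGt X P S u)
      atTop (𝓝 (∫ ω, randW X P S E a b ω ∂P)) := by
  have hC : 0 < (2 * Real.pi) ^ ((S.card : ℝ) / 2) *
        (∏ s : S, theta (covFn X P) S s) * Real.sqrt (covMatrix (covFn X P) S).det :=
    mul_pos (mul_pos (by positivity) (Finset.prod_pos fun s _ => hO.theta_pos s))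
      (Real.sqrt_pos.mpr hO.posDef.det_pos)
  have key := (h.tendsto_probMinGt_Icc hab hO hE).div (h.tendsto_probMinGt_finset hO)
    (inv_ne_zero hC.ne')
  rw [div_inv_eq_mul, div_mul_cancel₀ _ hC.ne'] at key
  refine key.congr' ?_
  filter_upwards [eventually_gt_atTop 0] with u hu
  exact div_div_div_cancel_right₀ (by positivity) _ _

lemma randW_nonneg (ω : Ω) : 0 ≤ randW X P S E a b ω := by
  have h1 : 0 ≤ wInt X P S a b ω := Finset.prod_nonneg fun s _ => by
    split_ifs
    exacts [expFactor_nonneg _ _ _, zero_le_one]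
  have h2 : 0 ≤ wLeft X P S a ω := by
    unfold wLeft
    split_ifs <;> first | exact expFactor_nonneg _ _ _ | simp
  have h3 : 0 ≤ wRight X P S b ω := by
    unfold wRight
    split_ifs <;> first | exact expFactor_nonneg _ _ _ | simp
  exact mul_nonneg (mul_nonneg (mul_nonneg h1 h2) h3)
    (Finset.prod_nonneg fun t _ => by split_ifs <;> simp)

/-- On this event both endpoint factors and all indicators equal `1`. It is an open condition on
finitely many values and derivatives of `X`, so it has positive probability as soon as it can be
satisfied. -/
lemma measure_signs_pos (h : SmoothModel X P a b) (hab : a < b) :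
    0 < P {ω | 0 < derivZ X P S a ω ∧ derivZ X P S b ω < 0 ∧
      ∀ t ∈ E \ S, 0 < procZ X P S t ω} := by
  classical
  set T : Finset ℝ := insert a (insert b (S ∪ E)) with hT
  have haT : a ∈ T := by simp [hT]
  have hbT : b ∈ T := by simp [hT]
  have hST : ∀ s : S, (s : ℝ) ∈ T := fun s => by simp [hT]
  have hET : ∀ t : ↥(E \ S), (t : ℝ) ∈ T := fun t => by
    have := (Finset.mem_sdiff.mp t.2).1
    simp [hT, this]
  set U : Set (T ⊕ T → ℝ) := {x |
    0 < x (Sum.inr ⟨a, haT⟩) -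
      ∑ s : S, deriv (fun t => regCoeff (covFn X P) S t s) a * x (Sum.inl ⟨s, hST s⟩)} ∩ ({x |
    x (Sum.inr ⟨b, hbT⟩) -
      ∑ s : S, deriv (fun t => regCoeff (covFn X P) S t s) b * x (Sum.inl ⟨s, hST s⟩) < 0} ∩
    ⋂ t : ↥(E \ S), {x | 0 < x (Sum.inl ⟨t, hET t⟩) -
      ∑ s : S, regCoeff (covFn X P) S t s * x (Sum.inl ⟨s, hST s⟩)}) with hU
  have hUo : IsOpen U := by
    refine (isOpen_lt (by fun_prop) (by fun_prop)).inter
      ((isOpen_lt (by fun_prop) (by fun_prop)).inter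
        (isOpen_iInter_of_finite fun t => isOpen_lt (by fun_prop) (by fun_prop)))
  have hUne : U.Nonempty := by
    -- Zero values on `S` make the regression terms vanish, so the signs are those of the free
    -- coordinates.
    refine ⟨Sum.elim (fun t => if (t : ℝ) ∈ S then 0 else 1)
      (fun t => if (t : ℝ) = b then -1 else 1),
      ?_, ?_, ?_⟩
    · simp [hab.ne]
    · simp
    · refine mem_iInter.mpr fun t => ?_
      have := (Finset.mem_sdiff.mp t.2).2
      simp [this]
  refine lt_of_lt_of_le (h.measure_jet_pos T hUo hUne) (measure_mono fun ω hω => ?_)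
  obtain ⟨h1, h2, h3⟩ := hω
  refine ⟨?_, ?_, fun t ht => ?_⟩
  · rw [h.derivZ_eq]; exact h1
  · rw [h.derivZ_eq]; exact h2
  · rw [procZ_eq]; exact mem_iInter.mp h3 ⟨t, ht⟩

/-- An interior point with `μ'' = 0` contributes the factor `0` identically. The second derivatives
at the endpoints do not matter, because the sign event makes the endpoint factors `1`. -/
lemma integral_randW_pos_iff (h : SmoothModel X P a b) (hab : a < b)
    (hO : OptimalStructure (covFn X P) a b ν S) :
    0 < ∫ ω, randW X P S E a b ω ∂P ↔
      ∀ t ∈ (S : Set ℝ) ∩ Ioo a b, 0 < iteratedDeriv 2 (mu (covFn X P) S) t := by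
  constructor
  · rintro hpos t ⟨htS, ht⟩
    refine lt_of_le_of_ne (h.second_deriv_nonneg hab hO (z := 0) htS (Or.inl ht)) fun h0 => ?_
    refine hpos.ne' ?_
    have : ∀ ω, randW X P S E a b ω = 0 := fun ω => by
      have : wInt X P S a b ω = 0 := Finset.prod_eq_zero (Finset.mem_univ ⟨t, htS⟩) (by
        simp only [if_pos ht]
        rw [expFactor, if_pos h0.symm])
      rw [randW, this]; simp
    simp [this]
  · intro hm
    rw [integral_pos_iff_support_of_nonneg randW_nonneg (h.integrable_randW hab hO)]
    refine lt_of_lt_of_le (h.measure_signs_pos (S := S) (E := E) hab) (measure_mono fun ω hω => ?_)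
    obtain ⟨h1, h2, h3⟩ := hω
    have e1 : wLeft X P S a ω = 1 := by
      unfold wLeft; split_ifs <;> rfl
    have e2 : wRight X P S b ω = 1 := by
      unfold wRight; split_ifs <;> rfl
    have e3 : 0 < wInt X P S a b ω := Finset.prod_pos fun s _ => by
      split_ifs with hs
      exacts [expFactor_pos (hm s ⟨s.2, hs⟩).ne', one_pos]
    rw [Function.mem_support, randW, e1, e2, Finset.prod_eq_one fun t ht => if_pos (h3 t ht)]
    simpa using e3.ne'

end SmoothModel

end HighMinima

/-! ### Smooth versions and the first set of assumptions -/

namespace HighMinima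

section Modification

variable {Ω : Type*} [MeasurableSpace Ω] {P : Measure Ω} {X X' : ℝ → Ω → ℝ} {a b : ℝ}

/-- The properties of the process that do not depend on the version of the paths. -/
structure SmoothLaw (X : ℝ → Ω → ℝ) (P : Measure Ω) (a b : ℝ) : Prop where
  smooth : ∀ᵐ ω ∂P, ContDiff ℝ ((⊤ : ℕ∞) : WithTop ℕ∞) fun t => X t ω
  power : HasPowerExpansion (covFn X P)
  nondegenerate : ∀ (T : Finset ℝ) (c d : ℝ → ℝ), (∀ᵐ ω ∂P, jetComb X T c d ω = 0) →
    ∀ t ∈ T, c t = 0 ∧ d t = 0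
  energy_pos : ∀ ν ∈ probOn a b, 0 < energy (covFn X P) ν
  potential_ne_const : ∀ ν ∈ probOn a b, ∀ V : ℝ, 0 < V → ¬ ∀ t, ∫ s, covFn X P s t ∂ν = V

lemma covFn_congr (h : ∀ᵐ ω ∂P, ∀ t, X' t ω = X t ω) : covFn X' P = covFn X P := by
  ext s t
  refine integral_congr_ae ?_
  filter_upwards [h] with ω hω
  rw [hω, hω]

/-- The paths are replaced by `0` on a measurable null set containing all non-smooth ones, which
changes neither law nor covariance. -/
lemma SmoothLaw.exists_smoothModel (hL : SmoothLaw X P a b)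
    (hX : IsCenteredContinuousGaussian X P) :
    ∃ X' : ℝ → Ω → ℝ, SmoothModel X' P a b ∧ ∀ᵐ ω ∂P, ∀ t, X' t ω = X t ω := by
  obtain ⟨N, hNsub, hNm, hN⟩ := exists_measurable_superset_of_null (ae_iff.mp hL.smooth)
  have hNae : ∀ᵐ ω ∂P, ω ∉ N := measure_eq_zero_iff_ae_notMem.mp hN
  set X' : ℝ → Ω → ℝ := fun t => Nᶜ.indicator (X t)
  have hon : ∀ ω ∉ N, ∀ t, X' t ω = X t ω := fun ω hω t => indicator_of_mem hω _
  have hoff : ∀ ω ∈ N, ∀ t, X' t ω = 0 := fun ω hω t => indicator_of_notMem (by simpa using hω) _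
  have hae : ∀ᵐ ω ∂P, ∀ t, X' t ω = X t ω := by
    filter_upwards [hNae] with ω hω using hon ω hω
  have hcov := covFn_congr hae
  refine ⟨X', ⟨fun t => (hX.measurable t).indicator hNm.compl, fun ω => ?_, ?_, fun t => ?_, ?_,
    fun T c d hz => hL.nondegenerate T c d ?_, ?_, ?_⟩, hae⟩
  · by_cases hω : ω ∈ N
    · simp_rw [hoff ω hω]
      exact contDiff_const
    · simp_rw [hon ω hω]
      by_contra hc
      exact hω (hNsub hc)
  · refine hX.gaussian.congr fun t => ?_
    filter_upwards [hae] with ω hω using (hω t).symm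
  · rw [← hX.centered t]
    refine integral_congr_ae ?_
    filter_upwards [hae] with ω hω using hω t
  · rw [hcov]; exact hL.power
  · filter_upwards [hz, hae] with ω hω h
    simpa only [jetComb, h] using hω
  · rw [hcov]; exact hL.energy_pos
  · rw [hcov]; exact hL.potential_ne_const

end Modification

section AssumptionA

variable {Ω : Type*} [MeasurableSpace Ω] {P : Measure Ω} {X : ℝ → Ω → ℝ} {a b : ℝ}

/-- If the combination vanishes almost surely, its coefficient vector is in the kernel of the
covariance matrix of the values and first derivatives on `T`, which is non-singular. -/
lemma SmoothNondegenerate.jet (h : SmoothNondegenerate X P)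
    (hX : IsCenteredContinuousGaussian X P) (T : Finset ℝ) (c d : ℝ → ℝ)
    (hz : ∀ᵐ ω ∂P, jetComb X T c d ω = 0) : ∀ t ∈ T, c t = 0 ∧ d t = 0 := by
  classical
  have := hX.gaussian.isProbabilityMeasure
  have hd : ∀ᵐ ω ∂P, Differentiable ℝ fun t => X t ω := by
    filter_upwards [h.1] with ω hω using hω.differentiable (by simp)
  set I : Finset (ℝ × ℕ) := T ×ˢ {0, 1} with hI
  set D : ℝ × ℕ → Ω → ℝ := fun p ω => iteratedDeriv p.2 (fun t => X t ω) p.1 with hD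
  set v : ℝ × ℕ → ℝ := fun p => if p.2 = 0 then c p.1 else d p.1 with hv
  have hmem : ∀ p ∈ I, MemLp (D p) 2 P := by
    rintro ⟨t, n⟩ hp
    simp only [hI, Finset.mem_product, Finset.mem_insert, Finset.mem_singleton] at hp
    rcases hp.2 with rfl | rfl
    · simpa [hD] using memLp_two_of_gaussian hX.gaussian t
    · have := (gaussian_jetComb hX.gaussian hX.centered hd {t} 0 1).1.memLp_two
      have e : jetComb X {t} 0 1 = D (t, 1) := by
        ext ω; simp [jetComb, hD]
      rwa [e] at this
  have hsum : ∀ ω, ∑ q : I, v q * D q ω = jetComb X T c d ω := by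
    intro ω
    rw [Finset.sum_coe_sort I (fun q => v q * D q ω), hI, Finset.sum_product, jetComb]
    refine Finset.sum_congr rfl fun t _ => ?_
    simp [hv, hD]
  have hMv : (Matrix.of fun p q : I => cov[fun ω => iteratedDeriv p.1.2 (fun t => X t ω) p.1.1,
      fun ω => iteratedDeriv q.1.2 (fun t => X t ω) q.1.1; P]) *ᵥ (fun q : I => v q) = 0 := by
    ext p
    have h1 : cov[D p, fun ω => ∑ q : I, v q * D q ω; P] = 0 := by
      have : (fun ω => ∑ q : I, v q * D q ω) =ᵐ[P] 0 := by
        filter_upwards [hz] with ω hω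
        rw [hsum, hω, Pi.zero_apply]
      rw [covariance, integral_congr_ae this]
      refine integral_eq_zero_of_ae ?_
      filter_upwards [this] with ω hω
      simp only [hω]; simp
    rw [covariance_fun_sum_right (X := fun (q : I) ω => v q * D q ω)
      (fun q => (hmem q q.2).const_mul _) (hmem p p.2)] at h1
    simp only [covariance_const_mul_right] at h1
    rw [Pi.zero_apply, ← h1]
    simp only [Matrix.mulVec, dotProduct, Matrix.of_apply]
    exact Finset.sum_congr rfl fun q _ => mul_comm _ _
  have hv0 := Matrix.eq_zero_of_mulVec_eq_zero (h.2 I) hMv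
  intro t ht
  have h0 : (t, 0) ∈ I := by simp [hI, ht]
  have h1 : (t, 1) ∈ I := by simp [hI, ht]
  exact ⟨by simpa [hv] using congrFun hv0 ⟨_, h0⟩, by simpa [hv] using congrFun hv0 ⟨_, h1⟩⟩

/-- The positive parts of `R(s,t)` tend to `0` for each `s` as `t → ∞` and are bounded for large
`t`. By dominated convergence their `ν`-integrals tend to `0`, and these bound the potential from
above. -/
lemma potential_ne_const_of_limsup {R : ℝ → ℝ → ℝ} (hR : Continuous fun p : ℝ × ℝ => R p.1 p.2)
    (hlim : ∀ s ∈ Icc a b, limsup (fun t : ℝ => (R s t : EReal)) atTop ≤ 0)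
    (hbdd : ∃ M : ℝ, ∀ᶠ t in atTop, ∀ s ∈ Icc a b, R s t ≤ M)
    {ν : Measure ℝ} (hν : ν ∈ probOn a b) {V : ℝ} (hV : 0 < V) :
    ¬ ∀ t, ∫ s, R s t ∂ν = V := by
  intro hconst
  have := hν.1
  obtain ⟨M, hM⟩ := hbdd
  have hcont : ∀ t, Continuous fun s => R s t := fun t =>
    hR.comp (continuous_id.prodMk continuous_const)
  have hmem := ae_mem_Icc_of_mem_probOn hν
  have key : Tendsto (fun t : ℝ => ∫ s, max (R s t) 0 ∂ν) atTop (𝓝 (∫ _, (0 : ℝ) ∂ν)) := by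
    refine tendsto_integral_filter_of_dominated_convergence (fun _ => max M 0) ?_ ?_
      (integrable_const _) ?_
    · exact Eventually.of_forall fun t =>
        ((hcont t).max continuous_const).aestronglyMeasurable
    · filter_upwards [hM] with t ht
      filter_upwards [hmem] with s hs
      rw [Real.norm_of_nonneg (le_max_right _ _)]
      exact max_le_max (ht s hs) le_rfl
    · filter_upwards [hmem] with s hs
      rw [tendsto_order]
      refine ⟨fun c hc => Eventually.of_forall fun t => hc.trans_le (le_max_right _ _),
        fun c hc => ?_⟩
      have hlt : limsup (fun t : ℝ => (R s t : EReal)) atTop < (c : EReal) :=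
        (hlim s hs).trans_lt (by exact_mod_cast hc)
      filter_upwards [eventually_lt_of_limsup_lt hlt] with t ht
      exact max_lt (by exact_mod_cast ht) hc
  rw [integral_zero] at key
  refine absurd (ge_of_tendsto' key fun t => ?_) hV.not_ge
  rw [← hconst t]
  exact integral_mono (integrable_of_continuous hν (hcont t))
    (integrable_of_continuous hν ((hcont t).max continuous_const)) fun s => le_max_left _ _

lemma AssumptionA.smoothLaw (h : AssumptionA X P a b) (hX : IsCenteredContinuousGaussian X P) :
    SmoothLaw X P a b where
  smooth := h.smooth_nondegenerate.1
  power := h.power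
  nondegenerate := h.smooth_nondegenerate.jet hX
  energy_pos := h.nonneg_nondegenerate a b
  potential_ne_const _ hν _ hV :=
    potential_ne_const_of_limsup h.power.continuous h.limsup_nonpos h.bddAbove hν hV

end AssumptionA

end HighMinima

/-! ### The stationary case: real spectral representation -/

namespace HighMinima

section Cas

/-- The function `cos + sin`. -/
noncomputable def cas (y : ℝ) : ℝ := Real.cos y + Real.sin y

/-- The derivatives of `cas` at `0`. -/
noncomputable def casCoeff (n : ℕ) : ℝ := ((1 - Complex.I) * Complex.I ^ n).re

lemma casCoeff_sq (n : ℕ) : casCoeff n ^ 2 = 1 := by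
  -- Multiplication by `i` exchanges real and imaginary parts up to sign, so both must be carried
  -- through the induction.
  suffices h : ((1 - Complex.I) * Complex.I ^ n).re ^ 2 = 1 ∧
      ((1 - Complex.I) * Complex.I ^ n).im ^ 2 = 1 from h.1
  induction n with
  | zero => simp
  | succ n ih =>
    rw [pow_succ Complex.I, ← mul_assoc, Complex.mul_I_re, Complex.mul_I_im]
    exact ⟨by rw [neg_sq]; exact ih.2, ih.1⟩

/-- This is what `cas` has over sine and cosine: no Taylor coefficient vanishes, so a vanishing
combination of functions `cas(t x)` yields all moment equations. -/
lemma casCoeff_ne_zero (n : ℕ) : casCoeff n ≠ 0 := fun h => by simpa [h] using casCoeff_sq n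

lemma abs_casCoeff (n : ℕ) : |casCoeff n| = 1 := by
  rw [← sq_eq_sq₀ (abs_nonneg _) zero_le_one, sq_abs, casCoeff_sq, one_pow]

lemma hasSum_casCoeff_add (k : ℕ) (y : ℝ) :
    HasSum (fun n : ℕ => casCoeff (n + k) / n.factorial * y ^ n)
      ((1 - Complex.I) * Complex.I ^ k * Complex.exp (y * Complex.I)).re := by
  have h := Complex.hasSum_re ((NormedSpace.expSeries_div_hasSum_exp
    ((y : ℂ) * Complex.I)).mul_left ((1 - Complex.I) * Complex.I ^ k))
  rw [← Complex.exp_eq_exp_ℂ] at h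
  convert h using 2 with n
  have e : (1 - Complex.I) * Complex.I ^ k * ((y * Complex.I) ^ n / (n.factorial : ℂ)) =
      ((y ^ n / n.factorial : ℝ) : ℂ) * ((1 - Complex.I) * Complex.I ^ (n + k)) := by
    push_cast
    rw [mul_pow, pow_add]
    ring
  rw [e, Complex.re_ofReal_mul, casCoeff]
  ring

lemma hasSum_cas (y : ℝ) : HasSum (fun n : ℕ => casCoeff n / n.factorial * y ^ n) (cas y) := by
  have h := hasSum_casCoeff_add 0 y
  have e : ((1 - Complex.I) * Complex.I ^ 0 * Complex.exp (y * Complex.I)).re = cas y := by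
    rw [pow_zero, mul_one, Complex.mul_re, Complex.exp_ofReal_mul_I_re,
      Complex.exp_ofReal_mul_I_im]
    simp [cas]
  rwa [e] at h

lemma hasSum_deriv_cas (y : ℝ) :
    HasSum (fun n : ℕ => casCoeff (n + 1) / n.factorial * y ^ n) (Real.cos y - Real.sin y) := by
  have h := hasSum_casCoeff_add 1 y
  have e : ((1 - Complex.I) * Complex.I ^ 1 * Complex.exp (y * Complex.I)).re =
      Real.cos y - Real.sin y := by
    rw [pow_one, Complex.mul_re, Complex.exp_ofReal_mul_I_re, Complex.exp_ofReal_mul_I_im]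
    simp
  rwa [e] at h

lemma continuous_cas : Continuous cas := Real.continuous_cos.add Real.continuous_sin

lemma abs_cas_le (y : ℝ) : |cas y| ≤ 2 :=
  (abs_add_le _ _).trans (by linarith [Real.abs_cos_le_one y, Real.abs_sin_le_one y])

/-- The sine term integrates to zero against a symmetric measure. Hence the products `cas(s x) cas(t
x)` represent the stationary covariance by a real Gram kernel. -/
lemma cas_mul_cas (x y : ℝ) : cas x * cas y = Real.cos (y - x) + Real.sin (x + y) := by
  rw [cas, cas, Real.cos_sub, Real.sin_add]
  ring

lemma cas_add_add_cas_sub (x y : ℝ) : cas (x + y) + cas (x - y) = 2 * (Real.cos y * cas x) := by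
  rw [cas, cas, cas, Real.cos_add, Real.cos_sub, Real.sin_add, Real.sin_sub]
  ring

lemma hasDerivAt_cas (y : ℝ) : HasDerivAt cas (Real.cos y - Real.sin y) y := by
  have := (Real.hasDerivAt_cos y).add (Real.hasDerivAt_sin y)
  rwa [show -Real.sin y + Real.cos y = Real.cos y - Real.sin y by ring] at this

lemma hasDerivAt_cas_mul (x t : ℝ) :
    HasDerivAt (fun s => cas (s * x)) ((Real.cos (t * x) - Real.sin (t * x)) * x) t := by
  have := (hasDerivAt_cas (t * x)).comp t ((hasDerivAt_id t).mul_const x)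
  rw [one_mul] at this
  exact this

/-- The double series lives on the diagonal. In this form the lemma on potentials also gives the
analyticity of the transform of a measure. -/
lemma hasPowerExpansion_cas : HasPowerExpansion fun s x => cas (s * x) := by
  refine ⟨fun m n => if m = n then casCoeff n / n.factorial else 0, fun s x => ?_⟩
  have hinj : Function.Injective fun n : ℕ => (n, n) := fun m n h => (Prod.ext_iff.mp h).1
  rw [← hinj.hasSum_iff]
  · have e : (fun n : ℕ => casCoeff n / n.factorial * (s * x) ^ n) = (fun p : ℕ × ℕ =>
        (if p.1 = p.2 then casCoeff p.2 / p.2.factorial else 0) * s ^ p.1 * x ^ p.2) ∘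
        fun n : ℕ => (n, n) := by
      ext n
      simp only [Function.comp, if_true, mul_pow, mul_assoc]
    rw [← e]
    exact hasSum_cas (s * x)
  · rintro ⟨m, n⟩ hp
    have : m ≠ n := fun h => hp ⟨m, by rw [h]⟩
    simp [this]

lemma hasSum_exp (y : ℝ) : HasSum (fun n : ℕ => y ^ n / n.factorial) (Real.exp y) := by
  rw [Real.exp_eq_exp_ℝ]
  exact NormedSpace.expSeries_div_hasSum_exp y

lemma hasSum_cas_mul_cas (x y : ℝ) :
    HasSum (fun p : ℕ × ℕ => casCoeff p.1 / p.1.factorial * x ^ p.1 *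
      (casCoeff p.2 / p.2.factorial * y ^ p.2)) (cas x * cas y) :=
  HasSum.mul (f := fun n : ℕ => casCoeff n / n.factorial * x ^ n)
    (g := fun n : ℕ => casCoeff n / n.factorial * y ^ n) (hasSum_cas x) (hasSum_cas y)
    (summable_mul_of_summable_norm (f := fun n : ℕ => casCoeff n / n.factorial * x ^ n)
      (g := fun n : ℕ => casCoeff n / n.factorial * y ^ n)
      (hasSum_cas x).summable.norm (hasSum_cas y).summable.norm)

end Cas

/-- `R` is the stationary covariance with spectral measure `F`, in a real form. -/
structure IsSpectral (R : ℝ → ℝ → ℝ) (F : Measure ℝ) : Prop where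
  finite : IsFiniteMeasure F
  rep : ∀ s t, R s t = ∫ x, cas (s * x) * cas (t * x) ∂F
  exp_moment : ∀ t : ℝ, Integrable (fun x : ℝ => Real.exp (t * x)) F
  accPt : ∃ x : ℝ, AccPt x (𝓟 F.support)

lemma integral_sin_eq_zero {F : Measure ℝ} (hsymm : F.map (fun x => -x) = F) (c : ℝ) :
    ∫ x, Real.sin (c * x) ∂F = 0 := by
  have h1 : ∫ x, Real.sin (c * x) ∂F = ∫ x, Real.sin (c * -x) ∂F := by
    conv_lhs => rw [← hsymm]
    rw [integral_map (by fun_prop) (by fun_prop)]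
  simp only [mul_neg, Real.sin_neg, integral_neg] at h1
  linarith

lemma AssumptionB.exists_isSpectral {Ω : Type*} [MeasurableSpace Ω] {P : Measure Ω}
    {X : ℝ → Ω → ℝ} (h : AssumptionB X P) : ∃ F, IsSpectral (covFn X P) F := by
  obtain ⟨F, hF, hsymm, hrep, hexp, hacc⟩ := h
  refine ⟨F, hF, fun s t => ?_, hexp, hacc⟩
  have h_int : Integrable (fun x : ℝ => Complex.exp (Complex.I * (t - s) * x)) F := by
    refine Integrable.of_bound (by fun_prop) 1 (ae_of_all _ fun x => ?_)
    rw [show Complex.I * (t - s) * x = (((t - s) * x : ℝ) : ℂ) * Complex.I by push_cast; ring,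
      Complex.norm_exp_ofReal_mul_I]
  have h1 : covFn X P s t = ∫ x, Real.cos ((t - s) * x) ∂F := by
    have h2 := congrArg Complex.re (hrep s t)
    rw [Complex.ofReal_re] at h2
    rw [h2]
    refine (integral_re (𝕜 := ℂ) h_int).symm.trans (integral_congr_ae (ae_of_all _ fun x => ?_))
    change (Complex.exp (Complex.I * (t - s) * x)).re = _
    rw [show Complex.I * (t - s) * x = (((t - s) * x : ℝ) : ℂ) * Complex.I by push_cast; ring,
      Complex.exp_ofReal_mul_I_re]
  have hi1 : Integrable (fun x : ℝ => Real.cos ((t - s) * x)) F :=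
    Integrable.of_bound (by fun_prop) 1 (ae_of_all _ fun x => Real.abs_cos_le_one _)
  have hi2 : Integrable (fun x : ℝ => Real.sin ((s + t) * x)) F :=
    Integrable.of_bound (by fun_prop) 1 (ae_of_all _ fun x => Real.abs_sin_le_one _)
  have h3 : ∀ x, cas (s * x) * cas (t * x) = Real.cos ((t - s) * x) + Real.sin ((s + t) * x) :=
    fun x => by rw [cas_mul_cas]; congr 2 <;> ring
  simp_rw [h3]
  rw [integral_add hi1 hi2, integral_sin_eq_zero hsymm, add_zero, h1]

namespace IsSpectral

variable {R : ℝ → ℝ → ℝ} {F : Measure ℝ} {a b : ℝ} {ν : Measure ℝ}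

lemma integrable_exp_abs (h : IsSpectral R F) (r : ℝ) :
    Integrable (fun x => Real.exp (r * |x|)) F := by
  refine ((h.exp_moment r).add (h.exp_moment (-r))).mono' (by fun_prop) (ae_of_all _ fun x => ?_)
  rw [Real.norm_of_nonneg (Real.exp_pos _).le, Pi.add_apply]
  rcases abs_choice x with hx | hx <;> rw [hx]
  · linarith [Real.exp_pos (-r * x)]
  · rw [mul_neg, ← neg_mul]; linarith [Real.exp_pos (r * x)]

/-- The two exponential series dominate the terms, with sum `exp((|s| + |t|) |x|)`, which is
`F`-integrable because all exponential moments are finite. -/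
lemma hasPowerExpansion (h : IsSpectral R F) : HasPowerExpansion R := by
  refine ⟨fun m n => ∫ x, casCoeff m / m.factorial * (casCoeff n / n.factorial) * x ^ (m + n) ∂F,
    fun s t => ?_⟩
  have hb : ∀ x : ℝ, HasSum (fun p : ℕ × ℕ => |s * x| ^ p.1 / (p.1.factorial : ℝ) *
      (|t * x| ^ p.2 / (p.2.factorial : ℝ))) (Real.exp |s * x| * Real.exp |t * x|) := fun x =>
    (hasSum_exp _).mul (hasSum_exp _) ((hasSum_exp _).summable.mul_of_nonneg (hasSum_exp _).summable
      (fun n => by positivity) (fun n => by positivity))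
  have key := hasSum_integral_of_dominated_convergence (μ := F)
    (F := fun (p : ℕ × ℕ) (x : ℝ) => casCoeff p.1 / p.1.factorial * (s * x) ^ p.1 *
      (casCoeff p.2 / p.2.factorial * (t * x) ^ p.2))
    (f := fun x => cas (s * x) * cas (t * x))
    (fun p x => |s * x| ^ p.1 / (p.1.factorial : ℝ) * (|t * x| ^ p.2 / (p.2.factorial : ℝ)))
    (fun p => by fun_prop) (fun p => ae_of_all _ fun x => ?_)
    (ae_of_all _ fun x => (hb x).summable) ?_ (ae_of_all _ fun x => ?_)
  · rw [h.rep]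
    have e : ∀ p : ℕ × ℕ, (∫ x, casCoeff p.1 / p.1.factorial * (casCoeff p.2 / p.2.factorial) *
        x ^ (p.1 + p.2) ∂F) * s ^ p.1 * t ^ p.2 = ∫ x, casCoeff p.1 / p.1.factorial *
        (s * x) ^ p.1 * (casCoeff p.2 / p.2.factorial * (t * x) ^ p.2) ∂F := fun p => ?_
    · simp_rw [e]
      exact key
    rw [← integral_mul_const, ← integral_mul_const]
    refine integral_congr_ae (ae_of_all _ fun x => ?_)
    simp only [mul_pow, pow_add]
    ring
  · simp only [norm_mul, norm_div, norm_pow, Real.norm_eq_abs, abs_casCoeff, Nat.abs_cast, abs_mul]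
    apply le_of_eq
    ring
  · simp_rw [fun x => (hb x).tsum_eq, ← Real.exp_add]
    have e : ∀ x : ℝ, |s * x| + |t * x| = (|s| + |t|) * |x| := fun x => by
      rw [abs_mul, abs_mul, add_mul]
    simp_rw [e]
    exact h.integrable_exp_abs (|s| + |t|)
  · exact hasSum_cas_mul_cas (s * x) (t * x)

/-- A continuous function that vanishes almost everywhere vanishes on the support. As the support
accumulates, the identity theorem applies. -/
lemma eq_zero_of_ae (h : IsSpectral R F) {g : ℝ → ℝ} (hg : AnalyticOnNhd ℝ g univ)
    (hae : ∀ᵐ x ∂F, g x = 0) (x : ℝ) : g x = 0 := by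
  obtain ⟨y, hy⟩ := h.accPt
  have hc : Continuous g := continuousOn_univ.mp hg.continuousOn
  have hsub : F.support ⊆ {x | g x = 0} :=
    Measure.support_subset_of_isClosed (isClosed_eq hc continuous_const) hae
  rw [accPt_iff_frequently_nhdsNE] at hy
  exact hg.eqOn_of_preconnected_of_frequently_eq (g := fun _ => 0) analyticOnNhd_const
    isPreconnected_univ (mem_univ y) (hy.mono hsub) (mem_univ x)

/-- The transform of a measure with kernel `cas`. -/
noncomputable def casTransform (ν : Measure ℝ) (x : ℝ) : ℝ := ∫ s, cas (s * x) ∂ν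

lemma analytic_casTransform (hν : ν ∈ probOn a b) : AnalyticOnNhd ℝ (casTransform ν) univ := by
  obtain ⟨c, hc⟩ := hasPowerExpansion_cas.exists_hasEntireSeries_integral hν
  exact hc.analyticOnNhd

lemma casTransform_zero (hν : ν ∈ probOn a b) : casTransform ν 0 = 1 := by
  have := hν.1
  simp [casTransform, cas]

lemma abs_casTransform_le (hν : ν ∈ probOn a b) (x : ℝ) : |casTransform ν x| ≤ 2 := by
  have := hν.1
  have h := norm_integral_le_of_norm_le_const (μ := ν) (f := fun s => cas (s * x)) (C := 2)
    (ae_of_all _ fun s => abs_cas_le _)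
  rw [probReal_univ, mul_one] at h
  exact h

lemma continuous_casTransform (hν : ν ∈ probOn a b) : Continuous (casTransform ν) :=
  continuousOn_univ.mp (analytic_casTransform hν).continuousOn

lemma integral_integral_cas (h : IsSpectral R F) (hν : ν ∈ probOn a b) {φ : ℝ → ℝ}
    (hφ : Continuous φ) {C : ℝ} (hC : ∀ x, |φ x| ≤ C) :
    ∫ t, ∫ x, cas (t * x) * φ x ∂F ∂ν = ∫ x, casTransform ν x * φ x ∂F := by
  have := hν.1
  have := h.finite
  have hc := continuous_cas
  rw [integral_integral_swap]
  · simp_rw [integral_mul_const]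
    rfl
  · refine Integrable.of_bound (C := 2 * C) ?_ (ae_of_all _ fun p => ?_)
    · exact Continuous.aestronglyMeasurable (by unfold Function.uncurry; fun_prop)
    · simp only [Function.uncurry, norm_mul, Real.norm_eq_abs]
      exact mul_le_mul (abs_cas_le _) (hC _) (abs_nonneg _) zero_le_two

lemma potential_eq (h : IsSpectral R F) (hν : ν ∈ probOn a b) (t : ℝ) :
    ∫ s, R s t ∂ν = ∫ x, cas (t * x) * casTransform ν x ∂F := by
  have hc := continuous_cas
  simp_rw [h.rep]
  rw [h.integral_integral_cas hν (by fun_prop) (fun x => abs_cas_le (t * x))]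
  simp_rw [mul_comm]

lemma integrable_mul_bounded (h : IsSpectral R F) {φ ψ : ℝ → ℝ} (hφ : Continuous φ)
    (hψ : Continuous ψ) {C D : ℝ} (hC : ∀ x, |φ x| ≤ C) (hD : ∀ x, |ψ x| ≤ D) :
    Integrable (fun x => φ x * ψ x) F := by
  have := h.finite
  refine Integrable.of_bound (C := C * D) (by fun_prop) (ae_of_all _ fun x => ?_)
  rw [norm_mul]
  exact mul_le_mul (hC x) (hD x) (abs_nonneg _) ((abs_nonneg _).trans (hC x))

/-- The energy is `∫ φ² dF` with `φ` the `cas` transform of `ν`. If it were `0`, analyticity would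
give `φ ≡ 0`, but `φ(0) = 1`. -/
lemma energy_pos (h : IsSpectral R F) (hν : ν ∈ probOn a b) : 0 < energy R ν := by
  have hc := continuous_casTransform hν
  have hb := abs_casTransform_le hν
  have e : energy R ν = ∫ x, casTransform ν x * casTransform ν x ∂F := by
    unfold energy
    simp_rw [h.potential_eq hν]
    exact h.integral_integral_cas hν hc hb
  have hnn : ∀ x, 0 ≤ casTransform ν x * casTransform ν x := fun x => mul_self_nonneg _
  rw [e]
  refine lt_of_le_of_ne (integral_nonneg hnn) fun h0 => ?_
  have h1 := (integral_eq_zero_iff_of_nonneg hnn (h.integrable_mul_bounded hc hc hb hb)).mp h0.symm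
  have h2 := h.eq_zero_of_ae (analytic_casTransform hν) (by
    filter_upwards [h1] with x hx
    simpa using hx) 0
  rw [casTransform_zero hν] at h2
  exact one_ne_zero h2

/-- For a constant potential, second differences in `t` give `∫ cas(t x) (1 - cos x) φ(x) F(dx) = 0`
for every `t`, where `φ` is the transform of `ν`. Integrating over `ν(dt)` yields `∫ (1 - cos x)
φ(x)² F(dx) = 0`. By analyticity the integrand vanishes identically, so `φ = 0` in a punctured
neighbourhood of `0`, against `φ(0) = 1`. -/
lemma potential_ne_const (h : IsSpectral R F) (hν : ν ∈ probOn a b) (V : ℝ) :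
    ¬ ∀ t, ∫ s, R s t ∂ν = V := by
  intro hconst
  have := hν.1
  have hcc := continuous_cas
  have hc := continuous_casTransform hν
  have hb := abs_casTransform_le hν
  simp_rw [h.potential_eq hν] at hconst
  have hi : ∀ t, Integrable (fun x => cas (t * x) * casTransform ν x) F := fun t =>
    h.integrable_mul_bounded (by fun_prop) hc (fun x => abs_cas_le _) hb
  have hφc : Continuous fun x => (1 - Real.cos x) * casTransform ν x := by fun_prop
  have hφb : ∀ x, |(1 - Real.cos x) * casTransform ν x| ≤ 2 * 2 := fun x => by
    rw [abs_mul]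
    refine mul_le_mul ?_ (hb x) (abs_nonneg _) zero_le_two
    exact abs_le.mpr ⟨by linarith [Real.cos_le_one x], by linarith [Real.neg_one_le_cos x]⟩
  have h1 : ∀ t, ∫ x, cas (t * x) * ((1 - Real.cos x) * casTransform ν x) ∂F = 0 := by
    intro t
    have e : ∀ x, cas (t * x) * ((1 - Real.cos x) * casTransform ν x) =
        cas (t * x) * casTransform ν x - 2⁻¹ * (cas ((t + 1) * x) * casTransform ν x +
          cas ((t - 1) * x) * casTransform ν x) := fun x => by
      have := cas_add_add_cas_sub (t * x) x
      rw [show (t + 1) * x = t * x + x by ring, show (t - 1) * x = t * x - x by ring, ← add_mul,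
        this]
      ring
    simp_rw [e]
    have hi2 : Integrable (fun x => cas ((t + 1) * x) * casTransform ν x +
        cas ((t - 1) * x) * casTransform ν x) F := (hi _).add (hi _)
    rw [integral_sub (hi t) (hi2.const_mul _), integral_const_mul,
      integral_add (hi _) (hi _), hconst, hconst, hconst]
    ring
  have h2 := h.integral_integral_cas hν hφc hφb
  simp_rw [h1, integral_zero] at h2
  have hnn : ∀ x, 0 ≤ casTransform ν x * ((1 - Real.cos x) * casTransform ν x) := fun x => by
    have : 0 ≤ 1 - Real.cos x := by linarith [Real.cos_le_one x]
    nlinarith [mul_nonneg this (mul_self_nonneg (casTransform ν x))]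
  have h3 := (integral_eq_zero_iff_of_nonneg hnn
    (h.integrable_mul_bounded hc hφc hb hφb)).mp h2.symm
  have han : AnalyticOnNhd ℝ (fun x => casTransform ν x * ((1 - Real.cos x) * casTransform ν x))
      univ := fun x _ => (analytic_casTransform hν x (mem_univ x)).mul
    ((analyticAt_const.sub Real.analyticAt_cos).mul (analytic_casTransform hν x (mem_univ x)))
  have h4 := h.eq_zero_of_ae han h3
  have h5 : ∀ᶠ x in 𝓝[≠] (0 : ℝ), casTransform ν x = 0 := by
    have hlt : ∀ᶠ x in 𝓝[≠] (0 : ℝ), x ∈ Ioo (-1 : ℝ) 1 :=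
      mem_nhdsWithin_of_mem_nhds (Ioo_mem_nhds (by norm_num) (by norm_num))
    filter_upwards [hlt, self_mem_nhdsWithin] with x hx hx0
    have hcos : 1 - Real.cos x ≠ 0 := by
      intro hcos
      have := (Real.cos_eq_one_iff_of_lt_of_lt (x := x) (by linarith [Real.pi_gt_three, hx.1])
        (by linarith [Real.pi_gt_three, hx.2])).mp (by linarith)
      exact hx0 this
    have := h4 x
    simpa [hcos] using this
  have h6 : Tendsto (casTransform ν) (𝓝[≠] 0) (𝓝 (casTransform ν 0)) :=
    hc.continuousAt.tendsto.mono_left nhdsWithin_le_nhds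
  have h7 : Tendsto (casTransform ν) (𝓝[≠] 0) (𝓝 0) :=
    tendsto_const_nhds.congr' (by filter_upwards [h5] with x hx using hx.symm)
  have := tendsto_nhds_unique h6 h7
  rw [casTransform_zero hν] at this
  exact one_ne_zero this

end IsSpectral

end HighMinima

/-! ### Non-degeneracy in the stationary case -/

namespace HighMinima

section Moments

open Polynomial in
/-- Values and first derivatives of polynomials at finitely many points are independent. -/
lemma eq_zero_of_moments {T : Finset ℝ} {c d : ℝ → ℝ}
    (h : ∀ n : ℕ, ∑ t ∈ T, (c t * t ^ n + d t * (n * t ^ (n - 1))) = 0) :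
    ∀ t ∈ T, c t = 0 ∧ d t = 0 := by
  classical
  have hp : ∀ p : ℝ[X], ∑ t ∈ T, (c t * p.eval t + d t * (derivative p).eval t) = 0 := by
    intro p
    induction p using Polynomial.induction_on' with
    | add p q hp hq =>
      refine Eq.trans ?_ ((congrArg₂ (· + ·) hp hq).trans (add_zero 0))
      rw [← Finset.sum_add_distrib]
      refine Finset.sum_congr rfl fun t _ => ?_
      simp only [eval_add, derivative_add]
      ring
    | monomial n x =>
      rw [← mul_zero x, ← h n, Finset.mul_sum]
      refine Finset.sum_congr rfl fun t _ => ?_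
      simp only [eval_monomial, derivative_monomial]
      ring
  intro t ht
  -- The polynomial `q` has double zeros at all other nodes, so multiples of `q` test only the node
  -- `t`: `(X - t) q` isolates `d t`, and then `q` isolates `c t`.
  set q : ℝ[X] := ∏ r ∈ T.erase t, (X - C r) ^ 2 with hq
  have hqt : q.eval t ≠ 0 := by
    rw [hq, eval_prod]
    refine Finset.prod_ne_zero_iff.mpr fun r hr => ?_
    simpa [sub_eq_zero] using (Finset.ne_of_mem_erase hr).symm
  have hdvd : ∀ r ∈ T, r ≠ t → (X - C r) ^ 2 ∣ q := fun r hr hrt =>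
    Finset.dvd_prod_of_mem (fun r => (X - C r) ^ 2) (Finset.mem_erase.mpr ⟨hrt, hr⟩)
  have hvan : ∀ p : ℝ[X], q ∣ p → c t * p.eval t + d t * (derivative p).eval t = 0 := by
    intro p hqp
    rw [← hp p]
    refine (Finset.sum_eq_single_of_mem (f := fun t => c t * p.eval t +
      d t * (derivative p).eval t) t ht fun r hr hrt => ?_).symm
    obtain ⟨g, rfl⟩ := (hdvd r hr hrt).trans hqp
    simp [derivative_mul, derivative_pow]
  have h1 := hvan ((X - C t) * q) (dvd_mul_left _ _)
  have hd : d t = 0 := by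
    simpa [derivative_mul, hqt] using h1
  have h2 := hvan q dvd_rfl
  rw [hd, zero_mul, add_zero] at h2
  exact ⟨(mul_eq_zero.mp h2).resolve_right hqt, hd⟩

end Moments

section Gram

lemma linearCombination_apply_apply {Ω : Type*} {X : ℝ → Ω → ℝ} (l : ℝ →₀ ℝ) (ω : Ω) :
    Finsupp.linearCombination ℝ X l ω = ∑ t ∈ l.support, l t * X t ω := by
  simp [Finsupp.linearCombination_apply, Finsupp.sum, Finset.sum_apply]

variable {Ω : Type*} [MeasurableSpace Ω] {P : Measure Ω} {X : ℝ → Ω → ℝ}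

lemma memLp_linearCombination (hX : ∀ t, MemLp (X t) 2 P) (l : ℝ →₀ ℝ) :
    MemLp (Finsupp.linearCombination ℝ X l) 2 P := by
  have e : Finsupp.linearCombination ℝ X l = fun ω => ∑ t ∈ l.support, l t * X t ω :=
    funext fun ω => linearCombination_apply_apply l ω
  rw [e]
  exact memLp_finsetSum _ fun t _ => (hX t).const_mul _

lemma integral_sq_linearCombination (hX : ∀ t, MemLp (X t) 2 P) (l : ℝ →₀ ℝ) :
    ∫ ω, Finsupp.linearCombination ℝ X l ω ^ 2 ∂P =
      ∑ s ∈ l.support, ∑ t ∈ l.support, l s * l t * covFn X P s t := by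
  have hi : ∀ s t, Integrable (fun ω => X s ω * X t ω) P := fun s t =>
    (hX s).integrable_mul (hX t)
  have hexp : ∀ ω, Finsupp.linearCombination ℝ X l ω ^ 2 =
      ∑ s ∈ l.support, ∑ t ∈ l.support, l s * l t * (X s ω * X t ω) := by
    intro ω
    rw [linearCombination_apply_apply, sq, Finset.sum_mul_sum]
    exact Finset.sum_congr rfl fun s _ => Finset.sum_congr rfl fun t _ => by ring
  simp_rw [hexp]
  rw [integral_finsetSum _ fun s _ => integrable_finsetSum _ fun t _ => (hi s t).const_mul _]
  refine Finset.sum_congr rfl fun s _ => ?_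
  rw [integral_finsetSum _ fun t _ => (hi s t).const_mul _]
  exact Finset.sum_congr rfl fun t _ => integral_const_mul _ _

/-- The coefficients of `jetApprox`. -/
noncomputable def jetFinsupp (T : Finset ℝ) (c d : ℝ → ℝ) (n : ℕ) : ℝ →₀ ℝ :=
  ∑ t ∈ T, (Finsupp.single t (c t) + (Finsupp.single (t + 1 / ((n : ℝ) + 1))
    (d t * ((n : ℝ) + 1)) - Finsupp.single t (d t * ((n : ℝ) + 1))))

lemma jetApprox_eq {Ω : Type*} (X : ℝ → Ω → ℝ) (T : Finset ℝ) (c d : ℝ → ℝ) (n : ℕ) :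
    jetApprox X T c d n = Finsupp.linearCombination ℝ X (jetFinsupp T c d n) := by
  ext ω
  simp only [jetFinsupp, map_sum, map_add, map_sub, Finsupp.linearCombination_single,
    Finset.sum_apply, Pi.add_apply, Pi.sub_apply, Pi.smul_apply, smul_eq_mul, jetApprox]
  exact Finset.sum_congr rfl fun t _ => by ring

end Gram

namespace IsSpectral

variable {Ω : Type*} [MeasurableSpace Ω] {P : Measure Ω} {X : ℝ → Ω → ℝ} {F : Measure ℝ}

/-- The process `cas (t x)` on the spectral side. -/
noncomputable def casProc (t x : ℝ) : ℝ := cas (t * x)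

lemma memLp_casProc (h : IsSpectral (covFn X P) F) (t : ℝ) : MemLp (casProc t) 2 F := by
  have := h.finite
  have hc := continuous_cas
  exact MemLp.of_bound (Continuous.aestronglyMeasurable (by unfold casProc; fun_prop)) 2
    (ae_of_all _ fun x => abs_cas_le _)

lemma covFn_casProc (h : IsSpectral (covFn X P) F) : covFn casProc F = covFn X P := by
  ext s t
  rw [h.rep]; rfl

lemma hasEntireSeries_jetComb_casProc (T : Finset ℝ) (c d : ℝ → ℝ) :
    HasEntireSeries (jetComb casProc T c d) fun n => casCoeff n / n.factorial *
      ∑ t ∈ T, (c t * t ^ n + d t * (n * t ^ (n - 1))) := by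
  intro x
  have h1 : ∀ t, HasSum (fun n : ℕ => casCoeff n / n.factorial * t ^ n * x ^ n)
      (casProc t x) := fun t => by
    rw [casProc]
    simpa only [mul_pow, mul_assoc] using hasSum_cas (t * x)
  have h2 : ∀ t, HasSum (fun n : ℕ => casCoeff n / n.factorial * (n * t ^ (n - 1)) * x ^ n)
      (deriv (fun s => casProc s x) t) := fun t => by
    have e : deriv (fun s => casProc s x) t = (Real.cos (t * x) - Real.sin (t * x)) * x :=
      (hasDerivAt_cas_mul x t).deriv
    -- The factor `n` kills the term `n = 0`, so the truncated exponent `n - 1` does no harm and the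
    -- series may be shifted by one.
    rw [e, ← hasSum_nat_add_iff' 1]
    have h3 := (hasSum_deriv_cas (t * x)).mul_right x
    have e2 : ∀ n : ℕ, casCoeff (n + 1) / ((n + 1).factorial : ℝ) *
        (((n + 1 : ℕ) : ℝ) * t ^ (n + 1 - 1)) * x ^ (n + 1) =
        casCoeff (n + 1) / n.factorial * (t * x) ^ n * x := by
      intro n
      rw [Nat.factorial_succ, Nat.add_sub_cancel, mul_pow, pow_succ]
      have : (n.factorial : ℝ) ≠ 0 := by positivity
      push_cast
      field_simp
    simp_rw [e2]
    simpa using h3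
  have h3 := hasSum_sum (s := T) fun t _ => ((h1 t).mul_left (c t)).add ((h2 t).mul_left (d t))
  have e : ∀ n : ℕ, casCoeff n / n.factorial *
      (∑ t ∈ T, (c t * t ^ n + d t * (n * t ^ (n - 1)))) * x ^ n =
      ∑ t ∈ T, (c t * (casCoeff n / n.factorial * t ^ n * x ^ n) +
        d t * (casCoeff n / n.factorial * (n * t ^ (n - 1)) * x ^ n)) := by
    intro n
    rw [Finset.mul_sum, Finset.sum_mul]
    exact Finset.sum_congr rfl fun t _ => by ring
  simp_rw [e]
  exact h3

lemma differentiable_casProc (x : ℝ) : Differentiable ℝ fun t => casProc t x := fun t =>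
  (hasDerivAt_cas_mul x t).differentiableAt

/-- Equal Gram kernels make the variance of each difference-quotient combination of `X` equal to the
squared `L²(F)` norm of the same combination of `cas(t ·)`. The variances tend to `0`, so by Fatou's
lemma the limiting combination of `cas(t ·)` is `0` `F`-almost everywhere. It is entire in `x`,
hence identically zero, and its Taylor coefficients give the moment equations. -/
lemma nondegenerate (h : IsSpectral (covFn X P) F) (hX : IsGaussianProcess X P)
    (h0 : ∀ t, ∫ ω, X t ω ∂P = 0) (hd : ∀ᵐ ω ∂P, Differentiable ℝ fun t => X t ω)
    (T : Finset ℝ) (c d : ℝ → ℝ) (hz : ∀ᵐ ω ∂P, jetComb X T c d ω = 0) :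
    ∀ t ∈ T, c t = 0 ∧ d t = 0 := by
  have := hX.isProbabilityMeasure
  have hXm := memLp_two_of_gaussian hX
  have hlim := (gaussian_jetComb hX h0 hd T c d).2.2
  have hvar0 : Var[jetComb X T c d; P] = 0 := by
    have : jetComb X T c d =ᵐ[P] 0 := hz
    rw [variance_congr this, variance_zero]
  rw [hvar0] at hlim
  have hmem : ∀ n, MemLp (jetApprox casProc T c d n) 2 F := fun n => by
    rw [jetApprox_eq]
    exact memLp_linearCombination h.memLp_casProc _
  have hgram : ∀ n, Var[jetApprox X T c d n; P] = ∫ x, jetApprox casProc T c d n x ^ 2 ∂F := by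
    intro n
    rw [variance_of_integral_eq_zero (hasGaussianLaw_jetApprox hX T c d n).aemeasurable
      (integral_jetApprox hX h0 T c d n)]
    rw [jetApprox_eq, jetApprox_eq, integral_sq_linearCombination hXm,
      integral_sq_linearCombination h.memLp_casProc, h.covFn_casProc]
  simp_rw [hgram] at hlim
  have hzero : ∫⁻ x, ENNReal.ofReal (jetComb casProc T c d x ^ 2) ∂F = 0 := by
    refine le_antisymm ?_ zero_le
    calc ∫⁻ x, ENNReal.ofReal (jetComb casProc T c d x ^ 2) ∂F
        = ∫⁻ x, liminf (fun n => ENNReal.ofReal (jetApprox casProc T c d n x ^ 2)) atTop ∂F := by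
          refine lintegral_congr fun x => (Tendsto.liminf_eq ?_).symm
          exact ENNReal.tendsto_ofReal
            ((tendsto_jetApprox (differentiable_casProc x) T c d).pow 2)
      _ ≤ liminf (fun n => ∫⁻ x, ENNReal.ofReal (jetApprox casProc T c d n x ^ 2) ∂F) atTop :=
          lintegral_liminf_le' fun n => ((hmem n).1.aemeasurable.pow_const 2).ennreal_ofReal
      _ = 0 := by
          refine Tendsto.liminf_eq ?_
          simp_rw [fun n => (ofReal_integral_eq_lintegral_ofReal (hmem n).integrable_sq
            (ae_of_all _ fun x => sq_nonneg _)).symm]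
          simpa using ENNReal.tendsto_ofReal hlim
  have hser := hasEntireSeries_jetComb_casProc T c d
  have hae : ∀ᵐ x ∂F, jetComb casProc T c d x = 0 := by
    rw [lintegral_eq_zero_iff
      (hser.continuous.measurable.pow_const 2).ennreal_ofReal] at hzero
    filter_upwards [hzero] with x hx
    simpa using hx
  have hall := h.eq_zero_of_ae hser.analyticOnNhd hae
  refine eq_zero_of_moments fun n => ?_
  have := hser.coeff_eq_zero hall n
  exact (mul_eq_zero.mp this).resolve_left
    (div_ne_zero (casCoeff_ne_zero n) (by positivity))

end IsSpectral

end HighMinima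

/-! ### Smooth paths in the stationary case -/

namespace HighMinima

section Hilbert

variable {ι H G : Type*} [NormedAddCommGroup H] [InnerProductSpace ℝ H]
  [NormedAddCommGroup G] [InnerProductSpace ℝ G]

lemma norm_linearCombination_eq {v : ι → H} {w : ι → G}
    (h : ∀ i j, inner ℝ (v i) (v j) = inner ℝ (w i) (w j)) (l : ι →₀ ℝ) :
    ‖Finsupp.linearCombination ℝ w l‖ = ‖Finsupp.linearCombination ℝ v l‖ := by
  rw [← sq_eq_sq₀ (norm_nonneg _) (norm_nonneg _), ← real_inner_self_eq_norm_sq,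
    ← real_inner_self_eq_norm_sq]
  simp only [Finsupp.linearCombination_apply, Finsupp.sum, sum_inner, inner_sum, inner_smul_left,
    inner_smul_right, h]

/-- Families with the same Gram matrix are related by a bounded operator. -/
lemma exists_clm_of_inner_eq [CompleteSpace H] [CompleteSpace G] {v : ι → H} {w : ι → G}
    (h : ∀ i j, inner ℝ (v i) (v j) = inner ℝ (w i) (w j)) :
    ∃ L : H →L[ℝ] G, ∀ i, L (v i) = w i := by
  set e := Finsupp.linearCombination ℝ v with he
  set f := Finsupp.linearCombination ℝ w with hf
  set K : Submodule ℝ H := (LinearMap.range e).topologicalClosure with hK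
  have hcl : IsClosed (K : Set H) := (LinearMap.range e).isClosed_topologicalClosure
  have : CompleteSpace K := hcl.completeSpace_coe
  have hmem : ∀ l, e l ∈ K := fun l =>
    (LinearMap.range e).le_topologicalClosure (LinearMap.mem_range_self e l)
  set e' : (ι →₀ ℝ) →ₗ[ℝ] K := e.codRestrict K hmem with he'
  have hdense : DenseRange e' := by
    intro x
    rw [Metric.mem_closure_iff]
    intro ε hε
    obtain ⟨y, ⟨l, rfl⟩, hy⟩ := Metric.mem_closure_iff.mp x.2 ε hε
    exact ⟨e' l, ⟨l, rfl⟩, hy⟩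
  have hnorm : ∃ C : ℝ, ∀ l, ‖f l‖ ≤ C * ‖e' l‖ :=
    ⟨1, fun l => by rw [one_mul]; exact (norm_linearCombination_eq h l).le⟩
  -- The norm-preserving map on combinations extends to the closed span by density, and to the whole
  -- space through the orthogonal projection.
  refine ⟨(f.extendOfNorm e').comp K.orthogonalProjectionOnto, fun i => ?_⟩
  have h1 : v i = (e' (Finsupp.single i 1) : H) := by simp [he', he]
  rw [ContinuousLinearMap.comp_apply, h1, Submodule.orthogonalProjectionOnto_mem_subspace_eq_self,
    LinearMap.extendOfNorm_eq hdense hnorm]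
  simp [hf]

end Hilbert

section AlmostSure

variable {Ω : Type*} [MeasurableSpace Ω] {μ : Measure Ω} [IsFiniteMeasure μ]

/-- On a finite measure space the `L¹` norm is at most a constant times the `L²` norm, so `∑ |g_n|`
is integrable and hence finite almost everywhere. -/
lemma ae_summable_of_summable_norm {g : ℕ → Lp ℝ 2 μ} (hs : Summable fun n => ‖g n‖) :
    ∀ᵐ ω ∂μ, Summable fun n => g n ω := by
  have hfin : ∫⁻ ω, ∑' n, ‖g n ω‖ₑ ∂μ ≠ ⊤ := by
    rw [lintegral_tsum fun n => (Lp.aestronglyMeasurable (g n)).enorm]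
    have hle : ∀ n, ∫⁻ ω, ‖g n ω‖ₑ ∂μ ≤ ENNReal.ofReal ‖g n‖ * μ univ ^ (1 / 2 : ℝ) := by
      intro n
      rw [← eLpNorm_one_eq_lintegral_enorm]
      refine (eLpNorm_le_eLpNorm_mul_rpow_measure_univ (p := 1) (q := 2) (by norm_num)
        (Lp.aestronglyMeasurable (g n))).trans ?_
      rw [Lp.norm_def, ENNReal.ofReal_toReal (Lp.eLpNorm_ne_top _)]
      norm_num
    refine ne_top_of_le_ne_top ?_ (ENNReal.tsum_le_tsum hle)
    rw [ENNReal.tsum_mul_right]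
    exact ENNReal.mul_ne_top hs.tsum_ofReal_ne_top
      (ENNReal.rpow_ne_top_of_nonneg (by norm_num) (measure_ne_top _ _))
  have hm : AEMeasurable (fun ω => ∑' n, ‖g n ω‖ₑ) μ :=
    AEMeasurable.tsum fun n => (Lp.aestronglyMeasurable (g n)).enorm
  filter_upwards [ae_lt_top' hm hfin] with ω hω
  refine Summable.of_norm ?_
  exact tsum_enorm_ne_top_iff_summable_norm.mp hω.ne

/-- The `L²` limit and the pointwise limit of the partial sums are both limits in measure, so they
agree almost everywhere. -/
lemma ae_hasSum_of_summable_norm {g : ℕ → Lp ℝ 2 μ} (hs : Summable fun n => ‖g n‖) :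
    ∀ᵐ ω ∂μ, HasSum (fun n => g n ω) ((∑' n, g n : Lp ℝ 2 μ) ω) := by
  have hsum := ae_summable_of_summable_norm hs
  have h1 : TendstoInMeasure μ (fun N ω => (∑ n ∈ Finset.range N, g n : Lp ℝ 2 μ) ω) atTop
      (∑' n, g n : Lp ℝ 2 μ) :=
    tendstoInMeasure_of_tendsto_Lp hs.of_norm.hasSum.tendsto_sum_nat
  have hcoe : ∀ᵐ ω ∂μ, ∀ N, (∑ n ∈ Finset.range N, g n : Lp ℝ 2 μ) ω =
      ∑ n ∈ Finset.range N, g n ω := by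
    refine ae_all_iff.mpr fun N => ?_
    filter_upwards [Lp.coeFn_finsetSum (Finset.range N) g] with ω hω
    rw [hω, Finset.sum_apply]
  have h2 : TendstoInMeasure μ (fun N ω => (∑ n ∈ Finset.range N, g n : Lp ℝ 2 μ) ω) atTop
      (fun ω => ∑' n, g n ω) := by
    refine tendstoInMeasure_of_tendsto_ae (fun N => Lp.aestronglyMeasurable _) ?_
    filter_upwards [hsum, hcoe] with ω hω hN
    simp_rw [hN]
    exact hω.hasSum.tendsto_sum_nat
  filter_upwards [hsum, tendstoInMeasure_ae_unique h1 h2] with ω hω heq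
  rw [heq]
  exact hω.hasSum

end AlmostSure

namespace IsSpectral

variable {Ω : Type*} [MeasurableSpace Ω] {P : Measure Ω} {X : ℝ → Ω → ℝ} {F : Measure ℝ}

/-- The terms of the power series of `cas`. -/
noncomputable def casTerm (n : ℕ) (x : ℝ) : ℝ := casCoeff n / n.factorial * x ^ n

lemma abs_casTerm_le {r : ℝ} (hr : 0 < r) (n : ℕ) (x : ℝ) :
    |casTerm n x| ≤ (r⁻¹) ^ n * Real.exp (r * |x|) := by
  have h := Real.pow_div_factorial_le_exp (r * |x|) (by positivity) n
  have e : |casTerm n x| = (r⁻¹) ^ n * ((r * |x|) ^ n / n.factorial) := by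
    rw [casTerm, abs_mul, abs_div, abs_casCoeff, abs_pow, Nat.abs_cast, mul_pow, inv_pow]
    field_simp
  rw [e]
  gcongr

lemma memLp_exp_abs (h : IsSpectral (covFn X P) F) (r : ℝ) :
    MemLp (fun x => Real.exp (r * |x|)) 2 F := by
  refine (memLp_two_iff_integrable_sq (by fun_prop)).mpr ?_
  refine (h.integrable_exp_abs (2 * r)).congr (ae_of_all _ fun x => ?_)
  simp only
  rw [← Real.exp_nat_mul]
  congr 1
  push_cast
  ring

lemma memLp_casTerm (h : IsSpectral (covFn X P) F) (n : ℕ) : MemLp (casTerm n) 2 F := by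
  refine (h.memLp_exp_abs 1).mono (by unfold casTerm; fun_prop) (ae_of_all _ fun x => ?_)
  have := abs_casTerm_le one_pos n x
  simpa using this

/-- The terms of the power series of `cas` in `L²`. -/
noncomputable def casTermLp (h : IsSpectral (covFn X P) F) (n : ℕ) : Lp ℝ 2 F :=
  (h.memLp_casTerm n).toLp

/-- The rate `r` is arbitrary; taking it larger than `|t|` makes the series with powers of `t`
converge in norm. -/
lemma norm_casTermLp_le (h : IsSpectral (covFn X P) F) {r : ℝ} (hr : 0 < r) (n : ℕ) :
    ‖h.casTermLp n‖ ≤ (r⁻¹) ^ n * ‖(h.memLp_exp_abs r).toLp‖ := by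
  refine Lp.norm_le_mul_norm_of_ae_le_mul ?_
  filter_upwards [(h.memLp_casTerm n).coeFn_toLp, (h.memLp_exp_abs r).coeFn_toLp] with x h1 h2
  rw [casTermLp, h1, h2, Real.norm_of_nonneg (Real.exp_pos _).le]
  exact abs_casTerm_le hr n x

lemma summable_norm_casTermLp (h : IsSpectral (covFn X P) F) (t : ℝ) :
    Summable fun n => |t| ^ n * ‖h.casTermLp n‖ := by
  set r := |t| + 1
  have hr : 0 < r := by positivity
  have hlt : |t| * r⁻¹ < 1 := by
    rw [← div_eq_mul_inv, div_lt_one hr]; exact lt_add_one _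
  refine Summable.of_nonneg_of_le (fun n => by positivity) (fun n => ?_)
    ((summable_geometric_of_lt_one (by positivity) hlt).mul_right ‖(h.memLp_exp_abs r).toLp‖)
  rw [mul_pow, mul_assoc]
  exact mul_le_mul_of_nonneg_left (h.norm_casTermLp_le hr n) (by positivity)

lemma tsum_casTermLp (h : IsSpectral (covFn X P) F) (t : ℝ) :
    ∑' n, t ^ n • h.casTermLp n = (h.memLp_casProc t).toLp := by
  have := h.finite
  have hs : Summable fun n => ‖t ^ n • h.casTermLp n‖ := by
    simpa only [norm_smul, norm_pow, Real.norm_eq_abs] using h.summable_norm_casTermLp t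
  refine Lp.ext ?_
  have hcoe : ∀ᵐ x ∂F, ∀ n, (t ^ n • h.casTermLp n : Lp ℝ 2 F) x = t ^ n * casTerm n x := by
    refine ae_all_iff.mpr fun n => ?_
    filter_upwards [Lp.coeFn_smul (t ^ n) (h.casTermLp n),
      (h.memLp_casTerm n).coeFn_toLp] with x h1 h2
    rw [h1, Pi.smul_apply, casTermLp, h2, smul_eq_mul]
  filter_upwards [ae_hasSum_of_summable_norm hs, hcoe, (h.memLp_casProc t).coeFn_toLp]
    with x h1 h2 h3
  rw [h3]
  refine h1.unique ?_
  simp_rw [h2]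
  have := hasSum_cas (t * x)
  rw [casProc]
  convert this using 2 with n
  rw [casTerm, mul_pow]
  ring

/-- The map `cas(t ·) ↦ X_t` preserves inner products and so comes from a bounded operator. Its
values on the terms of the power series of `cas` are the random coefficients. The exceptional null
set may still depend on `t`. -/
lemma exists_ae_hasSum [IsProbabilityMeasure P] (h : IsSpectral (covFn X P) F)
    (hX : ∀ t, MemLp (X t) 2 P) :
    ∃ η : ℕ → Ω → ℝ, ∀ t, ∀ᵐ ω ∂P, HasSum (fun n => η n ω * t ^ n) (X t ω) := by
  have hinner : ∀ s t, inner ℝ (h.memLp_casProc s).toLp (h.memLp_casProc t).toLp =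
      inner ℝ (hX s).toLp (hX t).toLp := by
    intro s t
    rw [L2.inner_def, L2.inner_def]
    have h1 : covFn casProc F s t = covFn X P s t := by rw [h.covFn_casProc]
    have h2 : ∫ x, inner ℝ ((h.memLp_casProc s).toLp (casProc s) x)
        ((h.memLp_casProc t).toLp (casProc t) x) ∂F =
        covFn casProc F s t := by
      refine integral_congr_ae ?_
      filter_upwards [(h.memLp_casProc s).coeFn_toLp, (h.memLp_casProc t).coeFn_toLp] with x h1 h2
      rw [h1, h2, real_inner_comm]; rfl
    have h3 : ∫ x, inner ℝ ((hX s).toLp (X s) x) ((hX t).toLp (X t) x) ∂P = covFn X P s t := by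
      refine integral_congr_ae ?_
      filter_upwards [(hX s).coeFn_toLp, (hX t).coeFn_toLp] with x h1 h2
      rw [h1, h2, real_inner_comm]; rfl
    rw [h2, h3, h1]
  obtain ⟨L, hL⟩ := exists_clm_of_inner_eq hinner
  refine ⟨fun n => L (h.casTermLp n), fun t => ?_⟩
  have hs0 : Summable fun n => ‖t ^ n • h.casTermLp n‖ := by
    simpa only [norm_smul, norm_pow, Real.norm_eq_abs] using h.summable_norm_casTermLp t
  have hs : Summable fun n => ‖t ^ n • L (h.casTermLp n)‖ := by
    refine Summable.of_nonneg_of_le (fun n => norm_nonneg _) (fun n => ?_) (hs0.mul_left ‖L‖)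
    rw [← map_smul]
    exact L.le_opNorm _
  have htsum : ∑' n, t ^ n • L (h.casTermLp n) = (hX t).toLp := by
    simp_rw [← map_smul]
    rw [← L.map_tsum hs0.of_norm, h.tsum_casTermLp, hL]
  have hcoe : ∀ᵐ ω ∂P, ∀ n, (t ^ n • L (h.casTermLp n) : Lp ℝ 2 P) ω =
      L (h.casTermLp n) ω * t ^ n := by
    refine ae_all_iff.mpr fun n => ?_
    filter_upwards [Lp.coeFn_smul (t ^ n) (L (h.casTermLp n))] with ω h1
    rw [h1, Pi.smul_apply, smul_eq_mul, mul_comm]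
  filter_upwards [ae_hasSum_of_summable_norm hs, hcoe, (hX t).coeFn_toLp] with ω h1 h2 h3
  rw [htsum, h3] at h1
  simpa only [h2] using h1

/-- Off one null set the expansion holds at all rational `t`. Convergence at the natural numbers
makes the series entire, and the continuous path agrees with it on the rationals, hence everywhere.
-/
lemma ae_smooth (h : IsSpectral (covFn X P) F) (hX : IsCenteredContinuousGaussian X P) :
    ∀ᵐ ω ∂P, ContDiff ℝ ((⊤ : ℕ∞) : WithTop ℕ∞) fun t => X t ω := by
  have := hX.gaussian.isProbabilityMeasure
  obtain ⟨η, hη⟩ := h.exists_ae_hasSum (memLp_two_of_gaussian hX.gaussian)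
  have hq : ∀ᵐ ω ∂P, ∀ q : ℚ, HasSum (fun n => η n ω * (q : ℝ) ^ n) (X q ω) :=
    ae_all_iff.mpr fun q => hη q
  filter_upwards [hq, hX.continuous_paths] with ω hω hc
  have hser : HasEntireSeries (fun t => ∑' n, η n ω * t ^ n) (fun n => η n ω) := by
    intro t
    obtain ⟨N, hN⟩ := exists_nat_ge |t|
    have h1 := (hω N).summable.norm
    refine (Summable.of_norm_bounded h1 fun n => ?_).hasSum
    rw [norm_mul, norm_mul, norm_pow, norm_pow, Rat.cast_natCast, Real.norm_eq_abs t,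
      Real.norm_of_nonneg (Nat.cast_nonneg N)]
    gcongr
  have heq : (fun t => X t ω) = fun t => ∑' n, η n ω * t ^ n := by
    refine Continuous.ext_on Rat.isDenseEmbedding_coe_real.dense hc hser.continuous ?_
    rintro _ ⟨q, rfl⟩
    exact (hω q).tsum_eq.symm
  rw [heq]
  exact hser.contDiff

end IsSpectral

lemma AssumptionB.smoothLaw {Ω : Type*} [MeasurableSpace Ω] {P : Measure Ω} {X : ℝ → Ω → ℝ}
    (h : AssumptionB X P) (hX : IsCenteredContinuousGaussian X P) (a b : ℝ) :
    SmoothLaw X P a b := by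
  obtain ⟨F, hF⟩ := h.exists_isSpectral
  have hs := hF.ae_smooth hX
  refine ⟨hs, hF.hasPowerExpansion, hF.nondegenerate hX.gaussian hX.centered ?_,
    fun ν hν => hF.energy_pos hν, fun ν hν V _ => hF.potential_ne_const hν V⟩
  filter_upwards [hs] with ω hω using hω.differentiable (by simp)

end HighMinima

/-! ### Transfer to the given version and conclusion -/

namespace HighMinima

section Transfer

variable {Ω : Type*} [MeasurableSpace Ω] {P : Measure Ω} {X X' : ℝ → Ω → ℝ} {S E : Finset ℝ}
  {a b : ℝ}

lemma procZ_congr (h : ∀ᵐ ω ∂P, ∀ t, X' t ω = X t ω) :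
    ∀ᵐ ω ∂P, ∀ t, procZ X' P S t ω = procZ X P S t ω := by
  filter_upwards [h] with ω hω t
  simp only [procZ, procY, covFn_congr h, hω]

lemma randW_congr (h : ∀ᵐ ω ∂P, ∀ t, X' t ω = X t ω) :
    randW X' P S E a b =ᵐ[P] randW X P S E a b := by
  filter_upwards [procZ_congr (S := S) h] with ω hω
  simp only [randW, wInt, wLeft, wRight, derivZ, covFn_congr h, hω]
  congr!

lemma probMinGt_congr (h : ∀ᵐ ω ∂P, ∀ t, X' t ω = X t ω) (K : Set ℝ) (u : ℝ) :
    probMinGt X' P K u = probMinGt X P K u := by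
  refine measureReal_congr ?_
  filter_upwards [h] with ω hω
  refine congrArg (u < ·) ?_
  simp only [minOver, hω]

end Transfer

end HighMinima

theorem theorem4p1 {Ω : Type*} [MeasurableSpace Ω] (P : Measure Ω) [IsProbabilityMeasure P]
    (X : ℝ → Ω → ℝ) (hX : HighMinima.IsCenteredContinuousGaussian X P)
    (a b : ℝ) (hab : a < b)
    (h : HighMinima.AssumptionA X P a b ∨ HighMinima.AssumptionB X P) :
    -- the optimal measure `ν`, its support `S` and the essential set `E`
    ∃ (ν : Measure ℝ) (S E : Finset ℝ),
      (HighMinima.IsOptimal (HighMinima.covFn X P) a b ν ∧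
        ∀ ν', HighMinima.IsOptimal (HighMinima.covFn X P) a b ν' → ν' = ν) ∧
      (S : Set ℝ) = ν.support ∧
      (E : Set ℝ) = HighMinima.essentialSet (HighMinima.covFn X P) S a b ∧
      -- the objects in the formulas are meaningful
      (∀ t, HighMinima.procY X P S t =ᵐ[P]
        P[X t | MeasurableSpace.comap (fun ω (s : S) => X s ω) MeasurableSpace.pi]) ∧
      (∀ᵐ ω ∂P, ContDiff ℝ ((⊤ : ℕ∞) : WithTop ℕ∞) fun t => HighMinima.procZ X P S t ω) ∧
      Integrable (HighMinima.randW X P S E a b) P ∧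
      (∀ u, 0 < HighMinima.probMinGt X P S u) ∧
      (∀ s, 0 < HighMinima.theta (HighMinima.covFn X P) S s) ∧
      0 < (HighMinima.covMatrix (HighMinima.covFn X P) S).det ∧
      0 < HighMinima.energy (HighMinima.covFn X P) ν ∧
      -- the asymptotic equivalences
      Tendsto (fun u => HighMinima.probMinGt X P (Icc a b) u / HighMinima.probMinGt X P S u)
        atTop (𝓝 (∫ ω, HighMinima.randW X P S E a b ω ∂P)) ∧
      Tendsto (fun u : ℝ => HighMinima.probMinGt X P (Icc a b) u /
          ((u ^ S.card)⁻¹ *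
            Real.exp (-(u ^ 2 / (2 * HighMinima.energy (HighMinima.covFn X P) ν)))))
        atTop (𝓝 ((∫ ω, HighMinima.randW X P S E a b ω ∂P) /
          ((2 * Real.pi) ^ ((S.card : ℝ) / 2) *
            (∏ s : S, HighMinima.theta (HighMinima.covFn X P) S s) *
            Real.sqrt (HighMinima.covMatrix (HighMinima.covFn X P) S).det))) ∧
      -- positivity of the constant
      (0 < ∫ ω, HighMinima.randW X P S E a b ω ∂P ↔
        ∀ t ∈ (S : Set ℝ) ∩ Ioo a b,
          0 < iteratedDeriv 2 (HighMinima.mu (HighMinima.covFn X P) S) t) := by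
  open HighMinima in
  have hL : SmoothLaw X P a b := h.elim (fun h => h.smoothLaw hX) fun h => h.smoothLaw hX a b
  obtain ⟨X', hX', hae⟩ := hL.exists_smoothModel hX
  obtain ⟨ν, S, hO⟩ := hX'.exists_optimal hab
  have hE : ((hO.finite_essential.toFinset : Finset ℝ) : Set ℝ) =
      essentialSet (covFn X' P) S a b := hO.finite_essential.coe_toFinset
  set E := hO.finite_essential.toFinset
  have hcov : covFn X' P = covFn X P := covFn_congr hae
  have hW : randW X' P S E a b =ᵐ[P] randW X P S E a b := randW_congr hae
  have h_int := hX'.integrable_randW (E := E) hab hO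
  have hpos := hX'.probMinGt_finset_pos hO.nonempty hO.posDef
  have hlim1 := hX'.tendsto_ratio hab hO hE
  have hlim2 := hX'.tendsto_probMinGt_Icc hab hO hE
  have hiff := hX'.integral_randW_pos_iff (E := E) hab hO
  -- Everything proved for the smooth version depends only on the covariance, on probabilities and
  -- on almost sure identities, so it holds for `X`.
  simp only [probMinGt_congr hae, integral_congr_ae hW, hcov] at hpos hlim1 hlim2 hiff
  rw [hcov] at hE hO
  refine ⟨ν, S, E, ⟨hO.optimal, hO.unique⟩, hO.support_eq, hE,
    procY_ae_eq_condExp hX.gaussian hX.measurable hX.centered hO.posDef, ?_, h_int.congr hW, hpos,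
    hO.theta_pos, hO.posDef.det_pos, hO.energy_pos, hlim1, hlim2, hiff⟩
  filter_upwards [procZ_congr (S := S) hae] with ω hω
  simpa only [hω] using hX'.contDiff_procZ (S := S) ω
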